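/- **Setting.** Greek indices run over $0,\dots,3$, Latin ones over $1,2,3$, repeated indices are summed, $\eta=\mathrm{diag}(1,-1,-1,-1)$. Fix an emission event $x_A=(x_A^0,\mathbf x_A)$, an open set $\mathcal M$ of events, and an open set $D\subset\mathbb R^3$ of reception positions with $\mathbf x_A\notin D$, star-shaped about $\mathbf x_A$ (if $\mathbf x\in D$ and $0<\mu\le1$ then $\mathbf x_A+\mu(\mathbf x-\mathbf x_A)\in D$). Let $(N_0,G)$ range over an open neighbourhood $P$ of $(0,0)$ in $\mathbb R^2$. Let $g_{\mu\nu}=\eta_{\mu\nu}+h_{\mu\nu}(x,G)$ be an invertible symmetric metric on $\mathcal M$ with $h(x,0)=0$, and set $k^{\mu\nu}=g^{\mu\nu}-\eta^{\mu\nu}$; let $\kappa^{\mu\nu}(x,N_0)=(n^2-1)w^\mu w^\nu$, where $n=n(x,N_0)$ is the refractive index, $n(x,0)=1$, and $w=w(x,N_0)$ is the velocity of the medium; $h$ and $\kappa$ are $C^\infty$ in the parameters and in $x$. The optical metric is $\bar g^{\mu\nu}=\eta^{\mu\nu}+k^{\mu\nu}+\kappa^{\mu\nu}$. Write $h^{(l)}_{\mu\nu}$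 and $\kappa^{\mu\nu}_{(l)}$ for the terms proportional to $G^l$ and $N_0^l$ in the expansions of $h$ and $\kappa$, and $$k_{(1)}^{\mu\nu}=-\eta^{\mu\alpha}\eta^{\beta\nu}h^{(1)}_{\alpha\beta},\qquad k_{(l)}^{\mu\nu}=-\eta^{\mu\alpha}\eta^{\beta\nu}h^{(l)}_{\alpha\beta}-\sum_{m=1}^{l-1}\eta^{\mu\alpha}h^{(m)}_{\alpha\beta}k_{(l-m)}^{\beta\nu}\quad(l\ge2).$$ **Delay functions.** For every $(N_0,G)\in P$ let $\mathcal R_e(x_A,\mathbf x)$, $\mathbf x\in D$, be the emission range transfer function: a family of null geodesics of $\bar g$ lying in $\mathcal M$, of class $C^2$ in $\mathbf x$ and the affine parameter (with wave covectors of class $C^1$), joins $x_A$ to the events $(x_A^0+\mathcal R_e(x_A,\mathbf x),\mathbf x)$; also $\mathcal R_e(x_A,\mathbf x_A)=0$. Let $\Xi=\mathcal R_e-|\mathbf x-\mathbf x_A|$. For $\mathbf x_B\in D$ put $R_{AB}=|\mathbf x_B-\mathbf x_A|$, $\mathbf N_{AB}=(\mathbf x_B-\mathbf x_A)/R_{AB}$,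 $\mathbf z_+(\mu)=\mathbf x_A+\mu R_{AB}\mathbf N_{AB}$, $z_+(\mu)=(x_A^0+\mu R_{AB},\mathbf z_+(\mu))$ and $\widetilde z_+(\mu)=(x_A^0+\mu R_{AB}+\Xi(x_A,\mathbf z_+(\mu)),\mathbf z_+(\mu))$. The gravitational delay $\Xi_{\mathrm g}$ (with $K=k$) and the refractive delay $\Xi_{\mathrm r}$ (with $K=\kappa$) are solutions $u$ on $D$ of $$u(\mathbf x_B)=\frac{R_{AB}}2\int_0^1\Big\{\big(K^{00}-2K^{0i}N^i_{AB}+K^{ij}N^i_{AB}N^j_{AB}\big)_{\widetilde z_+}-2\big(K^{0i}-K^{ij}N^j_{AB}\big)_{\widetilde z_+}\big[\partial_iu\big]_{\mathbf z_+}+\big(\eta^{ij}+K^{ij}\big)_{\widetilde z_+}\big[\partial_iu\,\partial_ju\big]_{\mathbf z_+}\Big\}d\mu ,$$ and the coupling delay is $\Xi_{\mathrm{gr}}=\Xi-\Xi_{\mathrm g}-\Xi_{\mathrm r}$. Quasi-Minkowskian regime: each of $\Xi,\Xi_{\mathrm g},\Xi_{\mathrm r}$ vanishes on $D$ for $(N_0,G)=(0,0)$,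 and its value at $\mathbf x_A+\mu\mathbf v$ is a $C^\infty$ function of $(N_0,G,\mu,\mathbf v)$ for $(N_0,G)\in P$, $0\le\mu\le1$, $\mathbf x_A+\mathbf v\in D$. **Theorem.** Let $s\ge1$ be an integer; count $N_0$ as of order $\varepsilon$ and $G$ as of order $\varepsilon^s$. There are functions $\Xi_{\mathrm r}^{(l)},\Xi_{\mathrm g}^{(l)},\Xi_{\mathrm{gr}}^{(l)}$, $l\ge1$, of $(\mathbf x,N_0,G)$, such that, with $$\Xi^{(l)}=\Xi_{\mathrm r}^{(l)}+\Theta(l-s)\,\Xi_{\mathrm g}^{(l-s+1)}+\Theta(l-s-1)\,\Xi_{\mathrm{gr}}^{(l-s)},\qquad \Theta(i)=1\ (i\ge0),\ 0\ (i<0),$$ one has, on $D$, $$\Xi=\sum_{l\ge1}\Xi^{(l)},\quad \Xi_{\mathrm r}=\sum_{l\ge1}\Xi_{\mathrm r}^{(l)},\quad \Xi_{\mathrm g}=\sum_{l\ge1}\Xi_{\mathrm g}^{(l)},\quad \Xi_{\mathrm{gr}}=\sum_{l\ge1}\Xi_{\mathrm{gr}}^{(l)} .$$ Each of these expansions means the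 following, at every $\mathbf x\in D$ and for every fixed $(N_0,G)\in\mathbb R^2$ along $(\varepsilon N_0,\varepsilon^sG)$. The $l$-th term is equal to $\varepsilon^{l+a}$ times its value at $(N_0,G)$, with $a=0,0,s-1,s$ respectively. The function minus the sum of the first $L$ terms is $O(\varepsilon^{L+a+1})$ as $\varepsilon\to0$, for every $L\ge0$. If the function is analytic in $\varepsilon$ at $0$, the series converges to it for all small $\varepsilon$. For all $(N_0,G)$ the terms are given on $D$ by the line integrals below along $z_+(\mu)$. Put $$\Phi_+^{(l,m)}=\frac1{m!}\sum_{n_1+\dots+n_m=l-m}\ \prod_{d=1}^m\Xi^{(n_d+1)}\quad(n_d\ge0),\qquad \widehat\kappa_{(l)}=\kappa_{(l)}+\sum_{m=1}^{l-1}\sum_{n=1}^m\Phi_+^{(m,n)}\partial_0^n\kappa_{(l-m)},$$ and, for $l=ps+q\ge s$ with $p=\lfloor l/s\rfloor$ and $0\le q<s$, $$\widehat k_{(l)}=\delta_{q0}\,k_{(p)}+\sum_{n=1}^{q}\Phi_+^{(q,n)}\partial_0^nk_{(p)}+\sum_{m=1}^{p-1}\sum_{n=1}^{ms+q}\Phi_+^{(ms+q,n)}\partial_0^nk_{(p-m)}.$$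 Under the integral signs $\kappa_{(l)},k_{(l)}$ and their time derivatives are taken at $z_+(\mu)$, and $\Phi_+$ and the spatial derivatives at $\mathbf z_+(\mu)$. Write $\mathsf s(K)=K^{00}-2K^{0i}N^i_{AB}+K^{ij}N^i_{AB}N^j_{AB}$, $\mathsf l(K;u)=(K^{0i}-K^{ij}N_{AB}^j)\,\partial_iu$, $\mathsf q(K;u,v)=K^{ij}\,\partial_iu\,\partial_jv$, and abbreviate $r_l=\Xi_{\mathrm r}^{(l)}$, $g_l=\Xi_{\mathrm g}^{(l)}$, $c_l=\Xi_{\mathrm{gr}}^{(l)}$. Empty sums are $0$. Then for all $l\ge1$: $$r_l=\frac{R_{AB}}2\int_0^1\Big\{\mathsf s(\widehat\kappa_{(l)})-2\sum_{m=1}^{l-1}\mathsf l(\widehat\kappa_{(m)};r_{l-m})+\sum_{m=1}^{l-1}\mathsf q(\eta;r_m,r_{l-m})+\sum_{m=1}^{l-2}\sum_{n=1}^{l-m-1}\mathsf q(\widehat\kappa_{(m)};r_n,r_{l-m-n})\Big\}d\mu ,$$ $$g_l=\frac{R_{AB}}2\int_0^1\Big\{\mathsf s(\widehat k_{(s+l-1)})-2\sum_{m=s}^{l-1}\mathsf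 l(\widehat k_{(m)};g_{l-m})+\sum_{m=1}^{l-s}\mathsf q(\eta;g_m,g_{l-s-m+1})+\sum_{m=s}^{l-s-1}\sum_{n=1}^{l-s-m}\mathsf q(\widehat k_{(m)};g_n,g_{l-s-m-n+1})\Big\}d\mu ,$$ and $\Xi_{\mathrm{gr}}^{(l)}=c_l$ is the sum of those of the following contributions whose threshold on $l$ is met. * $l\ge1$: $\;R_{AB}\int_0^1\{\sum_{m=1}^{l}\mathsf q(\eta;r_m,g_{l-m+1})-\sum_{m=1}^{l}\mathsf l(\widehat\kappa_{(m)};g_{l-m+1})-\sum_{m=s}^{l+s-1}\mathsf l(\widehat k_{(m)};r_{l+s-m})\}\,d\mu$ * $l\ge2$: $\;R_{AB}\int_0^1\{\sum_{m=1}^{l-1}\mathsf q(\eta;r_m,c_{l-m})-\sum_{m=1}^{l-1}\mathsf l(\widehat\kappa_{(m)};c_{l-m})+\sum_{m=1}^{l-1}\sum_{n=1}^{l-m}\mathsf q(\widehat\kappa_{(m)};r_n,g_{l-m-n+1})+\frac12\sum_{m=s}^{l+s-2}\sum_{n=1}^{l+s-m-1}\mathsf q(\widehat k_{(m)};r_n,r_{l+s-m-n})\}\,d\mu$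 * $l\ge3$: $\;R_{AB}\int_0^1\sum_{m=1}^{l-2}\sum_{n=1}^{l-m-1}\mathsf q(\widehat\kappa_{(m)};r_n,c_{l-m-n})\,d\mu$ * $l\ge s+1$: $\;R_{AB}\int_0^1\{\sum_{m=1}^{l-s}\mathsf q(\eta;g_m,c_{l-s-m+1})-\sum_{m=s}^{l-1}\mathsf l(\widehat k_{(m)};c_{l-m})+\sum_{m=s}^{l-1}\sum_{n=1}^{l-m}\mathsf q(\widehat k_{(m)};r_n,g_{l-m-n+1})+\frac12\sum_{m=1}^{l-s}\sum_{n=1}^{l-s-m+1}\mathsf q(\widehat\kappa_{(m)};g_n,g_{l-s-m-n+2})\}\,d\mu$ * $l\ge s+2$: $\;\frac{R_{AB}}2\int_0^1\{\sum_{m=1}^{l-s-1}\mathsf q(\eta;c_m,c_{l-s-m})+2\sum_{m=s}^{l-2}\sum_{n=1}^{l-m-1}\mathsf q(\widehat k_{(m)};r_n,c_{l-m-n})+2\sum_{m=1}^{l-s-1}\sum_{n=1}^{l-s-m}\mathsf q(\widehat\kappa_{(m)};g_n,c_{l-s-m-n+1})\}\,d\mu$ * $l\ge s+3$: $\;\frac{R_{AB}}2\int_0^1\sum_{m=1}^{l-s-2}\sum_{n=1}^{l-s-m-1}\mathsf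 q(\widehat\kappa_{(m)};c_n,c_{l-s-m-n})\,d\mu$ * $l\ge2s+1$: $\;R_{AB}\int_0^1\sum_{m=s}^{l-s-1}\sum_{n=1}^{l-s-m}\mathsf q(\widehat k_{(m)};g_n,c_{l-s-m-n+1})\,d\mu$ * $l\ge2s+2$: $\;\frac{R_{AB}}2\int_0^1\sum_{m=s}^{l-s-2}\sum_{n=1}^{l-s-m-1}\mathsf q(\widehat k_{(m)};c_n,c_{l-s-m-n})\,d\mu$ -/

import Mathlib

open scoped ContDiff Topology Matrix

noncomputable section

namespace OpticalDelay

/-! ### Coordinates -/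

/-- Spatial coordinates, with the Euclidean norm. -/
abbrev Space : Type := EuclideanSpace ℝ (Fin 3)

/-- Point events `(x⁰, x¹, x², x³)`. -/
abbrev Event : Type := Fin 4 → ℝ

/-- Components of a rank two tensor. The index `0` is the time index and `i.succ`, `i : Fin 3`,
are the spatial ones. -/
abbrev Tensor : Type := Matrix (Fin 4) (Fin 4) ℝ

/-- The event with time component `t` and spatial components `x`. -/
def event (t : ℝ) (x : Space) : Event := Fin.cons t (fun i => x i)

/-- `η = diag(1, -1, -1, -1)`. -/
def minkowski : Tensor := Matrix.diagonal (Fin.cons 1 (fun _ => -1))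

/-- The spatial gradient `(∂f/∂xⁱ)ᵢ` at `x`. -/
def grad (f : Space → ℝ) (x : Space) (i : Fin 3) : ℝ :=
  fderiv ℝ f x (EuclideanSpace.single i 1)

/-- `∂f/∂x^α` at the event `y`. -/
def partialDeriv (α : Fin 4) (f : Event → ℝ) (y : Event) : ℝ :=
  fderiv ℝ f y (Pi.single α 1)

/-- `∂ⁿf/(∂x⁰)ⁿ` at the event `y`. -/
def timeDeriv (n : ℕ) (f : Event → ℝ) (y : Event) : ℝ :=
  iteratedDeriv n (fun t => f (Function.update y 0 t)) (y 0)

/-! ### The optical metric -/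

/-- The contravariant gravitational perturbation `k = g⁻¹ - η` of the metric `g = η + h`,
for the value `G` of the gravitational parameter. -/
def gravPert (h : ℝ → Event → Tensor) (G : ℝ) (y : Event) : Tensor :=
  (minkowski + h G y)⁻¹ - minkowski

/-- The contravariant refractive perturbation `κ^{αβ} = (n² - 1) w^α w^β`, for the value `N₀` of
the refractivity parameter. -/
def refrPert (n : ℝ → Event → ℝ) (w : ℝ → Event → Fin 4 → ℝ) (N₀ : ℝ) (y : Event) : Tensor :=
  Matrix.of fun α β => (n N₀ y ^ 2 - 1) * w N₀ y α * w N₀ y β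

/-- The contravariant optical metric `η + k + κ`, for the parameters `p = (N₀, G)`. -/
def opticalInv (h : ℝ → Event → Tensor) (n : ℝ → Event → ℝ) (w : ℝ → Event → Fin 4 → ℝ)
    (p : ℝ × ℝ) (y : Event) : Tensor :=
  minkowski + gravPert h p.2 y + refrPert n w p.1 y

/-- The term of order `l` of the expansion of `h` in powers of `G`. -/
def hTerm (h : ℝ → Event → Tensor) (G : ℝ) (l : ℕ) (y : Event) : Tensor :=
  Matrix.of fun α β => G ^ l / (l.factorial : ℝ) * iteratedDeriv l (fun u => h u y α β) 0

/-- `k₍₁₎ = -η H₁ η` and `k₍ₗ₎ = -η Hₗ η - ∑_{1 ≤ m ≤ l-1} η Hₘ k₍ₗ₋ₘ₎` (index `m + 1` below). -/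
def contraTerm (H : ℕ → Tensor) : ℕ → Tensor
  | 0 => 0
  | l + 1 => -(minkowski * H (l + 1) * minkowski)
      - ∑ m : Fin l, minkowski * H (m + 1) * contraTerm H (l - m)
  termination_by l => l
  decreasing_by omega

/-- The term `k₍ₗ₎` of the post-Minkowskian expansion of `k`. -/
def kTerm (h : ℝ → Event → Tensor) (G : ℝ) (l : ℕ) (y : Event) : Tensor :=
  contraTerm (fun m => hTerm h G m y) l

/-- The term `κ₍ₗ₎`, proportional to `N₀ˡ`, of the expansion of `κ` in powers of `N₀`. -/
def kappaTerm (n : ℝ → Event → ℝ) (w : ℝ → Event → Fin 4 → ℝ) (N₀ : ℝ) (l : ℕ) (y : Event) :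
    Tensor :=
  Matrix.of fun α β =>
    N₀ ^ l / (l.factorial : ℝ) * iteratedDeriv l (fun u => refrPert n w u y α β) 0

/-! ### Light rays and the emission range transfer function -/

/-- `γ` restricted to `[0,1]` is a light ray in `M`, with wave covector `k`: the tangent is
`g^{αβ} k_β`, it is null, and `dk_α/dσ = -½ ∂_α g^{βδ} k_β k_δ`, which is the geodesic equation
of the metric whose contravariant components are `ginv`. -/
structure IsLightRay (ginv : Event → Tensor) (M : Set Event)
    (γ : ℝ → Event) (k : ℝ → Fin 4 → ℝ) : Prop where
  mem : ∀ σ ∈ Set.Icc (0 : ℝ) 1, γ σ ∈ M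
  ne_zero : ∀ σ ∈ Set.Icc (0 : ℝ) 1, k σ ≠ 0
  tangent : ∀ σ ∈ Set.Icc (0 : ℝ) 1, HasDerivAt γ (ginv (γ σ) *ᵥ k σ) σ
  null : ∀ σ ∈ Set.Icc (0 : ℝ) 1, k σ ⬝ᵥ (ginv (γ σ) *ᵥ k σ) = 0
  geodesic : ∀ σ ∈ Set.Icc (0 : ℝ) 1, ∀ α, HasDerivAt (fun τ => k τ α)
    (-(1 / 2) * ∑ β, ∑ δ, partialDeriv α (fun y => ginv y β δ) (γ σ) * k σ β * k σ δ) σ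

/-- `R` is the emission range transfer function on `D` of a congruence of light rays issued from
the event `x_A = (tA, xA)`: for `x ∈ D`, the ray of the congruence that arrives at the position
`x` does so at the time component `tA + R x`. The congruence depends smoothly on `x`. -/
def IsEmissionRange (ginv : Event → Tensor) (M : Set Event) (tA : ℝ) (xA : Space) (D : Set Space)
    (R : Space → ℝ) : Prop :=
  ∃ (γ : Space → ℝ → Event) (k : Space → ℝ → Fin 4 → ℝ) (O : Set (Space × ℝ)),
    IsOpen O ∧ D ×ˢ Set.Icc (0 : ℝ) 1 ⊆ O ∧
    ContDiffOn ℝ 2 (fun q : Space × ℝ => γ q.1 q.2) O ∧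
    ContDiffOn ℝ 1 (fun q : Space × ℝ => k q.1 q.2) O ∧
    ∀ x ∈ D, IsLightRay ginv M (γ x) (k x) ∧
      γ x 0 = event tA xA ∧ γ x 1 = event (tA + R x) x

/-- Admissible domains of reception positions: open, without the emission position, and
star-shaped with respect to it. -/
structure IsReceptionDomain (xA : Space) (D : Set Space) : Prop where
  isOpen : IsOpen D
  notMem : xA ∉ D
  star : ∀ x ∈ D, ∀ μ ∈ Set.Ioc (0 : ℝ) 1, xA + μ • (x - xA) ∈ D

/-- The emission delay function `Ξ = R - |x - x_A|`. -/
def delay (xA : Space) (R : Space → ℝ) (x : Space) : ℝ := R x - ‖x - xA‖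

/-- Quasi-Minkowskian regime for a delay function `f` depending on the parameters
`p = (N₀, G) ∈ P`: it vanishes for the Minkowskian path, which corresponds to `p = 0`, and it is a
smooth function of `p`, of the direction of `x - x_A` and of the distance to `x_A` (up to distance
zero; a delay function is in general not differentiable at `x_A` itself). -/
structure IsQuasiMinkowskian (xA : Space) (D : Set Space) (P : Set (ℝ × ℝ))
    (f : ℝ × ℝ → Space → ℝ) : Prop where
  zero : ∀ x ∈ D, f 0 x = 0
  smooth : ContDiffOn ℝ ∞
    (fun q : (ℝ × ℝ) × ℝ × Space => f q.1 (xA + q.2.1 • q.2.2))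
    (P ×ˢ Set.Icc (0 : ℝ) 1 ×ˢ {v : Space | xA + v ∈ D})

/-! ### Integrodifferential equations of the separate delays -/

/-- `N_AB`, the unit vector from `xA` to `x`. -/
def dir (xA x : Space) : Space := (‖x - xA‖)⁻¹ • (x - xA)

/-- The straight segment `z₊(μ) = x_A + μ R_AB N_AB` (spatial components). -/
def seg (xA x : Space) (μ : ℝ) : Space := xA + μ • (x - xA)

/-- `K⁰⁰ - 2 K⁰ⁱ Nⁱ + Kⁱʲ Nⁱ Nʲ`. -/
def source (K : Tensor) (N : Space) : ℝ :=
  K 0 0 - 2 * ∑ i : Fin 3, K 0 i.succ * N i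
    + ∑ i : Fin 3, ∑ j : Fin 3, K i.succ j.succ * N i * N j

/-- `(K⁰ⁱ - Kⁱʲ Nʲ) uᵢ`. -/
def lin (K : Tensor) (N : Space) (u : Fin 3 → ℝ) : ℝ :=
  ∑ i : Fin 3, (K 0 i.succ - ∑ j : Fin 3, K i.succ j.succ * N j) * u i

/-- `Kⁱʲ uᵢ vⱼ`. -/
def quad (K : Tensor) (u v : Fin 3 → ℝ) : ℝ :=
  ∑ i : Fin 3, ∑ j : Fin 3, K i.succ j.succ * u i * v j

/-- The integrodifferential equation which determines the part `u` of the total delay `Ξ` that is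
driven by the single perturbation `K`. The perturbation is taken along the actual path
`(tA + μ R_AB + Ξ(z₊(μ)), z₊(μ))`. -/
def IsDelayDrivenBy (K : Event → Tensor) (tA : ℝ) (xA : Space) (D : Set Space)
    (Ξ u : Space → ℝ) : Prop :=
  ∀ x ∈ D, u x = ‖x - xA‖ / 2 * ∫ μ in (0 : ℝ)..1,
    (source (K (event (tA + μ * ‖x - xA‖ + Ξ (seg xA x μ)) (seg xA x μ))) (dir xA x)
      - 2 * lin (K (event (tA + μ * ‖x - xA‖ + Ξ (seg xA x μ)) (seg xA x μ))) (dir xA x)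
          (grad u (seg xA x μ))
      + quad (minkowski + K (event (tA + μ * ‖x - xA‖ + Ξ (seg xA x μ)) (seg xA x μ)))
          (grad u (seg xA x μ)) (grad u (seg xA x μ)))

/-! ### The recursion for the terms of the expansions -/

/-- The sequences of the terms of the refractive, gravitational and coupling delays. Only the
indices `l ≥ 1` are meaningful. -/
structure DelayTerms where
  /-- refractive terms -/
  r : ℕ → Space → ℝ
  /-- gravitational terms -/
  g : ℕ → Space → ℝ
  /-- coupling terms -/
  gr : ℕ → Space → ℝ

/-- The terms of the total delay,
`Ξ^(l) = Ξ_r^(l) + Θ(l-s) Ξ_g^(l-s+1) + Θ(l-s-1) Ξ_gr^(l-s)`. -/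
def DelayTerms.total (X : DelayTerms) (s l : ℕ) (x : Space) : ℝ :=
  X.r l x + (if s ≤ l then X.g (l - s + 1) x else 0) + (if s + 1 ≤ l then X.gr (l - s) x else 0)

/-- Everything that enters the recursive formulas, for fixed values of the parameters: the integer
`s`, the emission event, the terms `κ₍ₗ₎` and `k₍ₗ₎`, and the terms of the delays. -/
structure RecData where
  /-- ordering integer -/
  s : ℕ
  /-- time component of the emission event -/
  tA : ℝ
  /-- position of the emission event -/
  xA : Space
  /-- refractive terms of the metric -/
  κ : ℕ → Event → Tensor
  /-- gravitational terms of the metric -/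
  k : ℕ → Event → Tensor
  /-- terms of the delays -/
  X : DelayTerms

namespace RecData

variable (S : RecData)

/-- The emission function `Φ₊^(l,m)`, for `1 ≤ m ≤ l`. -/
def Phi (l m : ℕ) (x : Space) : ℝ :=
  1 / (m.factorial : ℝ) *
    ∑ ν ∈ Finset.Nat.antidiagonalTuple m (l - m), ∏ d : Fin m, S.X.total S.s (ν d + 1) x

/-- The event `z₊(μ) = (tA + μ R_AB, z₊(μ))` of the Minkowskian path from `x_A` to `x`. -/
def path (x : Space) (μ : ℝ) : Event := event (S.tA + μ * ‖x - S.xA‖) (seg S.xA x μ)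

/-- The quantity `κ̂₊₍ₗ₎` at `z₊(μ)`. -/
def kappaHat (l : ℕ) (x : Space) (μ : ℝ) : Tensor :=
  Matrix.of fun α β => S.κ l (S.path x μ) α β
    + ∑ m ∈ Finset.Icc 1 (l - 1), ∑ n ∈ Finset.Icc 1 m,
        S.Phi m n (seg S.xA x μ) * timeDeriv n (fun y => S.κ (l - m) y α β) (S.path x μ)

/-- The quantity `k̂₊₍ₗ₎` at `z₊(μ)`, for `l ≥ s`, with `l = p s + q`, `0 ≤ q < s`. -/
def kHat (l : ℕ) (x : Space) (μ : ℝ) : Tensor :=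
  Matrix.of fun α β =>
    (if l % S.s = 0 then S.k (l / S.s) (S.path x μ) α β
      else ∑ n ∈ Finset.Icc 1 (l % S.s), S.Phi (l % S.s) n (seg S.xA x μ)
        * timeDeriv n (fun y => S.k (l / S.s) y α β) (S.path x μ))
    + ∑ m ∈ Finset.Icc 1 (l / S.s - 1), ∑ n ∈ Finset.Icc 1 (m * S.s + l % S.s),
        S.Phi (m * S.s + l % S.s) n (seg S.xA x μ)
          * timeDeriv n (fun y => S.k (l / S.s - m) y α β) (S.path x μ)

/-- Gradient of `Ξ_r^(l)` at `z₊(μ)`. -/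
def dr (l : ℕ) (x : Space) (μ : ℝ) : Fin 3 → ℝ := grad (S.X.r l) (seg S.xA x μ)

/-- Gradient of `Ξ_g^(l)` at `z₊(μ)`. -/
def dg (l : ℕ) (x : Space) (μ : ℝ) : Fin 3 → ℝ := grad (S.X.g l) (seg S.xA x μ)

/-- Gradient of `Ξ_gr^(l)` at `z₊(μ)`. -/
def dgr (l : ℕ) (x : Space) (μ : ℝ) : Fin 3 → ℝ := grad (S.X.gr l) (seg S.xA x μ)

/-- `R_AB`. -/
def range (x : Space) : ℝ := ‖x - S.xA‖

/-- `N_AB`. -/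
def N (x : Space) : Space := dir S.xA x

/-- The line integral for the refractive term of order `l`. -/
def refrFormula (l : ℕ) (x : Space) : ℝ :=
  S.range x / 2 * ∫ μ in (0 : ℝ)..1,
    (source (S.kappaHat l x μ) (S.N x)
      - 2 * ∑ m ∈ Finset.Icc 1 (l - 1), lin (S.kappaHat m x μ) (S.N x) (S.dr (l - m) x μ)
      + ∑ m ∈ Finset.Icc 1 (l - 1), quad minkowski (S.dr m x μ) (S.dr (l - m) x μ)
      + ∑ m ∈ Finset.Icc 1 (l - 2), ∑ n ∈ Finset.Icc 1 (l - m - 1),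
          quad (S.kappaHat m x μ) (S.dr n x μ) (S.dr (l - m - n) x μ))

/-- The line integral for the gravitational term of order `l`. -/
def gravFormula (l : ℕ) (x : Space) : ℝ :=
  S.range x / 2 * ∫ μ in (0 : ℝ)..1,
    (source (S.kHat (S.s + l - 1) x μ) (S.N x)
      + (if S.s + 1 ≤ l then
          -2 * ∑ m ∈ Finset.Icc S.s (l - 1), lin (S.kHat m x μ) (S.N x) (S.dg (l - m) x μ)
          + ∑ m ∈ Finset.Icc 1 (l - S.s),
              quad minkowski (S.dg m x μ) (S.dg (l - S.s - m + 1) x μ) else 0)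
      + (if 2 * S.s + 1 ≤ l then
          ∑ m ∈ Finset.Icc S.s (l - S.s - 1), ∑ n ∈ Finset.Icc 1 (l - S.s - m),
            quad (S.kHat m x μ) (S.dg n x μ) (S.dg (l - S.s - m - n + 1) x μ) else 0))

/-- Contribution to the coupling term of order `l`, present for `l ≥ 1`. -/
def couplOne (l : ℕ) (x : Space) : ℝ :=
  S.range x * ∫ μ in (0 : ℝ)..1,
    (∑ m ∈ Finset.Icc 1 l, quad minkowski (S.dr m x μ) (S.dg (l - m + 1) x μ)
      - ∑ m ∈ Finset.Icc 1 l, lin (S.kappaHat m x μ) (S.N x) (S.dg (l - m + 1) x μ)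
      - ∑ m ∈ Finset.Icc S.s (l + S.s - 1),
          lin (S.kHat m x μ) (S.N x) (S.dr (l + S.s - m) x μ))

/-- Contribution that switches on at `l = 2`. -/
def couplTwo (l : ℕ) (x : Space) : ℝ :=
  S.range x * ∫ μ in (0 : ℝ)..1,
    (∑ m ∈ Finset.Icc 1 (l - 1), quad minkowski (S.dr m x μ) (S.dgr (l - m) x μ)
      - ∑ m ∈ Finset.Icc 1 (l - 1), lin (S.kappaHat m x μ) (S.N x) (S.dgr (l - m) x μ)
      + ∑ m ∈ Finset.Icc 1 (l - 1), ∑ n ∈ Finset.Icc 1 (l - m),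
          quad (S.kappaHat m x μ) (S.dr n x μ) (S.dg (l - m - n + 1) x μ)
      + 1 / 2 * ∑ m ∈ Finset.Icc S.s (l + S.s - 2), ∑ n ∈ Finset.Icc 1 (l + S.s - m - 1),
          quad (S.kHat m x μ) (S.dr n x μ) (S.dr (l + S.s - m - n) x μ))

/-- Contribution that switches on at `l = 3`. -/
def couplThree (l : ℕ) (x : Space) : ℝ :=
  S.range x * ∫ μ in (0 : ℝ)..1,
    ∑ m ∈ Finset.Icc 1 (l - 2), ∑ n ∈ Finset.Icc 1 (l - m - 1),
      quad (S.kappaHat m x μ) (S.dr n x μ) (S.dgr (l - m - n) x μ)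

/-- Contribution that switches on at `l = s + 1`. -/
def couplSOne (l : ℕ) (x : Space) : ℝ :=
  S.range x * ∫ μ in (0 : ℝ)..1,
    (∑ m ∈ Finset.Icc 1 (l - S.s), quad minkowski (S.dg m x μ) (S.dgr (l - S.s - m + 1) x μ)
      - ∑ m ∈ Finset.Icc S.s (l - 1), lin (S.kHat m x μ) (S.N x) (S.dgr (l - m) x μ)
      + ∑ m ∈ Finset.Icc S.s (l - 1), ∑ n ∈ Finset.Icc 1 (l - m),
          quad (S.kHat m x μ) (S.dr n x μ) (S.dg (l - m - n + 1) x μ)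
      + 1 / 2 * ∑ m ∈ Finset.Icc 1 (l - S.s), ∑ n ∈ Finset.Icc 1 (l - S.s - m + 1),
          quad (S.kappaHat m x μ) (S.dg n x μ) (S.dg (l + 2 - S.s - m - n) x μ))

/-- Contribution that switches on at `l = s + 2`. -/
def couplSTwo (l : ℕ) (x : Space) : ℝ :=
  S.range x / 2 * ∫ μ in (0 : ℝ)..1,
    (∑ m ∈ Finset.Icc 1 (l - S.s - 1), quad minkowski (S.dgr m x μ) (S.dgr (l - S.s - m) x μ)
      + 2 * ∑ m ∈ Finset.Icc S.s (l - 2), ∑ n ∈ Finset.Icc 1 (l - m - 1),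
          quad (S.kHat m x μ) (S.dr n x μ) (S.dgr (l - m - n) x μ)
      + 2 * ∑ m ∈ Finset.Icc 1 (l - S.s - 1), ∑ n ∈ Finset.Icc 1 (l - S.s - m),
          quad (S.kappaHat m x μ) (S.dg n x μ) (S.dgr (l - S.s - m - n + 1) x μ))

/-- Contribution that switches on at `l = s + 3`. -/
def couplSThree (l : ℕ) (x : Space) : ℝ :=
  S.range x / 2 * ∫ μ in (0 : ℝ)..1,
    ∑ m ∈ Finset.Icc 1 (l - S.s - 2), ∑ n ∈ Finset.Icc 1 (l - S.s - m - 1),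
      quad (S.kappaHat m x μ) (S.dgr n x μ) (S.dgr (l - S.s - m - n) x μ)

/-- Contribution that switches on at `l = 2 s + 1`. -/
def couplTwoSOne (l : ℕ) (x : Space) : ℝ :=
  S.range x * ∫ μ in (0 : ℝ)..1,
    ∑ m ∈ Finset.Icc S.s (l - S.s - 1), ∑ n ∈ Finset.Icc 1 (l - S.s - m),
      quad (S.kHat m x μ) (S.dg n x μ) (S.dgr (l - S.s - m - n + 1) x μ)

/-- Contribution that switches on at `l = 2 s + 2`. -/
def couplTwoSTwo (l : ℕ) (x : Space) : ℝ :=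
  S.range x / 2 * ∫ μ in (0 : ℝ)..1,
    ∑ m ∈ Finset.Icc S.s (l - S.s - 2), ∑ n ∈ Finset.Icc 1 (l - S.s - m - 1),
      quad (S.kHat m x μ) (S.dgr n x μ) (S.dgr (l - S.s - m - n) x μ)

/-- The cumulative formula for the coupling term of order `l ≥ 1`. -/
def couplFormula (l : ℕ) (x : Space) : ℝ :=
  S.couplOne l x
    + (if 2 ≤ l then S.couplTwo l x else 0)
    + (if 3 ≤ l then S.couplThree l x else 0)
    + (if S.s + 1 ≤ l then S.couplSOne l x else 0)
    + (if S.s + 2 ≤ l then S.couplSTwo l x else 0)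
    + (if S.s + 3 ≤ l then S.couplSThree l x else 0)
    + (if 2 * S.s + 1 ≤ l then S.couplTwoSOne l x else 0)
    + (if 2 * S.s + 2 ≤ l then S.couplTwoSTwo l x else 0)

end RecData

/-! ### Expansions -/

/-- The parameters `(ε N₀, εˢ G)`; the weight of `N₀` is `1` and that of `G` is `s`. -/
def scale (s : ℕ) (ε : ℝ) (p : ℝ × ℝ) : ℝ × ℝ := (ε * p.1, ε ^ s * p.2)

/-- `f = ∑_{l ≥ 1} Xₗ`, with `Xₗ` of order `ε^(l+a)` when `N₀` is of order `ε` and `G` of order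
`εˢ`: the terms are homogeneous, the partial sums approximate `f` to the order of the first
neglected term, and the series converges to `f` as soon as `f` is analytic in `ε` at `0`. -/
structure HasExpansion (s a : ℕ) (f : ℝ × ℝ → ℝ) (X : ℝ × ℝ → ℕ → ℝ) : Prop where
  homogeneous : ∀ (p : ℝ × ℝ) (ε : ℝ) (l : ℕ), 1 ≤ l → X (scale s ε p) l = ε ^ (l + a) * X p l
  asymptotic : ∀ (p : ℝ × ℝ) (L : ℕ),
    (fun ε : ℝ => f (scale s ε p) - ∑ l ∈ Finset.Icc 1 L, X (scale s ε p) l)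
      =O[𝓝 0] (fun ε : ℝ => ε ^ (L + a + 1))
  hasSum : ∀ p : ℝ × ℝ, AnalyticAt ℝ (fun ε : ℝ => f (scale s ε p)) 0 →
    ∀ᶠ ε in 𝓝 (0 : ℝ), HasSum (fun l : ℕ => X (scale s ε p) (l + 1)) (f (scale s ε p))

end OpticalDelay

end

namespace OpticalDelay

open Filter Asymptotics PowerSeries MeasureTheory

/-! ### Asymptotic expansions in powers of a small quantity -/

/-! Fix `p = (N₀, G)` and follow the curve `ε ↦ (ε N₀, εˢ G)`. It lies in `P` for small `ε`,
whatever `p` is, and every delay becomes a smooth one-parameter family. The terms are defined as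
Taylor coefficients at `ε = 0`: order `l` for the refractive delay, `l + s - 1` for the
gravitational one, `l + s` for the coupling one. With this choice homogeneity is the uniqueness of
expansions under a rescaling of `ε` (`coeff_jet_scale`), and the asymptotic and convergence
statements are Taylor's theorem (`hasExpansion_of_jet`). What remains is that these coefficients
satisfy the line integrals and that the coefficients below the first named order vanish.

The total delay must obey the same kind of equation as the separate ones, driven by `κ + k`. Along a
congruence of null geodesics from one event the wave covector annihilates the connecting vector
(`covector_dotProduct_connecting`). At the endpoint this expresses the covector through the gradient
of `R`, and the null condition becomes the eikonal equation. Inserting `R = |x - x_A| + Ξ` and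
integrating along the straight segment gives `IsEmissionRange.isDelayDrivenBy`.

The three equations are then expanded in `ε` under the integral sign, which requires expansions
uniform in `μ ∈ (0, 1]` (`UnifJet`). The delicate factor is the gradient, since a delay need not be
differentiable at `x_A`. The `v`-gradient of `f (x_A + μ v)` is `μ` times the spatial gradient and
vanishes at `μ = 0`, so division by `μ` keeps it bounded (`IsSmoothFamily.unifJet_grad`). A
perturbation evaluated on the delayed path is a composition; its coefficients are the hatted
quantities (`coeff_comp`, `sum_coeff_X_pow_mul_pow`), with `Φ` the coefficients of `Ξⁿ / n!`.

Comparison of coefficients gives each delay coefficient as the integral of `integrandCoeff`, a sum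
of convolutions. Subtracting the gravitational and refractive equations from the total one leaves
exactly the cross terms (`integrandCoeff_coupling`). Induction on the order shows that the
gravitational coefficients vanish below `s` and the coupling ones up to `s`. These starting orders
turn convolutions over antidiagonals into the interval sums of the formulas and account for all the
thresholds on `l`. -/

/-- `f` has the asymptotic expansion `∑ⱼ cⱼ eʲ` in powers of the small quantity `e` along `l`. -/
structure HasJet {α : Type*} (l : Filter α) (e f : α → ℝ) (c : α → ℝ⟦X⟧) : Prop where
  bdd : ∀ j, (fun a => coeff j (c a)) =O[l] (fun _ => (1 : ℝ))
  approx : ∀ L, (fun a => f a - ∑ j ∈ Finset.range L, coeff j (c a) * e a ^ j)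
    =O[l] fun a => e a ^ L

namespace HasJet

variable {α β : Type*} {l : Filter α} {e f g : α → ℝ} {c d : α → ℝ⟦X⟧}

theorem isBigO_one (hf : HasJet l e f c) : f =O[l] (fun _ => (1 : ℝ)) := by
  simpa using hf.approx 0

theorem congr (hf : HasJet l e f c) (hfg : f =ᶠ[l] g) (hcd : c =ᶠ[l] d) : HasJet l e g d where
  bdd j := (hf.bdd j).congr' (hcd.mono fun a ha => by simp [ha]) EventuallyEq.rfl
  approx L := (hf.approx L).congr' (by
    filter_upwards [hfg, hcd] with a h1 h2
    rw [h1, h2]) EventuallyEq.rfl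

theorem comp (hf : HasJet l e f c) {l' : Filter β} {φ : β → α} (hφ : Tendsto φ l' l) :
    HasJet l' (e ∘ φ) (f ∘ φ) (c ∘ φ) where
  bdd j := (hf.bdd j).comp_tendsto hφ
  approx L := (hf.approx L).comp_tendsto hφ

theorem const {r : α → ℝ} (hr : r =O[l] (fun _ => (1 : ℝ))) :
    HasJet l e r (fun a => C (r a)) where
  bdd j := by
    rcases j with _ | j
    · simpa using hr
    · simpa [coeff_C] using isBigO_zero (E' := ℝ) (fun _ => (1 : ℝ)) l
  approx L := by
    rcases L with _ | L
    · simpa using hr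
    · refine (isBigO_zero _ _).congr_left fun a => ?_
      rw [Finset.sum_range_succ']
      simp [coeff_C]

theorem add (hf : HasJet l e f c) (hg : HasJet l e g d) :
    HasJet l e (fun a => f a + g a) (fun a => c a + d a) where
  bdd j := by simpa using (hf.bdd j).add (hg.bdd j)
  approx L := ((hf.approx L).add (hg.approx L)).congr_left fun a => by
    simp only [map_add, add_mul, Finset.sum_add_distrib]
    ring

theorem sum {ι : Type*} (s : Finset ι) {f : ι → α → ℝ} {c : ι → α → ℝ⟦X⟧}
    (h : ∀ i ∈ s, HasJet l e (f i) (c i)) :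
    HasJet l e (fun a => ∑ i ∈ s, f i a) (fun a => ∑ i ∈ s, c i a) := by
  classical
  induction s using Finset.induction_on with
  | empty => simpa using const (l := l) (e := e) (isBigO_zero (fun _ => (1 : ℝ)) l)
  | insert i s hi ih =>
    simp only [Finset.sum_insert hi]
    exact (h i (by simp)).add (ih fun k hk => h k (by simp [hk]))

/-- Pairs of total degree below `L` reassemble into the truncation of `c * d`, the bounds on the
single degrees being automatic there; every other pair carries a factor `x ^ L`. -/
theorem sum_mul_sum (c d : ℝ⟦X⟧) (x : ℝ) (L : ℕ) :
    (∑ j ∈ Finset.range L, coeff j c * x ^ j) * (∑ j ∈ Finset.range L, coeff j d * x ^ j)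
      = ∑ j ∈ Finset.range L, coeff j (c * d) * x ^ j
        + ∑ q ∈ (Finset.range L ×ˢ Finset.range L).filter (fun q => ¬ q.1 + q.2 < L),
          coeff q.1 c * coeff q.2 d * x ^ (q.1 + q.2 - L) * x ^ L := by
  rw [Finset.sum_mul_sum, ← Finset.sum_product',
    ← Finset.sum_filter_add_sum_filter_not _ (fun q : ℕ × ℕ => q.1 + q.2 < L)]
  congr 1
  · simp only [coeff_mul, Finset.sum_mul]
    rw [Finset.sum_sigma']
    refine Finset.sum_bij' (fun q _ => (⟨q.1 + q.2, q⟩ : Σ _ : ℕ, ℕ × ℕ)) (fun q _ => q.2)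
      ?_ ?_ ?_ ?_ ?_
    · intro q hq
      simp only [Finset.mem_filter, Finset.mem_product, Finset.mem_range] at hq
      simp [hq.2]
    · rintro ⟨n, q⟩ hq
      simp only [Finset.mem_sigma, Finset.mem_range, Finset.HasAntidiagonal.mem_antidiagonal] at hq
      simp only [Finset.mem_filter, Finset.mem_product, Finset.mem_range]
      omega
    · intro q _
      rfl
    · rintro ⟨n, q⟩ hq
      simp only [Finset.mem_sigma, Finset.mem_range, Finset.HasAntidiagonal.mem_antidiagonal] at hq
      simp [hq.2]
    · intro q _
      simp only [pow_add]
      ring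
  · refine Finset.sum_congr rfl fun q hq => ?_
    simp only [Finset.mem_filter, not_lt] at hq
    rw [mul_assoc _ (x ^ _) (x ^ _), ← pow_add, Nat.sub_add_cancel hq.2, pow_add]
    ring

/-- The error splits as `(f - f_L) g + f_L (g - g_L)` plus the part of `f_L g_L` of degree at least
`L`, where the subscript denotes truncation. Each piece is `O(e ^ L)` because the coefficients and
`e` are bounded along the filter. -/
theorem mul (he : e =O[l] (fun _ => (1 : ℝ))) (hf : HasJet l e f c) (hg : HasJet l e g d) :
    HasJet l e (fun a => f a * g a) (fun a => c a * d a) where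
  bdd j := by
    simp only [coeff_mul]
    refine IsBigO.fun_sum fun q _ => ?_
    simpa using (hf.bdd q.1).mul (hg.bdd q.2)
  approx L := by
    have he' : ∀ n, (fun a => e a ^ n) =O[l] (fun _ => (1 : ℝ)) := fun n => by
      simpa using he.pow n
    have h1 : (fun a => (f a - ∑ j ∈ Finset.range L, coeff j (c a) * e a ^ j) * g a)
        =O[l] fun a => e a ^ L := by simpa using (hf.approx L).mul hg.isBigO_one
    have h0 : (fun a => ∑ j ∈ Finset.range L, coeff j (c a) * e a ^ j)
        =O[l] (fun _ => (1 : ℝ)) := by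
      refine IsBigO.fun_sum fun j _ => ?_
      simpa using (hf.bdd j).mul (he' j)
    have h2 : (fun a => (∑ j ∈ Finset.range L, coeff j (c a) * e a ^ j)
        * (g a - ∑ j ∈ Finset.range L, coeff j (d a) * e a ^ j)) =O[l] fun a => e a ^ L := by
      simpa using h0.mul (hg.approx L)
    have h3 : (fun a => ∑ q ∈ (Finset.range L ×ˢ Finset.range L).filter
          (fun q => ¬ q.1 + q.2 < L),
          coeff q.1 (c a) * coeff q.2 (d a) * e a ^ (q.1 + q.2 - L) * e a ^ L)
        =O[l] fun a => e a ^ L := by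
      refine IsBigO.fun_sum fun q _ => ?_
      simpa using (((hf.bdd q.1).mul (hg.bdd q.2)).mul (he' _)).mul
        (isBigO_refl (fun a => e a ^ L) l)
    refine ((h1.add h2).add h3).congr_left fun a => ?_
    linear_combination -sum_mul_sum (c a) (d a) (e a) L

theorem const_mul {r : α → ℝ} (he : e =O[l] (fun _ => (1 : ℝ)))
    (hr : r =O[l] (fun _ => (1 : ℝ))) (hf : HasJet l e f c) :
    HasJet l e (fun a => r a * f a) (fun a => C (r a) * c a) :=
  (const hr).mul he hf

theorem neg (hf : HasJet l e f c) : HasJet l e (fun a => -f a) (fun a => -c a) where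
  bdd j := by simpa using (hf.bdd j).neg_left
  approx L := (hf.approx L).neg_left.congr_left fun a => by
    simp only [map_neg, neg_mul, Finset.sum_neg_distrib]
    ring

theorem sub (hf : HasJet l e f c) (hg : HasJet l e g d) :
    HasJet l e (fun a => f a - g a) (fun a => c a - d a) := by
  simpa only [sub_eq_add_neg] using hf.add hg.neg

theorem pow (he : e =O[l] (fun _ => (1 : ℝ))) (hf : HasJet l e f c) (n : ℕ) :
    HasJet l e (fun a => f a ^ n) (fun a => c a ^ n) := by
  induction n with
  | zero => simpa using const (l := l) (e := e) (isBigO_refl (fun _ => (1 : ℝ)) l)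
  | succ n ih => simpa only [pow_succ] using ih.mul he hf

/-- The expansion of the small quantity itself. -/
theorem self (he : e =O[l] (fun _ => (1 : ℝ))) : HasJet l e e (fun _ => X) where
  bdd j := isBigO_const_const _ one_ne_zero _
  approx L := by
    rcases L with _ | _ | L
    · simpa using he
    · simpa [coeff_X] using isBigO_refl e l
    · refine (isBigO_zero _ _).congr_left fun a => ?_
      rw [Finset.sum_range_succ', Finset.sum_range_succ']
      simp [coeff_X]

/-- Expansions of functions of one variable which agree to order `L` have the same coefficients
below the order `L`. -/
theorem coeff_eq {f g : ℝ → ℝ} {c d : ℝ⟦X⟧} (hf : HasJet (𝓝 0) id f fun _ => c)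
    (hg : HasJet (𝓝 0) id g fun _ => d) {L : ℕ}
    (hfg : (fun ε => f ε - g ε) =O[𝓝 0] fun ε => ε ^ L) {j : ℕ} (hj : j < L) :
    coeff j c = coeff j d := by
  induction j using Nat.strong_induction_on with
  | _ j ih =>
    have hO : ∀ n ≤ L, j + 1 ≤ n → (fun ε : ℝ => ε ^ n) =O[𝓝 0] fun ε : ℝ => ε ^ (j + 1) := by
      intro n _ hn
      obtain ⟨k, rfl⟩ := Nat.exists_eq_add_of_le hn
      simp only [pow_add _ (j + 1) k]
      have : (fun ε : ℝ => ε ^ k) =O[𝓝 0] fun _ => (1 : ℝ) :=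
        ((continuous_pow k).tendsto 0).isBigO_one ℝ
      simpa using (isBigO_refl (fun ε : ℝ => ε ^ (j + 1)) (𝓝 0)).mul this
    -- The lower coefficients agree by induction, so the difference of the truncations of length `j
    -- + 1` is a single monomial of degree `j`.
    have h1 : (fun ε : ℝ => (coeff j d - coeff j c) * ε ^ j) =O[𝓝 0] fun ε => ε ^ (j + 1) := by
      refine (((hf.approx (j + 1)).sub (hg.approx (j + 1))).sub
        (hfg.trans (hO L le_rfl hj))).congr_left fun ε => ?_
      rw [Finset.sum_range_succ, Finset.sum_range_succ,
        Finset.sum_congr rfl fun k hk => by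
          rw [ih k (Finset.mem_range.1 hk) ((Finset.mem_range.1 hk).trans hj)]]
      simp only [id]
      ring
    obtain ⟨K, hK⟩ := h1.bound
    -- On the punctured neighbourhood `|ε| ^ j` can be cancelled; the constant left is bounded by a
    -- multiple of `|ε|` and hence is zero.
    have h2 : ∀ᶠ ε in 𝓝[≠] (0 : ℝ), |coeff j d - coeff j c| ≤ K * |ε| := by
      filter_upwards [nhdsWithin_le_nhds hK, self_mem_nhdsWithin] with ε h0 hε
      have hp : 0 < |ε| ^ j := pow_pos (abs_pos.2 hε) j
      simp only [Real.norm_eq_abs, abs_mul, abs_pow, pow_succ, ← mul_assoc] at h0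
      refine le_of_mul_le_mul_right (h0.trans (le_of_eq ?_)) hp
      ring
    have h3 : Tendsto (fun ε : ℝ => K * |ε|) (𝓝[≠] 0) (𝓝 0) := by
      have : Continuous fun ε : ℝ => K * |ε| := by fun_prop
      simpa using (this.tendsto 0).mono_left nhdsWithin_le_nhds
    have h4 := ge_of_tendsto h3 h2
    have h5 : coeff j d - coeff j c = 0 := abs_eq_zero.1 (le_antisymm h4 (abs_nonneg _))
    linarith

theorem unique {f : ℝ → ℝ} {c d : ℝ⟦X⟧} (hf : HasJet (𝓝 0) id f fun _ => c)
    (hg : HasJet (𝓝 0) id f fun _ => d) : c = d := by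
  ext j
  exact hf.coeff_eq hg (L := j + 1) (by simpa using isBigO_zero _ _) (Nat.lt_succ_self j)

/-- A rescaling of the small quantity. -/
theorem comp_mul {f : ℝ → ℝ} {c : ℝ⟦X⟧} (hf : HasJet (𝓝 0) id f fun _ => c) (k : ℝ) :
    HasJet (𝓝 0) id (fun ε => f (ε * k)) fun _ => PowerSeries.mk fun j => k ^ j * coeff j c where
  bdd j := isBigO_const_const _ one_ne_zero _
  approx L := by
    have ht : Tendsto (fun ε : ℝ => ε * k) (𝓝 0) (𝓝 0) := by
      have : Continuous fun ε : ℝ => ε * k := by fun_prop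
      simpa using this.tendsto 0
    refine (((hf.approx L).comp_tendsto ht).trans ?_).congr_left fun ε => ?_
    · refine ((isBigO_refl (fun ε : ℝ => ε ^ L) (𝓝 0)).const_mul_left (k ^ L)).congr_left
        fun ε => ?_
      simp only [Function.comp, id, mul_pow]
      ring
    · simp only [Function.comp, id, coeff_mk, mul_pow]
      congr 1
      exact Finset.sum_congr rfl fun j _ => by ring

end HasJet

/-! ### Smooth families of functions of one variable -/

section Slices

variable {E E' : Type*} [NormedAddCommGroup E] [NormedSpace ℝ E] [NormedAddCommGroup E']
  [NormedSpace ℝ E']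

/-- `Z` need not be open (the segment parameter ranges over `[0, 1]`), so on the product only the
derivative within the set is available. Openness of `V` makes its restriction to a slice a genuine
derivative. -/
theorem hasFDerivAt_slice_right {Z : Set E'} {V : Set E} (hV : IsOpen V) {F : E' × E → ℝ}
    (hF : DifferentiableOn ℝ F (Z ×ˢ V)) {q : E' × E} (hq : q ∈ Z ×ˢ V) :
    HasFDerivAt (fun v => F (q.1, v))
      ((fderivWithin ℝ F (Z ×ˢ V) q).comp (ContinuousLinearMap.inr ℝ E' E)) q.2 := by
  have h1 := (hF q hq).hasFDerivWithinAt
  have h2 : HasFDerivWithinAt (fun v : E => (q.1, v)) (ContinuousLinearMap.inr ℝ E' E) V q.2 :=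
    (hasFDerivAt_prodMk_right q.1 q.2).hasFDerivWithinAt
  exact (HasFDerivWithinAt.comp (t := Z ×ˢ V) q.2 h1 h2 (fun v hv => ⟨hq.1, hv⟩)).hasFDerivAt
    (hV.mem_nhds hq.2)

theorem hasDerivAt_slice {U : Set ℝ} (hU : IsOpen U) {T : Set E} {F : ℝ × E → ℝ}
    (hF : DifferentiableOn ℝ F (U ×ˢ T)) {q : ℝ × E} (hq : q ∈ U ×ˢ T) :
    HasDerivAt (fun t => F (t, q.2)) (fderivWithin ℝ F (U ×ˢ T) q (1, 0)) q.1 := by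
  have h1 := (hF q hq).hasFDerivWithinAt
  have h2 : HasFDerivWithinAt (fun t : ℝ => (t, q.2)) (ContinuousLinearMap.inl ℝ ℝ E) U q.1 :=
    (hasFDerivAt_prodMk_left q.1 q.2).hasFDerivWithinAt
  have h3 := ((HasFDerivWithinAt.comp (t := U ×ˢ T) q.1 h1 h2 (fun v hv => ⟨hv, hq.2⟩)).hasFDerivAt
    (hU.mem_nhds hq.1)).hasDerivAt
  exact h3.congr_deriv (by simp)

theorem contDiffOn_fderiv_slice {Z : Set E'} {V : Set E} (hZ : UniqueDiffOn ℝ Z) (hV : IsOpen V)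
    {F : E' × E → ℝ} (hF : ContDiffOn ℝ ∞ F (Z ×ˢ V)) (v₀ : E) :
    ContDiffOn ℝ ∞ (fun q : E' × E => fderiv ℝ (fun v => F (q.1, v)) q.2 v₀) (Z ×ˢ V) := by
  have h := hF.fderivWithin (hZ.prod hV.uniqueDiffOn) (m := ∞) (by simp)
  refine (h.clm_apply (contDiffOn_const (c := ((0, v₀) : E' × E)))).congr fun q hq => ?_
  rw [(hasFDerivAt_slice_right hV (hF.differentiableOn (by simp)) hq).fderiv]
  simp

theorem contDiffOn_deriv_slice {U : Set ℝ} {T : Set E} (hU : IsOpen U) (hT : UniqueDiffOn ℝ T)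
    {F : ℝ × E → ℝ} (hF : ContDiffOn ℝ ∞ F (U ×ˢ T)) :
    ContDiffOn ℝ ∞ (fun q : ℝ × E => deriv (fun t => F (t, q.2)) q.1) (U ×ˢ T) := by
  have h := hF.fderivWithin (hU.uniqueDiffOn.prod hT) (m := ∞) (by simp)
  refine (h.clm_apply (contDiffOn_const (c := ((1, 0) : ℝ × E)))).congr fun q hq => ?_
  exact (hasDerivAt_slice hU (hF.differentiableOn (by simp)) hq).deriv

theorem contDiffOn_iteratedDeriv_slice {U : Set ℝ} {T : Set E} (hU : IsOpen U)
    (hT : UniqueDiffOn ℝ T) {F : ℝ × E → ℝ} (hF : ContDiffOn ℝ ∞ F (U ×ˢ T)) (n : ℕ) :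
    ContDiffOn ℝ ∞ (fun q : ℝ × E => iteratedDeriv n (fun t => F (t, q.2)) q.1) (U ×ˢ T) := by
  induction n with
  | zero => simpa using hF
  | succ n ih => simpa only [iteratedDeriv_succ] using contDiffOn_deriv_slice hU hT ih

/-- Both sides are the second derivative of `F` evaluated on `(1, 0)` and `(0, v₀)`, so this is the
symmetry of that derivative. Class `C²` is enough, which is all that is assumed of the congruence of
rays. -/
theorem hasDerivAt_fderiv {W : Set (ℝ × E)} (hW : IsOpen W) {F : ℝ × E → ℝ}
    (hF : ContDiffOn ℝ 2 F W) {q : ℝ × E} (hq : q ∈ W) (v₀ : E) :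
    HasDerivAt (fun t => fderiv ℝ (fun v => F (t, v)) q.2 v₀)
      (fderiv ℝ (fun v => deriv (fun t => F (t, v)) q.1) q.2 v₀) q.1 := by
  have hd : ∀ z ∈ W, HasFDerivAt F (fderiv ℝ F z) z := fun z hz =>
    ((hF.contDiffAt (hW.mem_nhds hz)).differentiableAt (by simp)).hasFDerivAt
  have h2 : HasFDerivAt (fderiv ℝ F) (fderiv ℝ (fderiv ℝ F) q) q :=
    (((hF.contDiffAt (hW.mem_nhds hq)).fderiv_right (m := 1) (by norm_cast)).differentiableAt
      (by simp)).hasFDerivAt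
  have hsymm : IsSymmSndFDerivAt ℝ F q :=
    (hF.contDiffAt (hW.mem_nhds hq)).isSymmSndFDerivAt (by simp)
  have e1 : (fun t => fderiv ℝ (fun v => F (t, v)) q.2 v₀)
      =ᶠ[𝓝 q.1] fun t => fderiv ℝ F (t, q.2) (0, v₀) := by
    have : ∀ᶠ t in 𝓝 q.1, (t, q.2) ∈ W :=
      (Continuous.prodMk_left q.2).continuousAt.preimage_mem_nhds (hW.mem_nhds hq)
    filter_upwards [this] with t ht
    have := (hd _ ht).comp q.2 (hasFDerivAt_prodMk_right (𝕜 := ℝ) t q.2)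
    have h3 := this.fderiv
    simp only [Function.comp_def] at h3
    rw [h3]
    simp
  have e2 : (fun v => deriv (fun t => F (t, v)) q.1)
      =ᶠ[𝓝 q.2] fun v => fderiv ℝ F (q.1, v) (1, 0) := by
    have : ∀ᶠ v in 𝓝 q.2, (q.1, v) ∈ W :=
      (Continuous.prodMk_right q.1).continuousAt.preimage_mem_nhds (hW.mem_nhds hq)
    filter_upwards [this] with v hv
    have := ((hd _ hv).comp q.1 (hasFDerivAt_prodMk_left (𝕜 := ℝ) q.1 v)).hasDerivAt
    simpa [Function.comp_def] using this.deriv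
  rw [e2.fderiv_eq]
  have d1 : HasDerivAt (fun t => fderiv ℝ F (t, q.2) (0, v₀))
      (fderiv ℝ (fderiv ℝ F) q (1, 0) (0, v₀)) q.1 := by
    have := ((HasFDerivAt.comp q.1 h2 (hasFDerivAt_prodMk_left (𝕜 := ℝ) q.1 q.2)).clm_apply
      (hasFDerivAt_const ((0, v₀) : ℝ × E) q.1)).hasDerivAt
    simpa [Function.comp_def] using this
  have d2 : HasFDerivAt (fun v => fderiv ℝ F (q.1, v) (1, 0))
      (((fderiv ℝ (fderiv ℝ F) q).comp (ContinuousLinearMap.inr ℝ ℝ E)).flip (1, 0)) q.2 := by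
    have := (HasFDerivAt.comp q.2 h2 (hasFDerivAt_prodMk_right (𝕜 := ℝ) q.1 q.2)).clm_apply
      (hasFDerivAt_const ((1, 0) : ℝ × E) q.2)
    simpa [Function.comp_def] using this
  rw [d2.fderiv]
  refine (d1.congr_of_eventuallyEq e1).congr_deriv ?_
  simpa using hsymm (1, 0) (0, v₀)

/-- This identifies the gradient of a Taylor coefficient with the Taylor coefficient of the
gradient. The statement is needed at every `ε ∈ U`, not only at `0`, because the induction
differentiates it in `ε`. -/
theorem iteratedDeriv_fderiv_comm {U : Set ℝ} {V : Set E} (hU : IsOpen U) (hV : IsOpen V)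
    {F : ℝ × E → ℝ} (hF : ContDiffOn ℝ ∞ F (U ×ˢ V)) (v₀ : E) {y : E} (hy : y ∈ V) (n : ℕ) :
    ∀ ε ∈ U, iteratedDeriv n (fun t => fderiv ℝ (fun v => F (t, v)) y v₀) ε
      = fderiv ℝ (fun v => iteratedDeriv n (fun t => F (t, v)) ε) y v₀ := by
  induction n with
  | zero => simp
  | succ n ih =>
    intro ε hε
    have e1 : iteratedDeriv n (fun t => fderiv ℝ (fun v => F (t, v)) y v₀) =ᶠ[𝓝 ε]
        fun t => fderiv ℝ (fun v => iteratedDeriv n (fun t => F (t, v)) t) y v₀ := by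
      filter_upwards [hU.mem_nhds hε] with t ht using ih t ht
    rw [iteratedDeriv_succ, e1.deriv_eq]
    simp only [iteratedDeriv_succ]
    exact (hasDerivAt_fderiv (hU.prod hV)
      ((contDiffOn_iteratedDeriv_slice hU hV.uniqueDiffOn hF n).of_le (by norm_cast))
      (q := (ε, y)) ⟨hε, hy⟩ v₀).deriv

end Slices

/-! ### Formal Taylor series and uniform Taylor estimates -/

/-- The formal Taylor series at `0`. -/
noncomputable def jet (f : ℝ → ℝ) : ℝ⟦X⟧ :=
  PowerSeries.mk fun j => iteratedDeriv j f 0 / (j.factorial : ℝ)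

@[simp] theorem coeff_jet (f : ℝ → ℝ) (j : ℕ) :
    coeff j (jet f) = iteratedDeriv j f 0 / (j.factorial : ℝ) := by simp [jet]

theorem jet_congr {f g : ℝ → ℝ} (h : f =ᶠ[𝓝 0] g) : jet f = jet g := by
  ext j
  simp only [coeff_jet, h.iteratedDeriv_eq j]

/-- The derivative of the remainder of `f` of order `n + 1` is the remainder of `deriv f` of order
`n`. The mean value inequality on the ball of radius `|ε|` then gains one power of `|ε|`. The
constant is not sharp, but it is the same for every `f` obeying the derivative bound, which is what
families require. -/
theorem abs_sub_taylor_le {δ : ℝ} {U : Set ℝ} (hU : IsOpen U)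
    (hδ : Metric.closedBall (0 : ℝ) δ ⊆ U) {C : ℝ} (n : ℕ) :
    ∀ f : ℝ → ℝ, ContDiffOn ℝ ∞ f U → (∀ ε, |ε| ≤ δ → |iteratedDeriv n f ε| ≤ C) →
      ∀ ε, |ε| ≤ δ → |f ε - ∑ j ∈ Finset.range n, coeff j (jet f) * ε ^ j| ≤ C * |ε| ^ n := by
  induction n with
  | zero => intro f _ h ε hε; simpa using h ε hε
  | succ n ih =>
    intro f hf hb ε hε
    have hf' : ContDiffOn ℝ ∞ (deriv f) U := ((contDiffOn_infty_iff_deriv_of_isOpen hU).1 hf).2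
    have hIH := ih (deriv f) hf' (fun t ht => by
      rw [← iteratedDeriv_succ']; exact hb t ht)
    set ρ : ℝ → ℝ := fun t => f t - ∑ j ∈ Finset.range (n + 1), coeff j (jet f) * t ^ j with hρ
    have hd : ∀ t, |t| ≤ δ → HasDerivAt ρ
        (deriv f t - ∑ j ∈ Finset.range n, coeff j (jet (deriv f)) * t ^ j) t := by
      intro t ht
      have hm : U ∈ 𝓝 t := hU.mem_nhds (hδ (by simpa using ht))
      have h1 : HasDerivAt f (deriv f t) t :=
        ((hf.contDiffAt hm).differentiableAt (by simp)).hasDerivAt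
      have h2 : HasDerivAt (fun t : ℝ => ∑ j ∈ Finset.range (n + 1), coeff j (jet f) * t ^ j)
          (∑ j ∈ Finset.range (n + 1), coeff j (jet f) * (j * t ^ (j - 1))) t :=
        HasDerivAt.fun_sum fun j _ => (hasDerivAt_pow j t).const_mul _
      refine (h1.sub h2).congr_deriv ?_
      congr 1
      rw [Finset.sum_range_succ']
      simp only [Nat.cast_zero, zero_mul, mul_zero, add_zero]
      refine Finset.sum_congr rfl fun j _ => ?_
      rw [coeff_jet, coeff_jet, iteratedDeriv_succ', Nat.factorial_succ]
      have : ((j.factorial : ℕ) : ℝ) ≠ 0 := by positivity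
      have : ((j : ℝ) + 1) ≠ 0 := by positivity
      push_cast
      field_simp
    have hρ0 : ρ 0 = 0 := by
      simp only [hρ]
      rw [Finset.sum_range_succ']
      simp
    have hmv := (convex_closedBall (0 : ℝ) |ε|).norm_image_sub_le_of_norm_hasDerivWithin_le
      (f := ρ) (C := C * |ε| ^ n) (x := 0) (y := ε)
      (fun t ht => (hd t ((by simpa using ht : |t| ≤ |ε|).trans hε)).hasDerivWithinAt)
      (fun t ht => by
        have ht' : |t| ≤ |ε| := by simpa using ht
        have hC : 0 ≤ C := (abs_nonneg _).trans (hb t (ht'.trans hε))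
        refine (hIH t (ht'.trans hε)).trans ?_
        gcongr) (by simp) (by simp)
    rw [hρ0, sub_zero, sub_zero, Real.norm_eq_abs, Real.norm_eq_abs] at hmv
    rw [pow_succ, ← mul_assoc]
    exact hmv

/-- A family of smooth functions with locally uniform bounds on the derivatives is uniformly
approximated by its Taylor expansions. -/
theorem hasJet_family {β : Type*} {I : Set β} {U : Set ℝ} (hU : IsOpen U) (h0 : (0 : ℝ) ∈ U)
    {ψ : ℝ × β → ℝ} (hψ : ∀ b ∈ I, ContDiffOn ℝ ∞ (fun ε => ψ (ε, b)) U)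
    (hb : ∀ n, ∃ C, ∃ δ > 0, ∀ b ∈ I, ∀ ε, |ε| ≤ δ → |iteratedDeriv n (fun t => ψ (t, b)) ε| ≤ C) :
    HasJet (𝓝 (0 : ℝ) ×ˢ 𝓟 I) Prod.fst ψ (fun q => jet fun t => ψ (t, q.2)) where
  bdd j := by
    obtain ⟨C, δ, hδ, h⟩ := hb j
    refine IsBigO.of_bound (C / (j.factorial : ℝ)) ?_
    filter_upwards [prod_mem_prod univ_mem (mem_principal_self I)] with q hq
    simp only [coeff_jet, norm_div, norm_one, mul_one, Real.norm_eq_abs, Nat.abs_cast]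
    gcongr
    exact h q.2 hq.2 0 (by simpa using hδ.le)
  approx L := by
    obtain ⟨C, δ, hδ, h⟩ := hb L
    obtain ⟨δ', hδ', h'⟩ := Metric.nhds_basis_closedBall.mem_iff.1 (hU.mem_nhds h0)
    refine IsBigO.of_bound C ?_
    filter_upwards [prod_mem_prod (Metric.closedBall_mem_nhds (0 : ℝ) (lt_min hδ hδ'))
      (mem_principal_self I)] with q hq
    have hq1 : |q.1| ≤ min δ δ' := by simpa using hq.1
    simp only [Real.norm_eq_abs, abs_pow]
    exact abs_sub_taylor_le hU ((Metric.closedBall_subset_closedBall (min_le_right _ _)).trans h')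
      L _ (hψ q.2 hq.2) (fun ε hε => h q.2 hq.2 ε (hε.trans (min_le_left _ _))) q.1 hq1

theorem hasJet_of_contDiffAt {f : ℝ → ℝ} {U : Set ℝ} (hU : IsOpen U) (h0 : (0 : ℝ) ∈ U)
    (hf : ContDiffOn ℝ ∞ f U) : HasJet (𝓝 0) id f (fun _ => jet f) := by
  have key := hasJet_family (I := Set.univ) (β := Unit) hU h0 (ψ := fun q => f q.1)
    (fun _ _ => hf) (fun n => by
      have hc := ((contDiffOn_iteratedDeriv_slice (E := Unit) (T := Set.univ)
        (F := fun q => f q.1) hU uniqueDiffOn_univ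
        (hf.comp contDiffOn_fst fun q hq => hq.1)) n).continuousOn
      have hc' : ContinuousOn (iteratedDeriv n f) U :=
        hc.comp (f := fun t : ℝ => (t, ())) (by fun_prop) (fun t ht => ⟨ht, trivial⟩)
      obtain ⟨δ, hδ, hs⟩ := Metric.nhds_basis_closedBall.mem_iff.1 (hU.mem_nhds h0)
      obtain ⟨C, hC⟩ := (isCompact_closedBall (0 : ℝ) δ).exists_bound_of_continuousOn (hc'.mono hs)
      exact ⟨C, δ, hδ, fun _ _ ε hε => hC ε (by simpa using hε)⟩)
  have ht : Tendsto (fun t : ℝ => (t, ())) (𝓝 0) (𝓝 0 ×ˢ 𝓟 Set.univ) := by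
    rw [principal_univ]
    exact tendsto_id.prodMk tendsto_top
  exact key.comp ht

/-! ### Uniform expansions along a segment -/

/-- Bounded continuous functions on `(0, 1]`. -/
structure BoundedCont (f : ℝ → ℝ) : Prop where
  cont : ContinuousOn f (Set.Ioc 0 1)
  bound : ∃ C, ∀ μ ∈ Set.Ioc (0 : ℝ) 1, |f μ| ≤ C

namespace BoundedCont

variable {f g : ℝ → ℝ}

theorem congr (hf : BoundedCont f) (h : ∀ μ ∈ Set.Ioc (0 : ℝ) 1, g μ = f μ) : BoundedCont g :=
  ⟨hf.cont.congr h, hf.bound.imp fun C hC μ hμ => by rw [h μ hμ]; exact hC μ hμ⟩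

theorem const (a : ℝ) : BoundedCont fun _ => a :=
  ⟨continuousOn_const, |a|, fun _ _ => le_rfl⟩

theorem add (hf : BoundedCont f) (hg : BoundedCont g) : BoundedCont fun μ => f μ + g μ := by
  obtain ⟨A, hA⟩ := hf.bound
  obtain ⟨B, hB⟩ := hg.bound
  exact ⟨hf.cont.add hg.cont, A + B, fun μ hμ =>
    (abs_add_le _ _).trans (add_le_add (hA μ hμ) (hB μ hμ))⟩

theorem mul (hf : BoundedCont f) (hg : BoundedCont g) : BoundedCont fun μ => f μ * g μ := by
  obtain ⟨A, hA⟩ := hf.bound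
  obtain ⟨B, hB⟩ := hg.bound
  refine ⟨hf.cont.mul hg.cont, A * B, fun μ hμ => ?_⟩
  rw [abs_mul]
  exact mul_le_mul (hA μ hμ) (hB μ hμ) (abs_nonneg _) ((abs_nonneg _).trans (hA μ hμ))

theorem sub (hf : BoundedCont f) (hg : BoundedCont g) : BoundedCont fun μ => f μ - g μ :=
  (hf.add ((const (-1)).mul hg)).congr fun μ _ => by ring

theorem sum {ι : Type*} (s : Finset ι) {f : ι → ℝ → ℝ} (h : ∀ i ∈ s, BoundedCont (f i)) :
    BoundedCont fun μ => ∑ i ∈ s, f i μ := by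
  classical
  induction s using Finset.induction_on with
  | empty => simpa using const 0
  | insert i s hi ih =>
    simp only [Finset.sum_insert hi]
    exact (h i (by simp)).add (ih fun k hk => h k (by simp [hk]))

theorem intervalIntegrable (hf : BoundedCont f) : IntervalIntegrable f volume 0 1 := by
  obtain ⟨C, hC⟩ := hf.bound
  rw [intervalIntegrable_iff_integrableOn_Ioc_of_le zero_le_one]
  refine IntegrableOn.of_bound measure_Ioc_lt_top
    (hf.cont.aestronglyMeasurable measurableSet_Ioc) C ?_
  exact (ae_restrict_iff' measurableSet_Ioc).2 (Eventually.of_forall hC)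

end BoundedCont

theorem integral_congr_Ioc {f g : ℝ → ℝ} (h : ∀ μ ∈ Set.Ioc (0 : ℝ) 1, f μ = g μ) :
    ∫ μ in (0 : ℝ)..1, f μ = ∫ μ in (0 : ℝ)..1, g μ :=
  intervalIntegral.integral_congr_ae (Eventually.of_forall fun μ hμ =>
    h μ (by rwa [Set.uIoc_of_le zero_le_one] at hμ))

/-- The family `f ε` of continuous functions on `(0, 1]` has an expansion in powers of `ε`,
uniformly on `(0, 1]`, with continuous coefficients. -/
structure UnifJet (f : ℝ → ℝ → ℝ) (c : ℝ → ℝ⟦X⟧) : Prop where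
  hasJet : HasJet (𝓝 (0 : ℝ) ×ˢ 𝓟 (Set.Ioc (0 : ℝ) 1)) Prod.fst (fun q : ℝ × ℝ => f q.1 q.2)
    (fun q => c q.2)
  cont : ∀ᶠ ε in 𝓝 (0 : ℝ), ContinuousOn (f ε) (Set.Ioc 0 1)
  contCoeff : ∀ j, ContinuousOn (fun μ => coeff j (c μ)) (Set.Ioc 0 1)

namespace UnifJet

variable {f g : ℝ → ℝ → ℝ} {c d : ℝ → ℝ⟦X⟧}

theorem fst_isBigO_one (I : Set ℝ) :
    (Prod.fst : ℝ × ℝ → ℝ) =O[𝓝 (0 : ℝ) ×ˢ 𝓟 I] (fun _ => (1 : ℝ)) :=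
  (tendsto_fst (f := 𝓝 (0 : ℝ)) (g := 𝓟 I)).isBigO_one ℝ

theorem const (a : ℝ) : UnifJet (fun _ _ => a) (fun _ => C a) where
  hasJet := HasJet.const (r := fun _ : ℝ × ℝ => a) (isBigO_const_const _ one_ne_zero _)
  cont := Eventually.of_forall fun _ => continuousOn_const
  contCoeff _ := continuousOn_const

theorem add (hf : UnifJet f c) (hg : UnifJet g d) :
    UnifJet (fun ε μ => f ε μ + g ε μ) (fun μ => c μ + d μ) where
  hasJet := hf.hasJet.add hg.hasJet
  cont := by filter_upwards [hf.cont, hg.cont] with ε h1 h2 using h1.add h2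
  contCoeff j := by simpa only [map_add] using (hf.contCoeff j).fun_add (hg.contCoeff j)

theorem mul (hf : UnifJet f c) (hg : UnifJet g d) :
    UnifJet (fun ε μ => f ε μ * g ε μ) (fun μ => c μ * d μ) where
  hasJet := hf.hasJet.mul (fst_isBigO_one _) hg.hasJet
  cont := by filter_upwards [hf.cont, hg.cont] with ε h1 h2 using h1.mul h2
  contCoeff j := by
    simp only [coeff_mul]
    exact continuousOn_finsetSum _ fun q _ => (hf.contCoeff q.1).mul (hg.contCoeff q.2)

theorem sub (hf : UnifJet f c) (hg : UnifJet g d) :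
    UnifJet (fun ε μ => f ε μ - g ε μ) (fun μ => c μ - d μ) where
  hasJet := hf.hasJet.sub hg.hasJet
  cont := by filter_upwards [hf.cont, hg.cont] with ε h1 h2 using h1.sub h2
  contCoeff j := by simpa only [map_sub] using (hf.contCoeff j).fun_sub (hg.contCoeff j)

theorem sum {ι : Type*} (s : Finset ι) {f : ι → ℝ → ℝ → ℝ} {c : ι → ℝ → ℝ⟦X⟧}
    (h : ∀ i ∈ s, UnifJet (f i) (c i)) :
    UnifJet (fun ε μ => ∑ i ∈ s, f i ε μ) (fun μ => ∑ i ∈ s, c i μ) := by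
  classical
  induction s using Finset.induction_on with
  | empty => simpa using const 0
  | insert i s hi ih =>
    simp only [Finset.sum_insert hi]
    exact (h i (by simp)).add (ih fun k hk => h k (by simp [hk]))

theorem boundedCont_coeff (hf : UnifJet f c) (j : ℕ) : BoundedCont fun μ => coeff j (c μ) := by
  refine ⟨hf.contCoeff j, ?_⟩
  obtain ⟨B, hB⟩ := (hf.hasJet.bdd j).bound
  rw [eventually_prod_principal_iff] at hB
  exact ⟨B, fun μ hμ => by simpa using hB.self_of_nhds μ hμ⟩

theorem boundedCont (hf : UnifJet f c) : ∀ᶠ ε in 𝓝 (0 : ℝ), BoundedCont (f ε) := by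
  obtain ⟨B, hB⟩ := hf.hasJet.isBigO_one.bound
  rw [eventually_prod_principal_iff] at hB
  filter_upwards [hB, hf.cont] with ε h1 h2
  exact ⟨h2, B, fun μ hμ => by simpa using h1 μ hμ⟩

theorem hasJet_at (hf : UnifJet f c) {μ : ℝ} (hμ : μ ∈ Set.Ioc (0 : ℝ) 1) :
    HasJet (𝓝 0) id (fun ε => f ε μ) (fun _ => c μ) := by
  have ht : Tendsto (fun ε : ℝ => (ε, μ)) (𝓝 0) (𝓝 0 ×ˢ 𝓟 (Set.Ioc (0 : ℝ) 1)) :=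
    tendsto_id.prodMk (tendsto_principal.2 (Eventually.of_forall fun _ => hμ))
  exact hf.hasJet.comp ht

/-- A remainder bound uniform in `μ` passes to the integral over an interval of length one with the
same constant. -/
theorem integral (hf : UnifJet f c) :
    HasJet (𝓝 0) id (fun ε => ∫ μ in (0 : ℝ)..1, f ε μ)
      (fun _ => PowerSeries.mk fun j => ∫ μ in (0 : ℝ)..1, coeff j (c μ)) where
  bdd j := isBigO_const_const _ one_ne_zero _
  approx L := by
    obtain ⟨B, hB⟩ := (hf.hasJet.approx L).bound
    rw [eventually_prod_principal_iff] at hB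
    refine IsBigO.of_bound B ?_
    filter_upwards [hB, hf.boundedCont] with ε h1 h2
    have hj : ∀ j ∈ Finset.range L,
        IntervalIntegrable (fun μ => coeff j (c μ) * ε ^ j) volume 0 1 := fun j _ =>
      ((hf.boundedCont_coeff j).mul (.const _)).intervalIntegrable
    have hs : IntervalIntegrable (fun μ => ∑ j ∈ Finset.range L, coeff j (c μ) * ε ^ j)
        volume 0 1 := (BoundedCont.sum _ fun j _ =>
          (hf.boundedCont_coeff j).mul (.const _)).intervalIntegrable
    simp only [coeff_mk, id]
    simp only [← intervalIntegral.integral_mul_const]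
    rw [← intervalIntegral.integral_finsetSum hj,
      ← intervalIntegral.integral_sub h2.intervalIntegrable hs]
    have := intervalIntegral.norm_integral_le_of_norm_le_const (a := (0 : ℝ)) (b := 1)
      (f := fun μ => f ε μ - ∑ j ∈ Finset.range L, coeff j (c μ) * ε ^ j)
      (C := B * ‖ε ^ L‖) (fun μ hμ => h1 μ (by rwa [Set.uIoc_of_le zero_le_one] at hμ))
    simpa using this

end UnifJet

/-- A smooth family on a closed segment has a uniform expansion. -/
theorem unifJet_of_contDiffOn {U : Set ℝ} (hU : IsOpen U) (h0 : (0 : ℝ) ∈ U) {ψ : ℝ × ℝ → ℝ}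
    (hψ : ContDiffOn ℝ ∞ ψ (U ×ˢ Set.Icc 0 1)) :
    UnifJet (fun ε μ => ψ (ε, μ)) (fun μ => jet fun ε => ψ (ε, μ)) := by
  have hD := contDiffOn_iteratedDeriv_slice hU (uniqueDiffOn_Icc zero_lt_one) hψ
  refine ⟨hasJet_family hU h0 ?_ ?_, ?_, ?_⟩
  · intro μ hμ
    exact hψ.comp (f := fun ε : ℝ => (ε, μ)) (by fun_prop)
      fun ε hε => ⟨hε, Set.Ioc_subset_Icc_self hμ⟩
  · intro n
    obtain ⟨δ, hδ, hs⟩ := Metric.nhds_basis_closedBall.mem_iff.1 (hU.mem_nhds h0)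
    obtain ⟨B, hB⟩ := ((isCompact_closedBall (0 : ℝ) δ).prod
      (isCompact_Icc (a := (0 : ℝ)) (b := 1))).exists_bound_of_continuousOn
      ((hD n).continuousOn.mono (Set.prod_mono hs subset_rfl))
    exact ⟨B, δ, hδ, fun μ hμ ε hε => hB (ε, μ)
      ⟨by simpa using hε, Set.Ioc_subset_Icc_self hμ⟩⟩
  · filter_upwards [hU.mem_nhds h0] with ε hε
    exact hψ.continuousOn.comp (f := fun μ : ℝ => (ε, μ)) (by fun_prop)
      fun μ hμ => ⟨hε, Set.Ioc_subset_Icc_self hμ⟩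
  · intro j
    simp only [coeff_jet]
    exact ((hD j).continuousOn.comp (f := fun μ : ℝ => ((0 : ℝ), μ)) (by fun_prop)
      fun μ hμ => ⟨h0, Set.Ioc_subset_Icc_self hμ⟩).div_const _

/-- A smooth family on a closed segment which vanishes at the initial point, divided by the
parameter, has a uniform expansion. -/
theorem unifJet_div_of_contDiffOn {U : Set ℝ} (hU : IsOpen U) (h0 : (0 : ℝ) ∈ U) {ψ : ℝ × ℝ → ℝ}
    (hψ : ContDiffOn ℝ ∞ ψ (U ×ˢ Set.Icc 0 1)) (hz : ∀ ε ∈ U, ψ (ε, 0) = 0) :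
    UnifJet (fun ε μ => μ⁻¹ * ψ (ε, μ)) (fun μ => jet fun ε => μ⁻¹ * ψ (ε, μ)) := by
  have hI : UniqueDiffOn ℝ (Set.Icc (0 : ℝ) 1) := uniqueDiffOn_Icc zero_lt_one
  have hD := contDiffOn_iteratedDeriv_slice hU hI hψ
  have hmul : ∀ n μ ε, iteratedDeriv n (fun t => μ⁻¹ * ψ (t, μ)) ε
      = μ⁻¹ * iteratedDeriv n (fun t => ψ (t, μ)) ε := fun n μ ε => by
    rw [iteratedDeriv_const_mul_field]
  -- Vanishing at `μ = 0` for all `ε ∈ U` is inherited by all `ε`-derivatives.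
  have hzero : ∀ n, ∀ ε ∈ U, iteratedDeriv n (fun t => ψ (t, 0)) ε = 0 := by
    intro n ε hε
    have : (fun t => ψ (t, 0)) =ᶠ[𝓝 ε] fun _ => (0 : ℝ) := by
      filter_upwards [hU.mem_nhds hε] with t ht using hz t ht
    rw [this.iteratedDeriv_eq]
    simp
  have hinv : ContinuousOn (fun μ : ℝ => μ⁻¹) (Set.Ioc 0 1) :=
    continuousOn_inv₀.mono fun μ hμ => hμ.1.ne'
  refine ⟨hasJet_family (ψ := fun q => q.2⁻¹ * ψ q) hU h0 ?_ ?_, ?_, ?_⟩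
  · intro μ hμ
    exact (contDiffOn_const (c := μ⁻¹)).mul (hψ.comp (f := fun ε : ℝ => (ε, μ)) (by fun_prop)
      fun ε hε => ⟨hε, Set.Ioc_subset_Icc_self hμ⟩)
  · intro n
    obtain ⟨δ, hδ, hs⟩ := Metric.nhds_basis_closedBall.mem_iff.1 (hU.mem_nhds h0)
    have hsub : Metric.closedBall (0 : ℝ) δ ×ˢ Set.Icc (0 : ℝ) 1 ⊆ U ×ˢ Set.Icc 0 1 :=
      Set.prod_mono hs subset_rfl
    have hF := (hD n).differentiableOn (by simp)
    have hF' := (hD n).continuousOn_fderivWithin (hU.uniqueDiffOn.prod hI) (by simp)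
    obtain ⟨B, hB⟩ := ((isCompact_closedBall (0 : ℝ) δ).prod
      (isCompact_Icc (a := (0 : ℝ)) (b := 1))).exists_bound_of_continuousOn (hF'.mono hsub)
    refine ⟨B, δ, hδ, fun μ hμ ε hε => ?_⟩
    have hmem : ∀ t ∈ Set.Icc (0 : ℝ) 1, (ε, t) ∈ Metric.closedBall (0 : ℝ) δ ×ˢ Set.Icc (0 : ℝ) 1 :=
      fun t ht => ⟨by simpa using hε, ht⟩
    have hconv : Convex ℝ (Metric.closedBall (0 : ℝ) δ ×ˢ Set.Icc (0 : ℝ) 1) :=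
      (convex_closedBall 0 δ).prod (convex_Icc 0 1)
    -- The mean value inequality from `(ε, 0)` to `(ε, μ)` bounds the `n`-th `ε`-derivative by `B *
    -- μ`, which absorbs the factor `μ⁻¹`.
    have hmv := hconv.norm_image_sub_le_of_norm_hasFDerivWithin_le
      (fun q hq => ((hF q (hsub hq)).hasFDerivWithinAt).mono hsub) hB
      (hmem 0 ⟨le_rfl, zero_le_one⟩) (hmem μ (Set.Ioc_subset_Icc_self hμ))
    have hn : ‖((ε, μ) : ℝ × ℝ) - (ε, 0)‖ = μ := by
      simp [Prod.norm_def, abs_of_pos hμ.1, hμ.1.le]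
    simp only [hzero n ε (hs (by simpa using hε)), sub_zero] at hmv
    rw [hn, Real.norm_eq_abs] at hmv
    simp only [hmul, abs_mul, abs_inv, abs_of_pos hμ.1]
    rw [inv_mul_le_iff₀ hμ.1, mul_comm]
    exact hmv
  · filter_upwards [hU.mem_nhds h0] with ε hε
    exact hinv.mul (hψ.continuousOn.comp (f := fun μ : ℝ => (ε, μ)) (by fun_prop)
      fun μ hμ => ⟨hε, Set.Ioc_subset_Icc_self hμ⟩)
  · intro j
    simp only [coeff_jet, hmul]
    exact (hinv.mul ((hD j).continuousOn.comp (f := fun μ : ℝ => ((0 : ℝ), μ)) (by fun_prop)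
      fun μ hμ => ⟨h0, Set.Ioc_subset_Icc_self hμ⟩)).div_const _

theorem UnifJet.congr {f g : ℝ → ℝ → ℝ} {c d : ℝ → ℝ⟦X⟧} (hf : UnifJet f c)
    (hfg : ∀ᶠ ε in 𝓝 (0 : ℝ), ∀ μ ∈ Set.Ioc (0 : ℝ) 1, g ε μ = f ε μ)
    (hcd : ∀ μ ∈ Set.Ioc (0 : ℝ) 1, d μ = c μ) : UnifJet g d where
  hasJet := by
    refine hf.hasJet.congr ?_ ?_
    · refine (eventually_prod_principal_iff.2 (hfg.mono fun ε h μ hμ => ?_))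
      exact (h μ hμ).symm
    · filter_upwards [prod_mem_prod univ_mem (mem_principal_self _)] with q hq
      exact (hcd q.2 hq.2).symm
  cont := by filter_upwards [hf.cont, hfg] with ε h1 h2 using h1.congr h2
  contCoeff j := (hf.contCoeff j).congr fun μ hμ => by simp only [hcd μ hμ]

/-! ### Smooth families of delay functions -/

theorem scale_zero {s : ℕ} (hs : 1 ≤ s) (p : ℝ × ℝ) : scale s 0 p = 0 := by
  have : s ≠ 0 := by omega
  simp [scale, this]

theorem contDiff_scale (s : ℕ) (p : ℝ × ℝ) : ContDiff ℝ ∞ fun ε => scale s ε p := by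
  unfold scale
  fun_prop

theorem scale_scale (s : ℕ) (ε c : ℝ) (p : ℝ × ℝ) :
    scale s ε (scale s c p) = scale s (ε * c) p := by
  simp only [scale, mul_pow, mul_assoc]

theorem seg_mem {xA : Space} {D : Set Space} (hD : IsReceptionDomain xA D) {x : Space}
    (hx : x ∈ D) {μ : ℝ} (hμ : μ ∈ Set.Ioc (0 : ℝ) 1) : seg xA x μ ∈ D :=
  hD.star x hx μ hμ

/-- A one-parameter family of functions of the reception position, smooth in the parameter, the
distance to the emission position and the direction. -/
def IsSmoothFamily (U : Set ℝ) (xA : Space) (D : Set Space) (f : ℝ → Space → ℝ) : Prop :=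
  ContDiffOn ℝ ∞ (fun q : ℝ × ℝ × Space => f q.1 (xA + q.2.1 • q.2.2))
    (U ×ˢ Set.Icc (0 : ℝ) 1 ×ˢ {v : Space | xA + v ∈ D})

theorem IsQuasiMinkowskian.isSmoothFamily {xA : Space} {D : Set Space} {P : Set (ℝ × ℝ)}
    {f : ℝ × ℝ → Space → ℝ} (hf : IsQuasiMinkowskian xA D P f) (s : ℕ) (p : ℝ × ℝ) :
    IsSmoothFamily {ε | scale s ε p ∈ P} xA D (fun ε => f (scale s ε p)) := by
  refine hf.smooth.comp (f := fun q : ℝ × ℝ × Space => (scale s q.1 p, q.2)) ?_ ?_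
  · exact (((contDiff_scale s p).comp contDiff_fst).prodMk contDiff_snd).contDiffOn
  · rintro q ⟨h1, h2⟩
    exact ⟨h1, h2⟩

/-- The coefficient of `ε ^ j` in the Taylor expansion of a one-parameter family of functions. -/
noncomputable def delayCoeff (f : ℝ → Space → ℝ) (j : ℕ) (y : Space) : ℝ :=
  coeff j (jet fun ε => f ε y)

namespace IsSmoothFamily

variable {U : Set ℝ} {xA : Space} {D : Set Space} {f g : ℝ → Space → ℝ}

theorem sub (hf : IsSmoothFamily U xA D f) (hg : IsSmoothFamily U xA D g) :
    IsSmoothFamily U xA D (fun ε y => f ε y - g ε y) :=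
  ContDiffOn.sub hf hg

theorem contDiffOn (hf : IsSmoothFamily U xA D f) :
    ContDiffOn ℝ ∞ (fun q : ℝ × Space => f q.1 q.2) (U ×ˢ D) := by
  refine (ContDiffOn.comp hf (f := fun q : ℝ × Space => (q.1, (1 : ℝ), q.2 - xA))
    (by fun_prop) ?_).congr ?_
  · rintro q ⟨h1, h2⟩
    exact ⟨h1, ⟨zero_le_one, le_rfl⟩, by simpa using h2⟩
  · intro q _
    simp

theorem contDiffOn_left (hf : IsSmoothFamily U xA D f) {y : Space} (hy : y ∈ D) :
    ContDiffOn ℝ ∞ (fun ε => f ε y) U :=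
  hf.contDiffOn.comp (f := fun ε : ℝ => (ε, y)) (by fun_prop) fun _ hε => ⟨hε, hy⟩

theorem contDiffOn_right (hf : IsSmoothFamily U xA D f) {ε : ℝ} (hε : ε ∈ U) :
    ContDiffOn ℝ ∞ (f ε) D :=
  hf.contDiffOn.comp (f := fun y : Space => (ε, y)) (by fun_prop) fun _ hy => ⟨hε, hy⟩

theorem hasJet (hf : IsSmoothFamily U xA D f) (hU : IsOpen U) (h0 : (0 : ℝ) ∈ U) {y : Space}
    (hy : y ∈ D) :
    HasJet (𝓝 0) id (fun ε => f ε y) fun _ => PowerSeries.mk fun j => delayCoeff f j y := by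
  have := hasJet_of_contDiffAt hU h0 (hf.contDiffOn_left hy)
  rwa [show (PowerSeries.mk fun j => delayCoeff f j y) = jet fun ε => f ε y by
    ext j
    simp [delayCoeff]]

theorem differentiableAt_delayCoeff (hf : IsSmoothFamily U xA D f) (hU : IsOpen U)
    (h0 : (0 : ℝ) ∈ U) (hD : IsOpen D) {y : Space} (hy : y ∈ D) (j : ℕ) :
    DifferentiableAt ℝ (fun v => iteratedDeriv j (fun t => f t v) 0) y := by
  have h1 := contDiffOn_iteratedDeriv_slice hU hD.uniqueDiffOn hf.contDiffOn j
  have h2 := h1.comp (f := fun y : Space => ((0 : ℝ), y)) (s := D) (by fun_prop)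
    fun _ hy => ⟨h0, hy⟩
  exact (h2.contDiffAt (hD.mem_nhds hy)).differentiableAt (by simp)

theorem grad_delayCoeff (hf : IsSmoothFamily U xA D f) (hU : IsOpen U) (h0 : (0 : ℝ) ∈ U)
    (hD : IsOpen D) {y : Space} (hy : y ∈ D) (j : ℕ) (i : Fin 3) :
    grad (delayCoeff f j) y i = coeff j (jet fun ε => grad (f ε) y i) := by
  have h1 := hf.differentiableAt_delayCoeff hU h0 hD hy j
  have h2 := iteratedDeriv_fderiv_comm hU hD hf.contDiffOn (EuclideanSpace.single i (1 : ℝ)) hy j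
    0 h0
  have h3 : delayCoeff f j = fun v => iteratedDeriv j (fun t => f t v) 0 * (j.factorial : ℝ)⁻¹ := by
    funext v
    simp [delayCoeff, div_eq_mul_inv]
  simp only [grad]
  rw [h3, fderiv_mul_const h1, coeff_jet, h2]
  simp [div_eq_inv_mul]

theorem contDiffOn_seg (hf : IsSmoothFamily U xA D f) {x : Space}
    (hx : x ∈ D) :
    ContDiffOn ℝ ∞ (fun q : ℝ × ℝ => f q.1 (seg xA x q.2)) (U ×ˢ Set.Icc 0 1) :=
  ContDiffOn.comp hf (f := fun q : ℝ × ℝ => (q.1, q.2, x - xA)) (by fun_prop)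
    fun q hq => ⟨hq.1, hq.2, by simpa using hx⟩

theorem fderiv_comp_seg (u : Space → ℝ) (xA v : Space) (μ : ℝ) :
    fderiv ℝ (fun v => u (xA + μ • v)) v = μ • fderiv ℝ u (xA + μ • v) := by
  rw [fderiv_comp_smul (f := fun w => u (xA + w)) μ, fderiv_comp_add_left]

/-- The gradient at the point `seg xA x μ` is `μ⁻¹` times the `v`-derivative of `f ε (xA + μ • v)`
at `v = x - xA`. That derivative is smooth on the closed segment and vanishes at `μ = 0`, where the
function is constant in `v`. Thus no differentiability at `xA` is needed. -/
theorem unifJet_grad (hf : IsSmoothFamily U xA D f) (hU : IsOpen U) (h0 : (0 : ℝ) ∈ U)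
    (hD : IsReceptionDomain xA D) {x : Space} (hx : x ∈ D) (i : Fin 3) :
    UnifJet (fun ε μ => grad (f ε) (seg xA x μ) i)
      (fun μ => PowerSeries.mk fun j => grad (delayCoeff f j) (seg xA x μ) i) := by
  have hV : IsOpen {v : Space | xA + v ∈ D} := hD.isOpen.preimage (by fun_prop)
  have hxV : x - xA ∈ {v : Space | xA + v ∈ D} := by simpa using hx
  have h1 : ContDiffOn ℝ ∞ (fun q : (ℝ × ℝ) × Space => f q.1.1 (xA + q.1.2 • q.2))
      ((U ×ˢ Set.Icc (0 : ℝ) 1) ×ˢ {v : Space | xA + v ∈ D}) :=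
    ContDiffOn.comp hf (f := fun q : (ℝ × ℝ) × Space => (q.1.1, q.1.2, q.2)) (by fun_prop)
      fun q hq => ⟨hq.1.1, hq.1.2, hq.2⟩
  have h2 := contDiffOn_fderiv_slice (hU.uniqueDiffOn.prod (uniqueDiffOn_Icc zero_lt_one)) hV h1
    (EuclideanSpace.single i (1 : ℝ))
  have h3 := h2.comp (f := fun q : ℝ × ℝ => (q, x - xA)) (s := U ×ˢ Set.Icc 0 1) (by fun_prop)
    fun q hq => ⟨hq, hxV⟩
  have hval : ∀ ε : ℝ, ∀ μ ∈ Set.Ioc (0 : ℝ) 1, grad (f ε) (seg xA x μ) i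
      = μ⁻¹ * fderiv ℝ (fun v => f ε (xA + μ • v)) (x - xA) (EuclideanSpace.single i 1) := by
    intro ε μ hμ
    rw [fderiv_comp_seg]
    have := hμ.1.ne'
    simp [grad, seg]
    field_simp
  refine (unifJet_div_of_contDiffOn hU h0 h3 ?_).congr (Eventually.of_forall fun ε => hval ε) ?_
  · intro ε _
    simp
  · intro μ hμ
    ext j
    rw [coeff_mk, hf.grad_delayCoeff hU h0 hD.isOpen (seg_mem hD hx hμ)]
    congr 3
    funext ε
    exact hval ε μ hμ

end IsSmoothFamily

/-! ### The eikonal equation for the emission range transfer function -/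

@[simp] theorem event_zero (t : ℝ) (x : Space) : event t x 0 = t := rfl

@[simp] theorem event_succ (t : ℝ) (x : Space) (i : Fin 3) : event t x i.succ = x i := rfl

theorem fderiv_apply_eq_sum_partialDeriv {f : Event → ℝ} (y v : Event) :
    fderiv ℝ f y v = ∑ α, partialDeriv α f y * v α := by
  conv_lhs => rw [pi_eq_sum_univ' v]
  simp only [map_sum, map_smul, partialDeriv, smul_eq_mul]
  refine Finset.sum_congr rfl fun α _ => ?_
  rw [mul_comm]

theorem fderiv_apply_eq_sum_grad {f : Space → ℝ} (y v : Space) :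
    fderiv ℝ f y v = ∑ i, grad f y i * v i := by
  conv_lhs => rw [← (EuclideanSpace.basisFun (Fin 3) ℝ).sum_repr v]
  simp only [map_sum, map_smul, grad, smul_eq_mul]
  refine Finset.sum_congr rfl fun α _ => ?_
  rw [mul_comm]
  simp

/-- Along a congruence of rays issued from a fixed event the product of the wave covector with
the connecting vector vanishes. -/
theorem covector_dotProduct_connecting {ginv : Event → Tensor} {M : Set Event}
    {D : Set Space} (hD : IsOpen D) (hsymm : ∀ y ∈ M, (ginv y).IsSymm)
    (hdiff : ∀ y ∈ M, ∀ α β, DifferentiableAt ℝ (fun y => ginv y α β) y)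
    {γ : Space → ℝ → Event} {k : Space → ℝ → Fin 4 → ℝ} {O : Set (Space × ℝ)} (hO : IsOpen O)
    (hDO : D ×ˢ Set.Icc (0 : ℝ) 1 ⊆ O)
    (hγ : ContDiffOn ℝ 2 (fun q : Space × ℝ => γ q.1 q.2) O)
    (hk : ContDiffOn ℝ 1 (fun q : Space × ℝ => k q.1 q.2) O)
    (hray : ∀ x ∈ D, IsLightRay ginv M (γ x) (k x)) {y₀ : Event} (h0 : ∀ x ∈ D, γ x 0 = y₀)
    {x : Space} (hx : x ∈ D) (e : Space) :
    ∑ α, k x 1 α * fderiv ℝ (fun v => γ v 1 α) x e = 0 := by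
  have hγα : ∀ α, ContDiffOn ℝ 2 (fun q : ℝ × Space => γ q.2 q.1 α) (Prod.swap ⁻¹' O) := by
    intro α
    have h1 := contDiffOn_pi.1 hγ α
    exact h1.comp (f := fun q : ℝ × Space => (q.2, q.1)) (by fun_prop) fun q hq => hq
  have hOs : IsOpen (Prod.swap ⁻¹' O : Set (ℝ × Space)) := hO.preimage continuous_swap
  -- The connecting vector is the derivative of the position along the ray in the direction `e`;
  -- exchanging the two derivatives gives its evolution from the tangent equation.
  have hJ : ∀ σ ∈ Set.Icc (0 : ℝ) 1, ∀ α,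
      HasDerivAt (fun t => fderiv ℝ (fun v => γ v t α) x e)
        (fderiv ℝ (fun v => ∑ β, ginv (γ v σ) α β * k v σ β) x e) σ := by
    intro σ hσ α
    have h1 := hasDerivAt_fderiv hOs (hγα α) (q := (σ, x)) (hDO ⟨hx, hσ⟩) e
    have h2 : (fun v => deriv (fun t => γ v t α) σ) =ᶠ[𝓝 x]
        fun v => ∑ β, ginv (γ v σ) α β * k v σ β := by
      filter_upwards [hD.mem_nhds hx] with v hv
      exact (hasDerivAt_pi.1 ((hray v hv).tangent σ hσ) α).deriv
    simpa only [h2.fderiv_eq] using h1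
  have hdγ : ∀ σ ∈ Set.Icc (0 : ℝ) 1, DifferentiableAt ℝ (fun v => γ v σ) x := by
    intro σ hσ
    have h1 : DifferentiableAt ℝ (fun q : Space × ℝ => γ q.1 q.2) (x, σ) :=
      ((hγ.contDiffAt (hO.mem_nhds (hDO ⟨hx, hσ⟩))).differentiableAt (by simp))
    exact h1.comp (f := fun v : Space => (v, σ)) x (by fun_prop)
  have hdk : ∀ σ ∈ Set.Icc (0 : ℝ) 1, ∀ α, DifferentiableAt ℝ (fun v => k v σ α) x := by
    intro σ hσ α
    have h1 : DifferentiableAt ℝ (fun q : Space × ℝ => k q.1 q.2) (x, σ) :=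
      ((hk.contDiffAt (hO.mem_nhds (hDO ⟨hx, hσ⟩))).differentiableAt (by simp))
    exact differentiableAt_pi.1 (h1.comp (f := fun v : Space => (v, σ)) x (by fun_prop)) α
  have hdg : ∀ σ ∈ Set.Icc (0 : ℝ) 1, ∀ α β,
      DifferentiableAt ℝ (fun v => ginv (γ v σ) α β) x ∧
      fderiv ℝ (fun v => ginv (γ v σ) α β) x e = ∑ δ, partialDeriv δ (fun y => ginv y α β) (γ x σ)
        * fderiv ℝ (fun v => γ v σ δ) x e := by
    intro σ hσ α β
    have h1 := hdiff _ ((hray x hx).mem σ hσ) α β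
    have h2 := hdγ σ hσ
    refine ⟨DifferentiableAt.comp (g := fun y => ginv y α β) x h1 h2, ?_⟩
    have h3 := (h1.hasFDerivAt.comp x h2.hasFDerivAt).fderiv
    simp only [Function.comp_def] at h3
    rw [h3, ContinuousLinearMap.comp_apply, fderiv_apply_eq_sum_partialDeriv]
    refine Finset.sum_congr rfl fun δ _ => ?_
    rw [(hasFDerivAt_pi'.1 h2.hasFDerivAt δ).fderiv]
    simp
  -- The product of covector and connecting vector is constant along the ray: by the geodesic
  -- equation and the previous step its derivative is half the `e`-derivative of `g^{αβ} k_α k_β`,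
  -- which vanishes since all nearby rays are null.
  set c : ℝ → ℝ := fun t => ∑ α, k x t α * fderiv ℝ (fun v => γ v t α) x e with hc
  have hcd : ∀ σ ∈ Set.Icc (0 : ℝ) 1, HasDerivAt c 0 σ := by
    intro σ hσ
    have h1 := HasDerivAt.fun_sum (u := Finset.univ) fun α _ =>
      ((hray x hx).geodesic σ hσ α).fun_mul (hJ σ hσ α)
    refine h1.congr_deriv ?_
    set κ := k x σ with hκ
    set dκ : Fin 4 → ℝ := fun α => fderiv ℝ (fun v => k v σ α) x e with hdκ
    set dγ : Fin 4 → ℝ := fun α => fderiv ℝ (fun v => γ v σ α) x e with hdγ'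
    set g := ginv (γ x σ) with hg
    set dg : Tensor := Matrix.of fun α β => fderiv ℝ (fun v => ginv (γ v σ) α β) x e with hdg'
    have e1 : ∀ α, fderiv ℝ (fun v => ∑ β, ginv (γ v σ) α β * k v σ β) x e
        = ∑ β, (dg α β * κ β + g α β * dκ β) := by
      intro α
      rw [fderiv_fun_sum fun β _ => (hdg σ hσ α β).1.fun_mul (hdk σ hσ β)]
      simp only [sum_apply]
      refine Finset.sum_congr rfl fun β _ => ?_
      rw [fderiv_fun_mul (hdg σ hσ α β).1 (hdk σ hσ β)]
      simp [hdg', hdκ, hg, hκ]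
      ring
    -- The null condition, differentiated across the congruence.
    have e2 : ∑ α, (dκ α * ∑ β, g α β * κ β + κ α * ∑ β, (dg α β * κ β + g α β * dκ β)) = 0 := by
      have hn : (fun v => ∑ α, k v σ α * ∑ β, ginv (γ v σ) α β * k v σ β) =ᶠ[𝓝 x] fun _ => 0 := by
        filter_upwards [hD.mem_nhds hx] with v hv using (hray v hv).null σ hσ
      have h2 : fderiv ℝ (fun v => ∑ α, k v σ α * ∑ β, ginv (γ v σ) α β * k v σ β) x e = 0 := by
        rw [hn.fderiv_eq]
        simp
      have hds : ∀ α, DifferentiableAt ℝ (fun v => ∑ β, ginv (γ v σ) α β * k v σ β) x := fun α =>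
        DifferentiableAt.fun_sum fun β _ => (hdg σ hσ α β).1.fun_mul (hdk σ hσ β)
      rw [fderiv_fun_sum fun α _ => (hdk σ hσ α).fun_mul (hds α)] at h2
      rw [← h2]
      simp only [sum_apply]
      refine Finset.sum_congr rfl fun α _ => ?_
      rw [fderiv_fun_mul (hdk σ hσ α) (hds α)]
      simp only [add_apply, smul_apply, e1, smul_eq_mul]
      simp only [hdκ, hg, hκ]
      ring
    have e3 : ∑ α, (-(1 / 2) * ∑ β, ∑ δ, partialDeriv α (fun y => ginv y β δ) (γ x σ) * κ β * κ δ)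
        * dγ α = -(1 / 2) * ∑ β, ∑ δ, κ β * dg β δ * κ δ := by
      have : ∀ β δ, dg β δ = ∑ α, partialDeriv α (fun y => ginv y β δ) (γ x σ) * dγ α :=
        fun β δ => (hdg σ hσ β δ).2
      simp only [this, Finset.mul_sum, Finset.sum_mul]
      rw [Finset.sum_comm]
      refine Finset.sum_congr rfl fun β _ => ?_
      rw [Finset.sum_comm]
      refine Finset.sum_congr rfl fun δ _ => Finset.sum_congr rfl fun α _ => ?_
      ring
    have e4 : ∑ α, dκ α * ∑ β, g α β * κ β = ∑ α, κ α * ∑ β, g α β * dκ β := by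
      simp only [Finset.mul_sum]
      rw [Finset.sum_comm]
      refine Finset.sum_congr rfl fun β _ => Finset.sum_congr rfl fun α _ => ?_
      have : g α β = g β α := (hsymm _ ((hray x hx).mem σ hσ)).apply β α
      rw [this]
      ring
    have e5 : ∑ α, κ α * ∑ β, dg α β * κ β = ∑ β, ∑ δ, κ β * dg β δ * κ δ := by
      simp only [Finset.mul_sum, mul_assoc]
    rw [Finset.sum_add_distrib, e3]
    simp only [e1]
    simp only [Finset.sum_add_distrib, mul_add] at e2 ⊢
    rw [e4, e5] at e2
    rw [e5]
    linarith
  -- All rays start at the same event, so the connecting vector vanishes there.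
  have hc0 : c 0 = 0 := by
    have : ∀ α, (fun v => γ v 0 α) =ᶠ[𝓝 x] fun _ => y₀ α := fun α => by
      filter_upwards [hD.mem_nhds hx] with v hv
      rw [h0 v hv]
    simp [hc, (this _).fderiv_eq]
  have := constant_of_has_deriv_right_zero (f := c) (a := 0) (b := 1)
    (fun σ hσ => (hcd σ hσ).continuousAt.continuousWithinAt)
    (fun σ hσ => (hcd σ ⟨hσ.1, hσ.2.le⟩).hasDerivWithinAt) 1 ⟨zero_le_one, le_rfl⟩
  rw [hc0] at this
  exact this

/-- The eikonal equation. -/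
theorem IsEmissionRange.eikonal {ginv : Event → Tensor} {M : Set Event} {tA : ℝ} {xA : Space}
    {D : Set Space} (hD : IsOpen D) (hsymm : ∀ y ∈ M, (ginv y).IsSymm)
    (hdiff : ∀ y ∈ M, ∀ α β, DifferentiableAt ℝ (fun y => ginv y α β) y)
    {R : Space → ℝ} (hR : IsEmissionRange ginv M tA xA D R) {x : Space} (hx : x ∈ D) :
    ginv (event (tA + R x) x) 0 0
      - 2 * ∑ i : Fin 3, ginv (event (tA + R x) x) 0 i.succ * grad R x i
      + ∑ i : Fin 3, ∑ j : Fin 3, ginv (event (tA + R x) x) i.succ j.succ * grad R x i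
        * grad R x j = 0 := by
  obtain ⟨γ, k, O, hO, hDO, hγ, hk, hray⟩ := hR
  -- Moving the endpoint in the direction `i` changes the arrival event by `∂ᵢR` in time and by the
  -- unit vector in space.
  have h1 : ∀ i : Fin 3, k x 1 i.succ = -(k x 1 0 * grad R x i) := by
    intro i
    have h := covector_dotProduct_connecting hD hsymm hdiff hO hDO hγ hk
      (fun x hx => (hray x hx).1) (fun x hx => (hray x hx).2.1) hx (EuclideanSpace.single i 1)
    have e0 : (fun v => γ v 1 0) =ᶠ[𝓝 x] fun v => tA + R v := by
      filter_upwards [hD.mem_nhds hx] with v hv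
      rw [(hray v hv).2.2, event_zero]
    have e1 : ∀ j : Fin 3, (fun v => γ v 1 j.succ) =ᶠ[𝓝 x] fun v => v j := by
      intro j
      filter_upwards [hD.mem_nhds hx] with v hv
      rw [(hray v hv).2.2, event_succ]
    have e2 : ∀ j : Fin 3, fderiv ℝ (fun v : Space => v j) x (EuclideanSpace.single i 1)
        = if j = i then 1 else 0 := by
      intro j
      have : fderiv ℝ (fun v : Space => v j) x = EuclideanSpace.proj j :=
        (EuclideanSpace.proj (𝕜 := ℝ) j).hasFDerivAt.fderiv
      rw [this]
      simp
    rw [Fin.sum_univ_succ, e0.fderiv_eq, fderiv_const_add] at h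
    simp only [(e1 _).fderiv_eq, e2] at h
    simp only [mul_ite, mul_one, mul_zero, Finset.sum_ite_eq', Finset.mem_univ, if_true] at h
    simp only [grad]
    linarith
  have hmem : (1 : ℝ) ∈ Set.Icc (0 : ℝ) 1 := ⟨zero_le_one, le_rfl⟩
  -- By `h1` the spatial components are multiples of the time component, and the covector is not
  -- zero.
  have hk0 : k x 1 0 ≠ 0 := by
    intro hz
    refine (hray x hx).1.ne_zero 1 hmem ?_
    funext α
    refine Fin.cases hz (fun i => ?_) α
    simp [h1 i, hz]
  have hn := (hray x hx).1.null 1 hmem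
  have hs := hsymm _ ((hray x hx).1.mem 1 hmem)
  rw [(hray x hx).2.2] at hn hs
  set g := ginv (event (tA + R x) x)
  have hg : ∀ i : Fin 3, g i.succ 0 = g 0 i.succ := fun i => hs.apply 0 i.succ
  -- The null condition at the endpoint is the eikonal expression times the square of the time
  -- component.
  have hexp : k x 1 ⬝ᵥ (g *ᵥ k x 1) = k x 1 0 ^ 2 * (g 0 0 - 2 * ∑ i : Fin 3, g 0 i.succ * grad R x i
      + ∑ i : Fin 3, ∑ j : Fin 3, g i.succ j.succ * grad R x i * grad R x j) := by
    simp only [dotProduct, Matrix.mulVec, Fin.sum_univ_succ (n := 3), h1, hg]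
    simp only [Fin.sum_univ_three]
    ring
  rw [hexp] at hn
  exact (mul_eq_zero.1 hn).resolve_left (pow_ne_zero 2 hk0)

theorem hasFDerivAt_norm_sub {xA x : Space} (hx : x ≠ xA) :
    HasFDerivAt (fun y : Space => ‖y - xA‖) (innerSL ℝ (dir xA x)) x := by
  have hn : ‖x - xA‖ ≠ 0 := norm_ne_zero_iff.2 (sub_ne_zero.2 hx)
  have h1 : HasFDerivAt (fun y : Space => ‖y - xA‖ ^ 2) _ x :=
    ((hasFDerivAt_id x).sub_const xA).norm_sq
  have h2 := h1.sqrt (pow_ne_zero 2 hn)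
  simp only [id, Real.sqrt_sq (norm_nonneg _)] at h2
  refine h2.congr_fderiv ?_
  ext v
  simp [dir]
  field_simp

theorem grad_add_norm {xA x : Space} (hx : x ≠ xA) {R : Space → ℝ}
    (hd : DifferentiableAt ℝ (delay xA R) x) (i : Fin 3) :
    grad R x i = dir xA x i + grad (delay xA R) x i := by
  have h1 : R = fun y => ‖y - xA‖ + delay xA R y := by
    funext y
    simp [delay]
  have h2 := ((hasFDerivAt_norm_sub hx).add hd.hasFDerivAt).fderiv
  conv_lhs => rw [h1]
  simp only [grad]
  have h3 : (fun y => ‖y - xA‖ + delay xA R y) = (fun y => ‖y - xA‖) + delay xA R := rfl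
  rw [h3, h2]
  simp [EuclideanSpace.inner_single_right]

theorem sum_dir_sq {xA x : Space} (hx : x ≠ xA) : ∑ i, dir xA x i ^ 2 = 1 := by
  have hn : ‖x - xA‖ ≠ 0 := norm_ne_zero_iff.2 (sub_ne_zero.2 hx)
  have h1 : ‖dir xA x‖ = 1 := by
    rw [dir, norm_smul, norm_inv, norm_norm, inv_mul_cancel₀ hn]
  rw [← EuclideanSpace.real_norm_sq_eq, h1, one_pow]

theorem dir_seg {xA x : Space} {μ : ℝ} (hμ : 0 < μ) : dir xA (seg xA x μ) = dir xA x := by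
  simp only [dir, seg, add_sub_cancel_left, norm_smul, Real.norm_eq_abs, abs_of_pos hμ, mul_inv,
    smul_smul]
  congr 1
  field_simp

theorem norm_seg_sub {xA x : Space} {μ : ℝ} (hμ : 0 ≤ μ) :
    ‖seg xA x μ - xA‖ = μ * ‖x - xA‖ := by
  simp [seg, norm_smul, abs_of_nonneg hμ]

/-- The total delay solves the integrodifferential equation driven by the full perturbation of
the optical metric. -/
theorem IsEmissionRange.isDelayDrivenBy {K : Event → Tensor} {M : Set Event} {tA : ℝ} {xA : Space}
    {D : Set Space} (hD : IsReceptionDomain xA D) (hsymm : ∀ y ∈ M, (K y).IsSymm)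
    (hdiff : ∀ y ∈ M, ∀ α β, DifferentiableAt ℝ (fun y => K y α β) y)
    {R : Space → ℝ} (hR : IsEmissionRange (fun y => minkowski + K y) M tA xA D R)
    (hR0 : R xA = 0) (hd : DifferentiableOn ℝ (delay xA R) D)
    (hseg : ∀ x ∈ D, ContDiffOn ℝ 1 (fun μ => delay xA R (seg xA x μ)) (Set.Icc 0 1)) :
    IsDelayDrivenBy K tA xA D (delay xA R) (delay xA R) := by
  intro x hx
  set f : ℝ → ℝ := fun μ => delay xA R (seg xA x μ) with hf
  have hne : ∀ y ∈ D, y ≠ xA := fun y hy h => hD.notMem (h ▸ hy)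
  have hdy : ∀ y ∈ D, DifferentiableAt ℝ (delay xA R) y := fun y hy =>
    (hd y hy).differentiableAt (hD.isOpen.mem_nhds hy)
  have hn : ‖x - xA‖ ≠ 0 := norm_ne_zero_iff.2 (sub_ne_zero.2 (hne x hx))
  have hder : ∀ μ ∈ Set.Ioc (0 : ℝ) 1,
      HasDerivAt f (∑ i, grad (delay xA R) (seg xA x μ) i * (x - xA) i) μ := by
    intro μ hμ
    have h1 : HasDerivAt (fun μ => seg xA x μ) (x - xA) μ := by
      simpa [seg] using ((hasDerivAt_id μ).smul_const (x - xA)).const_add xA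
    have h2 := (hdy _ (seg_mem hD hx hμ)).hasFDerivAt.comp_hasDerivAt μ h1
    rw [fderiv_apply_eq_sum_grad] at h2
    exact h2
  -- Insert `∇R = N + ∇Ξ` into the eikonal equation. The Minkowskian part contributes `1 - |N|² = 0`
  -- and the linear term `-2 N·∇Ξ`; solving for the latter gives the derivative along the segment.
  -- Symmetry of `K` merges the mixed terms in `N` and `∇Ξ`.
  have hval : ∀ μ ∈ Set.Ioc (0 : ℝ) 1, ∑ i, grad (delay xA R) (seg xA x μ) i * (x - xA) i
      = ‖x - xA‖ / 2 *
    (source (K (event (tA + μ * ‖x - xA‖ + delay xA R (seg xA x μ)) (seg xA x μ))) (dir xA x)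
      - 2 * lin (K (event (tA + μ * ‖x - xA‖ + delay xA R (seg xA x μ)) (seg xA x μ))) (dir xA x)
          (grad (delay xA R) (seg xA x μ))
      + quad (minkowski + K (event (tA + μ * ‖x - xA‖ + delay xA R (seg xA x μ)) (seg xA x μ)))
          (grad (delay xA R) (seg xA x μ)) (grad (delay xA R) (seg xA x μ))) := by
    intro μ hμ
    have hy := seg_mem hD hx hμ
    have hη : ∀ y ∈ M, (minkowski + K y).IsSymm := fun y hy =>
      (Matrix.isSymm_diagonal _).add (hsymm y hy)
    have heik := hR.eikonal hD.isOpen hη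
      (fun y hy α β => by
        simpa using (differentiableAt_const (minkowski α β)).fun_add (hdiff y hy α β)) hy
    have htime : tA + R (seg xA x μ) = tA + μ * ‖x - xA‖ + delay xA R (seg xA x μ) := by
      rw [delay, norm_seg_sub hμ.1.le]
      ring
    have hmem : event (tA + R (seg xA x μ)) (seg xA x μ) ∈ M := by
      obtain ⟨γ, k, O, -, -, -, -, hray⟩ := hR
      have := (hray _ hy).1.mem 1 ⟨zero_le_one, le_rfl⟩
      rwa [(hray _ hy).2.2] at this
    have hs := hsymm _ hmem
    rw [htime] at heik hs
    set k := K (event (tA + μ * ‖x - xA‖ + delay xA R (seg xA x μ)) (seg xA x μ))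
    have hg : ∀ i, grad R (seg xA x μ) i = dir xA x i + grad (delay xA R) (seg xA x μ) i := by
      intro i
      rw [grad_add_norm (hne _ hy) (hdy _ hy), dir_seg hμ.1]
    have hN := sum_dir_sq (hne x hx)
    have hxN : ∀ i, (x - xA) i = ‖x - xA‖ * dir xA x i := by
      intro i
      simp only [dir, PiLp.smul_apply, smul_eq_mul]
      field_simp
    have s10 : k 2 1 = k 1 2 := hs.apply 1 2
    have s20 : k 3 1 = k 1 3 := hs.apply 1 3
    have s21 : k 3 2 = k 2 3 := hs.apply 2 3
    simp only [hg, hxN, source, lin, quad] at heik ⊢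
    generalize grad (delay xA R) (seg xA x μ) = u at *
    generalize dir xA x = N at *
    generalize ‖x - xA‖ = r at *
    simp [Fin.sum_univ_three, minkowski, Matrix.diagonal_apply, Fin.succ_inj] at heik hN ⊢
    rw [s10, s20, s21] at heik ⊢
    linear_combination -(r / 2) * heik - (r / 2) * hN
  -- The derivative within `[0, 1]` is continuous up to `μ = 0`, so the fundamental theorem applies
  -- although `delay xA R` itself may fail to be differentiable at `xA`.
  have hint := intervalIntegral.integral_eq_sub_of_hasDerivAt_of_le (f := f)
    (f' := derivWithin f (Set.Icc 0 1)) zero_le_one (hseg x hx).continuousOn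
    (fun μ hμ => by
      have h1 := hder μ ⟨hμ.1, hμ.2.le⟩
      rw [derivWithin_of_mem_nhds (Icc_mem_nhds hμ.1 hμ.2)]
      exact h1.differentiableAt.hasDerivAt)
    (((hseg x hx).continuousOn_derivWithin (uniqueDiffOn_Icc zero_lt_one) le_rfl)
      |>.intervalIntegrable_of_Icc zero_le_one)
  have hf1 : f 1 = delay xA R x := by simp [hf, seg]
  have hf0 : f 0 = 0 := by simp [hf, seg, delay, hR0]
  rw [hf1, hf0, sub_zero] at hint
  rw [← hint, ← intervalIntegral.integral_const_mul]
  refine integral_congr_Ioc fun μ hμ => ?_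
  rw [← hval μ hμ]
  rw [← (hder μ hμ).deriv]
  exact (hder μ hμ).differentiableAt.derivWithin
    (uniqueDiffOn_Icc zero_lt_one μ (Set.Ioc_subset_Icc_self hμ))

/-! ### Expansion of a composition -/

theorem coeff_pow_eq_sum_antidiagonalTuple (Z : ℝ⟦X⟧) (n j : ℕ) :
    coeff j (Z ^ n) = ∑ ν ∈ Finset.Nat.antidiagonalTuple n j, ∏ d : Fin n, coeff (ν d) Z := by
  have h : Z ^ n = ∏ _d : Fin n, Z := by simp
  rw [h, coeff_prod]
  refine Finset.sum_bij' (fun ν _ => (ν : Fin n → ℕ)) (fun ν _ => Finsupp.equivFunOnFinite.symm ν)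
    ?_ ?_ ?_ ?_ ?_
  · intro ν hν
    simpa [Finset.Nat.mem_antidiagonalTuple, Finset.mem_finsuppAntidiag] using hν
  · intro ν hν
    simpa [Finset.Nat.mem_antidiagonalTuple, Finset.mem_finsuppAntidiag] using hν
  · intro ν _
    ext
    simp
  · intro ν _
    simp
  · intro ν _
    rfl

/-- Factor `Z = X * Z₁`, so `Zⁿ = Xⁿ * Z₁ⁿ`. This shift is the origin of the indices `n_d + 1` and
of the total `l - m` in the emission functions. -/
theorem coeff_pow_of_constantCoeff_eq_zero {Z : ℝ⟦X⟧} (hZ : coeff 0 Z = 0) (n j : ℕ) :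
    coeff j (Z ^ n) = if n ≤ j then
      ∑ ν ∈ Finset.Nat.antidiagonalTuple n (j - n), ∏ d : Fin n, coeff (ν d + 1) Z else 0 := by
  have h : Z = X * PowerSeries.mk fun j => coeff (j + 1) Z := by
    ext j
    rcases j with _ | j
    · rw [hZ, coeff_zero_X_mul]
    · rw [coeff_succ_X_mul, coeff_mk]
  conv_lhs => rw [h, mul_pow, coeff_X_pow_mul']
  split_ifs with hn
  · rw [coeff_pow_eq_sum_antidiagonalTuple]
    simp
  · rfl

/-- The mixed Taylor coefficients of `F (u, t)` at `(0, t₀)`, without the factor `1 / n!`. -/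
noncomputable def mixedCoeff (F : ℝ × ℝ → ℝ) (t₀ : ℝ) (m n : ℕ) : ℝ :=
  iteratedDeriv n (fun t => coeff m (jet fun u => F (u, t))) t₀

theorem HasJet.isBigO_id {ξ : ℝ → ℝ} {Z : ℝ⟦X⟧} (hξ : HasJet (𝓝 0) id ξ fun _ => Z)
    (hZ : coeff 0 Z = 0) : ξ =O[𝓝 0] fun ε => ε := by
  have := hξ.approx 1
  simp only [Finset.range_one, Finset.sum_singleton, hZ, zero_mul, sub_zero, pow_one, id] at this
  exact this

/-- Two Taylor expansions are composed: first in the parameter `u = ε ^ σ * k`, then of each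
coefficient in the time `t₀ + ξ ε`. The first must be uniform for `t` near `t₀`, since the time
moves with `ε`. Both are cut at order `l + 1`, and uniqueness of coefficients finishes. -/
theorem coeff_comp {F : ℝ × ℝ → ℝ} {U V : Set ℝ} (hU : IsOpen U) (h0 : (0 : ℝ) ∈ U)
    (hV : IsOpen V) {t₀ : ℝ} (ht₀ : t₀ ∈ V) (hF : ContDiffOn ℝ ∞ F (U ×ˢ V)) {ξ : ℝ → ℝ}
    {Z : ℝ⟦X⟧} (hξ : HasJet (𝓝 0) id ξ fun _ => Z) (hZ : coeff 0 Z = 0) (k : ℝ) {σ : ℕ}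
    (hσ : 1 ≤ σ) {c : ℝ⟦X⟧}
    (hc : HasJet (𝓝 0) id (fun ε => F (ε ^ σ * k, t₀ + ξ ε)) fun _ => c) (l : ℕ) :
    coeff l c = ∑ m ∈ Finset.range (l + 1), ∑ n ∈ Finset.range (l + 1),
      k ^ m * mixedCoeff F t₀ m n / (n.factorial : ℝ) * coeff l (X ^ (σ * m) * Z ^ n) := by
  have hid : (id : ℝ → ℝ) =O[𝓝 0] fun _ => (1 : ℝ) := (tendsto_id (x := 𝓝 (0 : ℝ))).isBigO_one ℝ
  have hξO := hξ.isBigO_id hZ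
  have hξ0 : Tendsto ξ (𝓝 0) (𝓝 0) := hξO.trans_tendsto tendsto_id
  have hu0 : Tendsto (fun ε : ℝ => ε ^ σ * k) (𝓝 0) (𝓝 0) := by
    have : Continuous fun ε : ℝ => ε ^ σ * k := by fun_prop
    have h := this.tendsto 0
    simpa [zero_pow (by omega : σ ≠ 0)] using h
  -- The crude order `ε` suffices in place of `ε ^ σ`, because the truncation length `l + 1` is the
  -- same for every `σ`.
  have huO : (fun ε : ℝ => ε ^ σ * k) =O[𝓝 0] fun ε => ε := by
    obtain ⟨τ, rfl⟩ : ∃ τ, σ = τ + 1 := ⟨σ - 1, by omega⟩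
    have h1 : (fun ε : ℝ => ε ^ τ * k) =O[𝓝 0] fun _ => (1 : ℝ) := by
      have : Continuous fun ε : ℝ => ε ^ τ * k := by fun_prop
      exact (this.tendsto 0).isBigO_one ℝ
    refine (h1.mul (isBigO_refl (fun ε : ℝ => ε) (𝓝 0))).congr (fun ε => by ring) fun ε => by ring
  have hmc : ∀ m, ContDiffOn ℝ ∞ (fun t => coeff m (jet fun u => F (u, t))) V := by
    intro m
    simp only [coeff_jet]
    exact ((contDiffOn_iteratedDeriv_slice hU hV.uniqueDiffOn hF m).comp
      (f := fun t : ℝ => ((0 : ℝ), t)) (by fun_prop) fun t ht => ⟨h0, ht⟩).div_const _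
  obtain ⟨d, hd, hdV⟩ := Metric.nhds_basis_closedBall.mem_iff.1 (hV.mem_nhds ht₀)
  obtain ⟨δ, hδ, hδU⟩ := Metric.nhds_basis_closedBall.mem_iff.1 (hU.mem_nhds h0)
  have hfam : HasJet (𝓝 (0 : ℝ) ×ˢ 𝓟 (Metric.closedBall t₀ d)) Prod.fst F
      (fun q => jet fun u => F (u, q.2)) := by
    refine hasJet_family hU h0 (fun t ht => ?_) fun n => ?_
    · exact hF.comp (f := fun u : ℝ => (u, t)) (by fun_prop) fun u hu => ⟨hu, hdV ht⟩
    · obtain ⟨B, hB⟩ := ((isCompact_closedBall (0 : ℝ) δ).prod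
        (isCompact_closedBall t₀ d)).exists_bound_of_continuousOn
        ((contDiffOn_iteratedDeriv_slice hU hV.uniqueDiffOn hF n).continuousOn.mono
          (Set.prod_mono hδU hdV))
      exact ⟨B, δ, hδ, fun t ht u hu => hB (u, t) ⟨by simpa using hu, ht⟩⟩
  have htd : Tendsto (fun ε => (ε ^ σ * k, t₀ + ξ ε)) (𝓝 0)
      (𝓝 (0 : ℝ) ×ˢ 𝓟 (Metric.closedBall t₀ d)) := by
    refine hu0.prodMk (tendsto_principal.2 ?_)
    have h1 : Tendsto (fun ε => t₀ + ξ ε) (𝓝 0) (𝓝 t₀) := by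
      simpa using hξ0.const_add t₀
    exact h1 (Metric.closedBall_mem_nhds t₀ hd)
  have s1 : (fun ε => F (ε ^ σ * k, t₀ + ξ ε) - ∑ m ∈ Finset.range (l + 1),
      coeff m (jet fun u => F (u, t₀ + ξ ε)) * (ε ^ σ * k) ^ m) =O[𝓝 0] fun ε => ε ^ (l + 1) :=
    ((hfam.approx (l + 1)).comp_tendsto htd).trans (huO.pow (l + 1))
  have s2 : ∀ m, (fun ε => coeff m (jet fun u => F (u, t₀ + ξ ε)) - ∑ n ∈ Finset.range (l + 1),
      mixedCoeff F t₀ m n / (n.factorial : ℝ) * ξ ε ^ n) =O[𝓝 0] fun ε => ε ^ (l + 1) := by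
    intro m
    have hV' : IsOpen {δ : ℝ | t₀ + δ ∈ V} := hV.preimage (by fun_prop)
    have h1 : HasJet (𝓝 0) id (fun δ => coeff m (jet fun u => F (u, t₀ + δ))) _ :=
      hasJet_of_contDiffAt hV' (by simpa using ht₀)
        ((hmc m).comp (f := fun δ : ℝ => t₀ + δ) (by fun_prop) fun δ hδ => hδ)
    refine (((h1.approx (l + 1)).comp_tendsto hξ0).trans (hξO.pow (l + 1))).congr_left fun ε => ?_
    have h2 : ∀ n, iteratedDeriv n (fun δ => coeff m (jet fun u => F (u, t₀ + δ))) 0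
        = mixedCoeff F t₀ m n := by
      intro n
      have h3 := congrFun (iteratedDeriv_comp_const_add n
        (fun t => coeff m (jet fun u => F (u, t))) t₀) 0
      rw [add_zero] at h3
      exact h3
    simp only [Function.comp, id]
    rw [Finset.sum_congr rfl fun n _ => by rw [coeff_jet, h2]]
  have s3 : (fun ε => F (ε ^ σ * k, t₀ + ξ ε) - ∑ m ∈ Finset.range (l + 1),
      ∑ n ∈ Finset.range (l + 1),
        (k ^ m * mixedCoeff F t₀ m n / (n.factorial : ℝ)) * ((ε ^ (σ * m)) * ξ ε ^ n))
      =O[𝓝 0] fun ε => ε ^ (l + 1) := by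
    have h1 : (fun ε => ∑ m ∈ Finset.range (l + 1), (ε ^ σ * k) ^ m *
        (coeff m (jet fun u => F (u, t₀ + ξ ε)) - ∑ n ∈ Finset.range (l + 1),
          mixedCoeff F t₀ m n / (n.factorial : ℝ) * ξ ε ^ n)) =O[𝓝 0] fun ε => ε ^ (l + 1) := by
      refine IsBigO.fun_sum fun m _ => ?_
      have h2 : (fun ε : ℝ => (ε ^ σ * k) ^ m) =O[𝓝 0] fun _ => (1 : ℝ) := by
        have : Continuous fun ε : ℝ => (ε ^ σ * k) ^ m := by fun_prop
        exact (this.tendsto 0).isBigO_one ℝ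
      simpa using h2.mul (s2 m)
    refine (s1.add h1).congr_left fun ε => ?_
    rw [sub_add, ← Finset.sum_sub_distrib]
    congr 1
    refine Finset.sum_congr rfl fun m _ => ?_
    rw [mul_sub, mul_comm, sub_sub_cancel, Finset.mul_sum]
    refine Finset.sum_congr rfl fun n _ => ?_
    rw [mul_pow, ← pow_mul]
    ring
  have hsum : HasJet (𝓝 0) id (fun ε => ∑ m ∈ Finset.range (l + 1), ∑ n ∈ Finset.range (l + 1),
        (k ^ m * mixedCoeff F t₀ m n / (n.factorial : ℝ)) * ((ε ^ (σ * m)) * ξ ε ^ n))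
      (fun _ => ∑ m ∈ Finset.range (l + 1), ∑ n ∈ Finset.range (l + 1),
        C (k ^ m * mixedCoeff F t₀ m n / (n.factorial : ℝ)) * (X ^ (σ * m) * Z ^ n)) := by
    refine HasJet.sum _ fun m _ => HasJet.sum _ fun n _ => ?_
    exact HasJet.const_mul (r := fun _ => k ^ m * mixedCoeff F t₀ m n / (n.factorial : ℝ)) hid
      (isBigO_const_const _ one_ne_zero _)
      (((HasJet.self hid).pow hid (σ * m)).mul hid (hξ.pow hid n))
  rw [hc.coeff_eq hsum s3 (Nat.lt_succ_self l)]
  simp only [map_sum, coeff_C_mul]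

/-- The expansion of a composition, sorted by the order of the terms. `T m n` stands for
`∂ₜⁿ` of the term of order `m` of the function, and `φ j n` for the coefficient of order `j`
of `ξⁿ / n!`. -/
theorem sum_coeff_X_pow_mul_pow {Z : ℝ⟦X⟧} (hZ : coeff 0 Z = 0) {σ l : ℕ} (hσ : 1 ≤ σ)
    {T φ : ℕ → ℕ → ℝ} (hT : ∀ n, T 0 n = 0)
    (hφ : ∀ j n, 1 ≤ n → n ≤ j → φ j n = coeff j (Z ^ n) / (n.factorial : ℝ)) (hl : σ ≤ l) :
    ∑ m ∈ Finset.range (l + 1), ∑ n ∈ Finset.range (l + 1),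
      T m n / (n.factorial : ℝ) * coeff l (X ^ (σ * m) * Z ^ n)
    = (if l % σ = 0 then T (l / σ) 0
        else ∑ n ∈ Finset.Icc 1 (l % σ), φ (l % σ) n * T (l / σ) n)
      + ∑ m ∈ Finset.Icc 1 (l / σ - 1), ∑ n ∈ Finset.Icc 1 (m * σ + l % σ),
          φ (m * σ + l % σ) n * T (l / σ - m) n := by
  -- `Z` has no constant term, so `Zⁿ` contributes to order `j` only if `n ≤ j`. At `j = 0` only `n
  -- = 0` survives, while for `j > 0` the value `n = 0` drops out.
  have hE : ∀ j m, j ≤ l → ∑ n ∈ Finset.range (l + 1), T m n / (n.factorial : ℝ) * coeff j (Z ^ n)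
      = if j = 0 then T m 0 else ∑ n ∈ Finset.Icc 1 j, φ j n * T m n := by
    intro j m hj
    split_ifs with h0
    · subst h0
      rw [Finset.sum_eq_single 0]
      · simp
      · intro n _ hn
        rw [coeff_pow_of_constantCoeff_eq_zero hZ, if_neg (by omega), mul_zero]
      · simp
    · have h1 : Finset.Icc 1 j ⊆ Finset.range (l + 1) := by
        intro n hn
        simp only [Finset.mem_Icc, Finset.mem_range] at *
        omega
      rw [← Finset.sum_subset h1]
      · refine Finset.sum_congr rfl fun n hn => ?_
        rw [Finset.mem_Icc] at hn
        rw [hφ j n hn.1 hn.2]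
        ring
      · intro n _ hn
        rcases Nat.eq_zero_or_pos n with rfl | hn0
        · simp [coeff_one, h0]
        · rw [coeff_pow_of_constantCoeff_eq_zero hZ, if_neg, mul_zero]
          intro h
          exact hn (Finset.mem_Icc.2 ⟨hn0, h⟩)
  have hdiv : σ * (l / σ) + l % σ = l := Nat.div_add_mod l σ
  have hp : 1 ≤ l / σ := (Nat.one_le_div_iff (by omega)).2 hl
  -- The factor `X ^ (σ * m)` lowers the order to `l - σ * m`. The value `m = 0` contributes nothing
  -- by `hT`, and `m > l / σ` exceeds the available order.
  have h2 : ∑ m ∈ Finset.range (l + 1), ∑ n ∈ Finset.range (l + 1),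
      T m n / (n.factorial : ℝ) * coeff l (X ^ (σ * m) * Z ^ n)
      = ∑ m ∈ Finset.Icc 1 (l / σ), ∑ n ∈ Finset.range (l + 1),
        T m n / (n.factorial : ℝ) * coeff (l - σ * m) (Z ^ n) := by
    have h1 : Finset.Icc 1 (l / σ) ⊆ Finset.range (l + 1) := by
      intro n hn
      simp only [Finset.mem_Icc, Finset.mem_range] at *
      have := Nat.div_le_self l σ
      omega
    rw [← Finset.sum_subset h1]
    · refine Finset.sum_congr rfl fun m hm => Finset.sum_congr rfl fun n _ => ?_
      rw [coeff_X_pow_mul', if_pos]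
      rw [Finset.mem_Icc, Nat.le_div_iff_mul_le (by omega)] at hm
      rw [mul_comm]
      exact hm.2
    · intro m _ hm
      rcases Nat.eq_zero_or_pos m with rfl | hm0
      · simp [hT]
      · refine Finset.sum_eq_zero fun n _ => ?_
        rw [coeff_X_pow_mul', if_neg, mul_zero]
        intro h
        refine hm (Finset.mem_Icc.2 ⟨hm0, ?_⟩)
        rw [Nat.le_div_iff_mul_le (by omega), mul_comm]
        exact h
  rw [h2, Finset.sum_congr rfl fun m _ => hE _ m (Nat.sub_le _ _)]
  obtain ⟨p, hp'⟩ : ∃ p, l / σ = p + 1 := ⟨l / σ - 1, by omega⟩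
  rw [hp'] at hdiv ⊢
  -- The largest `m` leaves the order `l % σ`, which may be zero and is split off. The other values
  -- are reversed by `m ↦ l / σ - m` and leave the order `m * σ + l % σ`, which is never zero.
  rw [Finset.sum_Icc_succ_top (by omega), add_comm, Nat.add_sub_cancel]
  have hq : l - σ * (p + 1) = l % σ := by omega
  rw [hq]
  congr 1
  refine Finset.sum_bij' (fun m _ => p + 1 - m) (fun m _ => p + 1 - m) ?_ ?_ ?_ ?_ ?_
  · intro m hm
    rw [Finset.mem_Icc] at *
    omega
  · intro m hm
    rw [Finset.mem_Icc] at *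
    omega
  · intro m hm
    rw [Finset.mem_Icc] at hm
    omega
  · intro m hm
    rw [Finset.mem_Icc] at hm
    omega
  · intro m hm
    rw [Finset.mem_Icc] at hm
    obtain ⟨r, hr⟩ : ∃ r, p + 1 = m + r := ⟨p + 1 - m, by omega⟩
    have hr' : p + 1 - m = r := by omega
    have e1 : l - σ * m = r * σ + l % σ := by
      rw [hr, mul_add] at hdiv
      rw [mul_comm r σ]
      omega
    have e2 : r * σ + l % σ ≠ 0 := by
      have : 1 ≤ r * σ := Nat.mul_pos (by omega) (by omega)
      omega
    have e3 : p + 1 - r = m := by omega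
    rw [e1, hr', if_neg e2, e3]

/-! ### The terms of the perturbation of the metric -/

theorem minkowski_mul_self : minkowski * minkowski = 1 := by
  rw [minkowski, Matrix.diagonal_mul_diagonal, ← Matrix.diagonal_one]
  congr 1
  funext i
  refine Fin.cases ?_ (fun i => ?_) i <;> simp

theorem contraTerm_succ (H : ℕ → Tensor) (l : ℕ) :
    contraTerm H (l + 1) = -(minkowski * H (l + 1) * minkowski)
      - ∑ m : Fin l, minkowski * H (m + 1) * contraTerm H (l - m) := by
  rw [contraTerm]

theorem contraTerm_zero (H : ℕ → Tensor) : contraTerm H 0 = 0 := by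
  rw [contraTerm]

theorem contraTerm_pow_smul (H : ℕ → Tensor) (G : ℝ) (l : ℕ) :
    contraTerm (fun m => G ^ m • H m) l = G ^ l • contraTerm H l := by
  induction l using Nat.strong_induction_on with
  | _ l ih =>
    rcases l with _ | l
    · simp [contraTerm_zero]
    · rw [contraTerm_succ, contraTerm_succ, smul_sub, smul_neg, Finset.smul_sum]
      congr 1
      · simp
      · refine Finset.sum_congr rfl fun m _ => ?_
        rw [ih _ (by omega), Matrix.mul_smul, Matrix.mul_smul, Matrix.smul_mul, smul_smul, ← pow_add]
        congr 2
        have := m.2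
        omega

/-- The hypothesis `h` is the part of order `l` of `(η + H)(η + A) = 1`. Since `η` is its own
inverse, multiplication by `η` solves it for `A l`, and this is the defining recursion. -/
theorem eq_contraTerm {H A : ℕ → Tensor} (hH : H 0 = 0) (hA : A 0 = 0)
    (h : ∀ l, 1 ≤ l → minkowski * A l + H l * minkowski
      + ∑ q ∈ Finset.HasAntidiagonal.antidiagonal l, H q.1 * A q.2 = 0) (l : ℕ) :
    A l = contraTerm H l := by
  induction l using Nat.strong_induction_on with
  | _ l ih =>
    rcases l with _ | l
    · rw [hA, contraTerm_zero]
    · have h1 : A (l + 1) = minkowski * (minkowski * A (l + 1)) := by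
        rw [← mul_assoc, minkowski_mul_self, one_mul]
      have h2 : minkowski * A (l + 1) = -(H (l + 1) * minkowski)
          - ∑ q ∈ Finset.HasAntidiagonal.antidiagonal (l + 1), H q.1 * A q.2 := by
        have := h (l + 1) (by omega)
        rw [add_assoc] at this
        rw [eq_neg_of_add_eq_zero_left this]
        abel
      rw [h1, h2, contraTerm_succ, mul_sub, mul_neg, mul_assoc, Finset.mul_sum,
        Finset.Nat.sum_antidiagonal_eq_sum_range_succ_mk, Finset.sum_range_succ']
      simp only [hH, zero_mul, mul_zero, add_zero]
      rw [Finset.sum_range_succ]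
      simp only [Nat.sub_self, hA, mul_zero, add_zero]
      rw [Finset.sum_range]
      congr 1
      refine Finset.sum_congr rfl fun m _ => ?_
      have e : l + 1 - (m + 1) = l - m := by omega
      rw [e, ih (l - m) (by omega), mul_assoc]

theorem hTerm_eq (h : ℝ → Event → Tensor) (G : ℝ) (y : Event) (m : ℕ) :
    hTerm h G m y = G ^ m • Matrix.of fun α β => coeff m (jet fun u => h u y α β) := by
  ext α β
  simp [hTerm]
  ring

/-- The terms `k₍ₗ₎` are the Taylor coefficients of `g⁻¹ - η`. -/
theorem kTerm_eq {h : ℝ → Event → Tensor} {y : Event} {U : Set ℝ} (hU : IsOpen U)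
    (h0 : (0 : ℝ) ∈ U) (hh : ∀ α β, ContDiffOn ℝ ∞ (fun u => h u y α β) U)
    (hk : ∀ α β, ContDiffOn ℝ ∞ (fun u => gravPert h u y α β) U)
    (hdet : ∀ u ∈ U, (minkowski + h u y).det ≠ 0) (hz : h 0 y = 0) (G : ℝ) (l : ℕ)
    (α β : Fin 4) :
    kTerm h G l y α β = G ^ l * coeff l (jet fun u => gravPert h u y α β) := by
  have hid : (id : ℝ → ℝ) =O[𝓝 0] fun _ => (1 : ℝ) := (tendsto_id (x := 𝓝 (0 : ℝ))).isBigO_one ℝ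
  set H : ℕ → Tensor := fun m => Matrix.of fun α β => coeff m (jet fun u => h u y α β) with hH
  set A : ℕ → Tensor := fun m => Matrix.of fun α β => coeff m (jet fun u => gravPert h u y α β)
    with hA
  have hk0 : gravPert h 0 y = 0 := by
    rw [gravPert, hz, add_zero, Matrix.inv_eq_right_inv minkowski_mul_self, sub_self]
  -- Entry by entry, `(η + h)(η + k)` is constant near `u = 0`; uniqueness of its expansion kills
  -- every coefficient of order `l ≥ 1`.
  have key : ∀ l, 1 ≤ l → minkowski * A l + H l * minkowski
      + ∑ q ∈ Finset.HasAntidiagonal.antidiagonal l, H q.1 * A q.2 = 0 := by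
    intro l hl
    ext a b
    have hc : ∀ r : ℝ, HasJet (𝓝 0) id (fun _ : ℝ => r) fun _ => C r := fun r =>
      HasJet.const (r := fun _ : ℝ => r) (isBigO_const_const _ one_ne_zero _)
    have j1 : HasJet (𝓝 0) id (fun u => ∑ j, (minkowski a j + h u y a j)
        * (minkowski j b + gravPert h u y j b)) fun _ => ∑ j,
          (C (minkowski a j) + jet fun u => h u y a j)
          * (C (minkowski j b) + jet fun u => gravPert h u y j b) :=
      HasJet.sum _ fun j _ => HasJet.mul hid
        ((hc _).add (hasJet_of_contDiffAt hU h0 (hh a j)))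
        ((hc _).add (hasJet_of_contDiffAt hU h0 (hk j b)))
    have j2 : HasJet (𝓝 0) id (fun u => ∑ j, (minkowski a j + h u y a j)
        * (minkowski j b + gravPert h u y j b)) fun _ => C ((1 : Tensor) a b) := by
      refine (hc ((1 : Tensor) a b)).congr ?_ EventuallyEq.rfl
      filter_upwards [hU.mem_nhds h0] with u hu
      have e1 : (minkowski + h u y) * (minkowski + gravPert h u y) = 1 := by
        rw [gravPert, add_sub_cancel]
        exact Matrix.mul_nonsing_inv _ (isUnit_iff_ne_zero.2 (hdet u hu))
      rw [← e1]
      rfl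
    have j3 := congrArg (coeff l) (j1.unique j2)
    have hl0 : l ≠ 0 := by omega
    have hm : ∀ j, coeff l ((jet fun u => h u y a j) * jet fun u => gravPert h u y j b)
        = ∑ q ∈ Finset.HasAntidiagonal.antidiagonal l, coeff q.1 (jet fun u => h u y a j)
          * coeff q.2 (jet fun u => gravPert h u y j b) := fun j => coeff_mul _ _ _
    simp only [map_sum, mul_add, add_mul, map_add, hm, coeff_mul_C, coeff_C_mul,
      coeff_C, if_neg hl0, zero_mul] at j3
    simp only [Finset.sum_add_distrib, Finset.sum_const_zero] at j3
    simp only [Matrix.add_apply, Matrix.mul_apply, Matrix.sum_apply, Matrix.zero_apply, hA, hH,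
      Matrix.of_apply]
    rw [Finset.sum_comm (s := Finset.HasAntidiagonal.antidiagonal l)]
    linarith
  have hH0 : H 0 = 0 := by
    ext a b
    simp [hH, hz]
  have hA0 : A 0 = 0 := by
    ext a b
    simp [hA, hk0]
  have e1 : kTerm h G l y = G ^ l • contraTerm H l := by
    rw [← contraTerm_pow_smul, kTerm]
    congr 1
    funext m
    exact hTerm_eq h G y m
  rw [e1, ← eq_contraTerm hH0 hA0 key]
  rfl

/-! ### Smoothness of the perturbation of the metric -/

section Smooth

variable {E : Type*} [NormedAddCommGroup E] [NormedSpace ℝ E] {S : Set E}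

theorem contDiffOn_det {A : E → Tensor} (hA : ∀ α β, ContDiffOn ℝ ∞ (fun q => A q α β) S) :
    ContDiffOn ℝ ∞ (fun q => (A q).det) S := by
  simp only [Matrix.det_apply]
  exact ContDiffOn.sum fun σ _ => (contDiffOn_prod fun i _ => hA _ _).const_smul _

/-- Cramer's rule: an entry of the inverse is a determinant with one row replaced, divided by the
determinant of `A`. -/
theorem contDiffOn_inv_apply {A : E → Tensor} (hA : ∀ α β, ContDiffOn ℝ ∞ (fun q => A q α β) S)
    (hdet : ∀ q ∈ S, (A q).det ≠ 0) (α β : Fin 4) :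
    ContDiffOn ℝ ∞ (fun q => (A q)⁻¹ α β) S := by
  simp only [Matrix.inv_def, Ring.inverse_eq_inv', Matrix.smul_apply, smul_eq_mul,
    Matrix.adjugate_apply]
  refine ((contDiffOn_det hA).inv hdet).mul (contDiffOn_det fun a b => ?_)
  by_cases h : a = β
  · subst h
    simp only [Matrix.updateRow_self]
    exact contDiffOn_const
  · simp only [Matrix.updateRow_ne h]
    exact hA a b

theorem contDiffOn_event {t : E → ℝ} {z : E → Space} (ht : ContDiffOn ℝ ∞ t S)
    (hz : ContDiffOn ℝ ∞ z S) : ContDiffOn ℝ ∞ (fun q => event (t q) (z q)) S := by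
  refine contDiffOn_pi.2 fun α => ?_
  refine Fin.cases ?_ (fun i => ?_) α
  · simpa using ht
  · simp only [event_succ]
    exact (EuclideanSpace.proj (𝕜 := ℝ) i).contDiff.comp_contDiffOn hz

end Smooth

theorem contDiffOn_gravPert {P : Set (ℝ × ℝ)} {M : Set Event} {h : ℝ → Event → Tensor}
    (h_smooth : ∀ α β, ContDiffOn ℝ ∞ (fun q : (ℝ × ℝ) × Event => h q.1.2 q.2 α β) (P ×ˢ M))
    (h_det : ∀ p ∈ P, ∀ y ∈ M, (minkowski + h p.2 y).det ≠ 0) (α β : Fin 4) :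
    ContDiffOn ℝ ∞ (fun q : (ℝ × ℝ) × Event => gravPert h q.1.2 q.2 α β) (P ×ˢ M) := by
  simp only [gravPert, Matrix.sub_apply]
  refine (contDiffOn_inv_apply (fun a b => ?_) (fun q hq => h_det q.1 hq.1 q.2 hq.2) α β).sub
    contDiffOn_const
  simp only [Matrix.add_apply]
  exact contDiffOn_const.add (h_smooth a b)

theorem gravPert_isSymm {h : ℝ → Event → Tensor} {G : ℝ} {y : Event} (hs : (h G y).IsSymm) :
    (gravPert h G y).IsSymm :=
  ((Matrix.isSymm_diagonal _).add hs).inv.sub (Matrix.isSymm_diagonal _)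

theorem refrPert_isSymm (n : ℝ → Event → ℝ) (w : ℝ → Event → Fin 4 → ℝ) (N₀ : ℝ) (y : Event) :
    (refrPert n w N₀ y).IsSymm := by
  ext α β
  simp [refrPert]
  ring

theorem gravPert_zero {h : ℝ → Event → Tensor} {y : Event} (hz : h 0 y = 0) :
    gravPert h 0 y = 0 := by
  rw [gravPert, hz, add_zero, Matrix.inv_eq_right_inv minkowski_mul_self, sub_self]

theorem refrPert_zero {n : ℝ → Event → ℝ} {w : ℝ → Event → Fin 4 → ℝ} {y : Event}
    (hn : n 0 y = 1) : refrPert n w 0 y = 0 := by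
  ext α β
  simp [refrPert, hn]

/-! ### Expansion of a perturbation along the actual path -/

theorem update_event (t t' : ℝ) (z : Space) : Function.update (event t z) 0 t' = event t' z := by
  funext α
  refine Fin.cases ?_ (fun i => ?_) α
  · simp
  · rw [Function.update_of_ne (Fin.succ_ne_zero i), event_succ, event_succ]

section Path

variable {M : Set Event} {U : Set ℝ} {K : ℝ → Event → ℝ} {term : ℕ → Event → ℝ} {k : ℝ}
  {t₀ : ℝ} {z : Space} {ξ : ℝ → ℝ} {Z c : ℝ⟦X⟧} {σ l : ℕ}

/-- The coefficients of a perturbation along the path `t₀ + ξ ε`, in terms of the time derivatives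
of its terms at `t₀`. -/
theorem coeff_path (hM : IsOpen M) (hU : IsOpen U) (h0 : (0 : ℝ) ∈ U)
    (hK : ContDiffOn ℝ ∞ (fun q : ℝ × Event => K q.1 q.2) (U ×ˢ M))
    (hterm : ∀ y ∈ M, ∀ m, term m y = k ^ m * coeff m (jet fun u => K u y))
    (hy : event t₀ z ∈ M) (hξ : HasJet (𝓝 0) id ξ fun _ => Z) (hZ : coeff 0 Z = 0) (hσ : 1 ≤ σ)
    (hc : HasJet (𝓝 0) id (fun ε => K (ε ^ σ * k) (event (t₀ + ξ ε) z)) fun _ => c) (l : ℕ) :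
    coeff l c = ∑ m ∈ Finset.range (l + 1), ∑ n ∈ Finset.range (l + 1),
      timeDeriv n (term m) (event t₀ z) / (n.factorial : ℝ) * coeff l (X ^ (σ * m) * Z ^ n) := by
  have hev : Continuous fun t => event t z := by
    have := (contDiffOn_event (S := Set.univ) (t := fun t : ℝ => t) (z := fun _ => z)
      contDiffOn_id contDiffOn_const).continuousOn
    exact continuousOn_univ.1 this
  have hV : IsOpen {t | event t z ∈ M} := hM.preimage hev
  have hF : ContDiffOn ℝ ∞ (fun q : ℝ × ℝ => K q.1 (event q.2 z)) (U ×ˢ {t | event t z ∈ M}) :=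
    hK.comp (f := fun q : ℝ × ℝ => (q.1, event q.2 z))
      (contDiffOn_fst.prodMk (contDiffOn_event contDiffOn_snd contDiffOn_const))
      fun q hq => ⟨hq.1, hq.2⟩
  rw [coeff_comp hU h0 hV hy hF hξ hZ k hσ hc l]
  refine Finset.sum_congr rfl fun m _ => Finset.sum_congr rfl fun n _ => ?_
  congr 2
  rw [mixedCoeff, timeDeriv, event_zero]
  simp only [update_event]
  have h1 : (fun t => term m (event t z)) =ᶠ[𝓝 t₀]
      fun t => k ^ m * coeff m (jet fun u => K u (event t z)) := by
    filter_upwards [hV.mem_nhds hy] with t ht using hterm _ ht m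
  rw [h1.iteratedDeriv_eq, iteratedDeriv_const_mul_field]

theorem timeDeriv_term_zero (hM : IsOpen M) (hK0 : ∀ y ∈ M, K 0 y = 0)
    (hterm : ∀ y ∈ M, ∀ m, term m y = k ^ m * coeff m (jet fun u => K u y))
    (hy : event t₀ z ∈ M) (n : ℕ) : timeDeriv n (term 0) (event t₀ z) = 0 := by
  have hev : Continuous fun t => event t z := by
    have := (contDiffOn_event (S := Set.univ) (t := fun t : ℝ => t) (z := fun _ => z)
      contDiffOn_id contDiffOn_const).continuousOn
    exact continuousOn_univ.1 this
  have hV : IsOpen {t | event t z ∈ M} := hM.preimage hev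
  rw [timeDeriv, event_zero]
  simp only [update_event]
  have h1 : (fun t => term 0 (event t z)) =ᶠ[𝓝 t₀] fun _ => 0 := by
    filter_upwards [hV.mem_nhds hy] with t ht
    rw [hterm _ ht 0]
    simp [hK0 _ ht]
  rw [h1.iteratedDeriv_eq]
  simp

/-- The term of order zero vanishes, and the term of order `m ≥ 1` carries `ε ^ (σ * m)`. Displacing
the path cannot lower these orders. -/
theorem coeff_path_eq_zero (hM : IsOpen M) (hU : IsOpen U) (h0 : (0 : ℝ) ∈ U)
    (hK : ContDiffOn ℝ ∞ (fun q : ℝ × Event => K q.1 q.2) (U ×ˢ M)) (hK0 : ∀ y ∈ M, K 0 y = 0)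
    (hterm : ∀ y ∈ M, ∀ m, term m y = k ^ m * coeff m (jet fun u => K u y))
    (hy : event t₀ z ∈ M) (hξ : HasJet (𝓝 0) id ξ fun _ => Z) (hZ : coeff 0 Z = 0) (hσ : 1 ≤ σ)
    (hc : HasJet (𝓝 0) id (fun ε => K (ε ^ σ * k) (event (t₀ + ξ ε) z)) fun _ => c)
    (hl : l < σ) : coeff l c = 0 := by
  rw [coeff_path hM hU h0 hK hterm hy hξ hZ hσ hc l]
  refine Finset.sum_eq_zero fun m _ => Finset.sum_eq_zero fun n _ => ?_
  rcases Nat.eq_zero_or_pos m with rfl | hm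
  · rw [timeDeriv_term_zero hM hK0 hterm hy, zero_div, zero_mul]
  · rw [coeff_X_pow_mul', if_neg, mul_zero]
    have : σ ≤ σ * m := Nat.le_mul_of_pos_right σ hm
    omega

/-- The common source of the two hatted quantities: `σ = 1` gives the refractive one and `σ = s` the
gravitational one. -/
theorem coeff_path_eq_hat (hM : IsOpen M) (hU : IsOpen U) (h0 : (0 : ℝ) ∈ U)
    (hK : ContDiffOn ℝ ∞ (fun q : ℝ × Event => K q.1 q.2) (U ×ˢ M)) (hK0 : ∀ y ∈ M, K 0 y = 0)
    (hterm : ∀ y ∈ M, ∀ m, term m y = k ^ m * coeff m (jet fun u => K u y))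
    (hy : event t₀ z ∈ M) (hξ : HasJet (𝓝 0) id ξ fun _ => Z) (hZ : coeff 0 Z = 0) (hσ : 1 ≤ σ)
    (hc : HasJet (𝓝 0) id (fun ε => K (ε ^ σ * k) (event (t₀ + ξ ε) z)) fun _ => c)
    {φ : ℕ → ℕ → ℝ}
    (hφ : ∀ j n, 1 ≤ n → n ≤ j → φ j n = coeff j (Z ^ n) / (n.factorial : ℝ)) (hl : σ ≤ l) :
    coeff l c = (if l % σ = 0 then term (l / σ) (event t₀ z)
        else ∑ n ∈ Finset.Icc 1 (l % σ), φ (l % σ) n * timeDeriv n (term (l / σ)) (event t₀ z))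
      + ∑ m ∈ Finset.Icc 1 (l / σ - 1), ∑ n ∈ Finset.Icc 1 (m * σ + l % σ),
          φ (m * σ + l % σ) n * timeDeriv n (term (l / σ - m)) (event t₀ z) := by
  rw [coeff_path hM hU h0 hK hterm hy hξ hZ hσ hc l,
    sum_coeff_X_pow_mul_pow (T := fun m n => timeDeriv n (term m) (event t₀ z)) hZ hσ
      (timeDeriv_term_zero hM hK0 hterm hy) hφ hl]
  simp [timeDeriv, update_event]

end Path

/-! ### Coefficients of the integrodifferential equation -/

namespace UnifJet

variable {K : ℝ → ℝ → Tensor} {Kc : ℕ → ℝ → Tensor} {u v : ℝ → ℝ → Fin 3 → ℝ}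
  {uc vc : ℕ → ℝ → Fin 3 → ℝ}

theorem source (hK : ∀ α β, UnifJet (fun ε μ => K ε μ α β)
      (fun μ => PowerSeries.mk fun j => Kc j μ α β)) (N : Space) :
    UnifJet (fun ε μ => source (K ε μ) N) (fun μ => PowerSeries.mk fun j => source (Kc j μ) N) := by
  have h1 := ((hK 0 0).sub ((const 2).mul (sum Finset.univ fun i _ =>
    (hK 0 i.succ).mul (const (N i))))).add (sum Finset.univ fun i _ => sum Finset.univ fun j _ =>
    ((hK (i : Fin 3).succ (j : Fin 3).succ).mul (const (N i))).mul (const (N j)))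
  refine h1.congr (Eventually.of_forall fun ε μ _ => rfl) fun μ _ => ?_
  ext j
  simp only [coeff_mk, OpticalDelay.source, map_add, map_sub, coeff_C_mul, map_sum, coeff_mul_C]

theorem lin (hK : ∀ α β, UnifJet (fun ε μ => K ε μ α β)
      (fun μ => PowerSeries.mk fun j => Kc j μ α β)) (N : Space)
    (hu : ∀ i, UnifJet (fun ε μ => u ε μ i) (fun μ => PowerSeries.mk fun j => uc j μ i)) :
    UnifJet (fun ε μ => lin (K ε μ) N (u ε μ)) (fun μ => PowerSeries.mk fun j =>
      ∑ q ∈ Finset.HasAntidiagonal.antidiagonal j, lin (Kc q.1 μ) N (uc q.2 μ)) := by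
  have h1 := sum Finset.univ fun i _ => ((hK 0 (i : Fin 3).succ).sub (sum Finset.univ fun j _ =>
    (hK i.succ (j : Fin 3).succ).mul (const (N j)))).mul (hu i)
  refine h1.congr (Eventually.of_forall fun ε μ _ => rfl) fun μ _ => ?_
  ext j
  simp only [coeff_mk, OpticalDelay.lin, map_sum]
  rw [Finset.sum_comm]
  refine Finset.sum_congr rfl fun i _ => ?_
  rw [coeff_mul]
  simp only [coeff_mk, map_sub, map_sum, coeff_mul_C]

theorem quad (hK : ∀ α β, UnifJet (fun ε μ => K ε μ α β)
      (fun μ => PowerSeries.mk fun j => Kc j μ α β))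
    (hu : ∀ i, UnifJet (fun ε μ => u ε μ i) (fun μ => PowerSeries.mk fun j => uc j μ i))
    (hv : ∀ i, UnifJet (fun ε μ => v ε μ i) (fun μ => PowerSeries.mk fun j => vc j μ i)) :
    UnifJet (fun ε μ => quad (K ε μ) (u ε μ) (v ε μ)) (fun μ => PowerSeries.mk fun j =>
      ∑ q ∈ Finset.HasAntidiagonal.antidiagonal j,
        ∑ q' ∈ Finset.HasAntidiagonal.antidiagonal q.2,
          quad (Kc q.1 μ) (uc q'.1 μ) (vc q'.2 μ)) := by
  have h1 := sum Finset.univ fun i _ => sum Finset.univ fun j _ =>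
    ((hK (i : Fin 3).succ (j : Fin 3).succ).mul (hu i)).mul (hv j)
  refine h1.congr (Eventually.of_forall fun ε μ _ => rfl) fun μ _ => ?_
  ext j
  simp only [coeff_mk, OpticalDelay.quad, map_sum]
  have h2 : ∀ (a b : Fin 3), coeff j (((PowerSeries.mk fun j => Kc j μ a.succ b.succ)
      * (PowerSeries.mk fun j => uc j μ a)) * (PowerSeries.mk fun j => vc j μ b))
      = ∑ q ∈ Finset.HasAntidiagonal.antidiagonal j,
        ∑ q' ∈ Finset.HasAntidiagonal.antidiagonal q.2,
          Kc q.1 μ a.succ b.succ * uc q'.1 μ a * vc q'.2 μ b := by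
    intro a b
    rw [mul_assoc, coeff_mul]
    simp only [coeff_mul, coeff_mk, Finset.mul_sum, mul_assoc]
  simp only [h2]
  rw [Finset.sum_congr rfl fun q _ => Finset.sum_comm]
  rw [Finset.sum_comm]
  refine Finset.sum_congr rfl fun a _ => ?_
  rw [Finset.sum_congr rfl fun q _ => Finset.sum_comm]
  rw [Finset.sum_comm]

theorem quad_const (L : Tensor)
    (hu : ∀ i, UnifJet (fun ε μ => u ε μ i) (fun μ => PowerSeries.mk fun j => uc j μ i))
    (hv : ∀ i, UnifJet (fun ε μ => v ε μ i) (fun μ => PowerSeries.mk fun j => vc j μ i)) :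
    UnifJet (fun ε μ => OpticalDelay.quad L (u ε μ) (v ε μ)) (fun μ => PowerSeries.mk fun j =>
      ∑ q ∈ Finset.HasAntidiagonal.antidiagonal j,
        OpticalDelay.quad L (uc q.1 μ) (vc q.2 μ)) := by
  have h1 := sum Finset.univ fun i _ => sum Finset.univ fun j _ =>
    ((const (L (i : Fin 3).succ (j : Fin 3).succ)).mul (hu i)).mul (hv j)
  refine h1.congr (Eventually.of_forall fun ε μ _ => rfl) fun μ _ => ?_
  ext j
  simp only [coeff_mk, OpticalDelay.quad, map_sum]
  have h2 : ∀ (a b : Fin 3), coeff j ((C (L a.succ b.succ)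
      * (PowerSeries.mk fun j => uc j μ a)) * (PowerSeries.mk fun j => vc j μ b))
      = ∑ q ∈ Finset.HasAntidiagonal.antidiagonal j, L a.succ b.succ * uc q.1 μ a * vc q.2 μ b := by
    intro a b
    rw [mul_assoc, coeff_C_mul, coeff_mul]
    simp only [coeff_mk, Finset.mul_sum, mul_assoc]
  simp only [h2]
  rw [Finset.sum_comm]
  refine Finset.sum_congr rfl fun a _ => ?_
  rw [Finset.sum_comm]

end UnifJet

theorem quad_add_left (K L : Tensor) (u v : Fin 3 → ℝ) :
    quad (K + L) u v = quad K u v + quad L u v := by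
  simp only [quad, Matrix.add_apply, add_mul, Finset.sum_add_distrib]

/-- The coefficient of order `j` of the integrand of the integrodifferential equation. -/
noncomputable def integrandCoeff (K : ℕ → Tensor) (N : Space) (u : ℕ → Fin 3 → ℝ) (j : ℕ) : ℝ :=
  source (K j) N
    - 2 * ∑ q ∈ Finset.HasAntidiagonal.antidiagonal j, lin (K q.1) N (u q.2)
    + (∑ q ∈ Finset.HasAntidiagonal.antidiagonal j, quad minkowski (u q.1) (u q.2)
      + ∑ q ∈ Finset.HasAntidiagonal.antidiagonal j,
        ∑ q' ∈ Finset.HasAntidiagonal.antidiagonal q.2, quad (K q.1) (u q'.1) (u q'.2))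

theorem unifJet_integrand {K : ℝ → ℝ → Tensor} {Kc : ℕ → ℝ → Tensor} {u : ℝ → ℝ → Fin 3 → ℝ}
    {uc : ℕ → ℝ → Fin 3 → ℝ} (hK : ∀ α β, UnifJet (fun ε μ => K ε μ α β)
      (fun μ => PowerSeries.mk fun j => Kc j μ α β)) (N : Space)
    (hu : ∀ i, UnifJet (fun ε μ => u ε μ i) (fun μ => PowerSeries.mk fun j => uc j μ i)) :
    UnifJet (fun ε μ => source (K ε μ) N - 2 * lin (K ε μ) N (u ε μ)
        + quad (minkowski + K ε μ) (u ε μ) (u ε μ))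
      (fun μ => PowerSeries.mk fun j => integrandCoeff (fun m => Kc m μ) N (fun m => uc m μ) j) := by
  have h1 := ((UnifJet.source hK N).sub ((UnifJet.const 2).mul (UnifJet.lin hK N hu))).add
    ((UnifJet.quad_const minkowski hu hu).add (UnifJet.quad hK hu hu))
  refine h1.congr (Eventually.of_forall fun ε μ _ => ?_) fun μ _ => ?_
  · simp only [quad_add_left]
  · ext j
    simp only [coeff_mk, integrandCoeff, map_add, map_sub, coeff_C_mul]

/-- The equation holds exactly for every `ε ∈ U`. Its right side is expanded by integrating the
uniform expansion of the integrand, its left side is smooth in `ε`, and the coefficients agree by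
uniqueness. -/
theorem delayCoeff_eq_integral {U : Set ℝ} (hU : IsOpen U) (h0 : (0 : ℝ) ∈ U) {xA : Space}
    {D : Set Space} {f : ℝ → Space → ℝ}
    (hf : IsSmoothFamily U xA D f) {x : Space} (hx : x ∈ D) {K : ℝ → ℝ → Tensor}
    {Kc : ℕ → ℝ → Tensor} {uc : ℕ → ℝ → Fin 3 → ℝ} (hK : ∀ α β, UnifJet (fun ε μ => K ε μ α β)
      (fun μ => PowerSeries.mk fun j => Kc j μ α β))
    (hu : ∀ i, UnifJet (fun ε μ => grad (f ε) (seg xA x μ) i)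
      (fun μ => PowerSeries.mk fun j => uc j μ i))
    (heq : ∀ ε ∈ U, f ε x = ‖x - xA‖ / 2 * ∫ μ in (0 : ℝ)..1,
      (source (K ε μ) (dir xA x) - 2 * lin (K ε μ) (dir xA x) (grad (f ε) (seg xA x μ))
        + quad (minkowski + K ε μ) (grad (f ε) (seg xA x μ)) (grad (f ε) (seg xA x μ)))) (j : ℕ) :
    delayCoeff f j x = ‖x - xA‖ / 2 * ∫ μ in (0 : ℝ)..1,
      integrandCoeff (fun m => Kc m μ) (dir xA x) (fun m => uc m μ) j := by
  have hid : (id : ℝ → ℝ) =O[𝓝 0] fun _ => (1 : ℝ) := (tendsto_id (x := 𝓝 (0 : ℝ))).isBigO_one ℝ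
  have h1 := (unifJet_integrand hK (dir xA x)
    (u := fun ε μ => grad (f ε) (seg xA x μ)) hu).integral
  have h2 := HasJet.const_mul (r := fun _ => ‖x - xA‖ / 2) hid
    (isBigO_const_const _ one_ne_zero _) h1
  have h3 := (h2.congr (d := fun _ => C (‖x - xA‖ / 2) * PowerSeries.mk fun j => ∫ μ in (0 : ℝ)..1,
      coeff j (PowerSeries.mk fun j => integrandCoeff (fun m => Kc m μ) (dir xA x)
        (fun m => uc m μ) j)) (g := fun ε => f ε x)
    (by filter_upwards [hU.mem_nhds h0] with ε hε using (heq ε hε).symm)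
    EventuallyEq.rfl).unique (hf.hasJet hU h0 hx)
  have h4 := congrArg (coeff j) h3
  simp only [coeff_C_mul, coeff_mk] at h4
  exact h4.symm

/-! ### Convolutions of sequences of coefficients -/

/-- The coefficient of order `n` of `lin K N u`. -/
noncomputable def linConv (N : Space) (K : ℕ → Tensor) (u : ℕ → Fin 3 → ℝ) (n : ℕ) : ℝ :=
  ∑ q ∈ Finset.HasAntidiagonal.antidiagonal n, lin (K q.1) N (u q.2)

/-- The coefficient of order `n` of `quad minkowski u v`. -/
noncomputable def quadConv (u v : ℕ → Fin 3 → ℝ) (n : ℕ) : ℝ :=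
  ∑ q ∈ Finset.HasAntidiagonal.antidiagonal n, quad minkowski (u q.1) (v q.2)

/-- The coefficient of order `n` of `quad K u v`. -/
noncomputable def triConv (K : ℕ → Tensor) (u v : ℕ → Fin 3 → ℝ) (n : ℕ) : ℝ :=
  ∑ q ∈ Finset.HasAntidiagonal.antidiagonal n,
    ∑ q' ∈ Finset.HasAntidiagonal.antidiagonal q.2, quad (K q.1) (u q'.1) (v q'.2)

theorem integrandCoeff_eq (K : ℕ → Tensor) (N : Space) (u : ℕ → Fin 3 → ℝ) (n : ℕ) :
    integrandCoeff K N u n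
      = source (K n) N - 2 * linConv N K u n + (quadConv u u n + triConv K u u n) := rfl

/-! ### Linearity and symmetry of the convolutions -/

section Algebra

variable (N : Space) (K L : ℕ → Tensor) (u v w : ℕ → Fin 3 → ℝ) (n : ℕ)

theorem source_add (A B : Tensor) : source (A + B) N = source A N + source B N := by
  simp only [source, Matrix.add_apply, Fin.sum_univ_three]
  ring

@[simp] theorem source_zero : source 0 N = 0 := by simp [source]

theorem lin_add_left (A B : Tensor) (x : Fin 3 → ℝ) : lin (A + B) N x = lin A N x + lin B N x := by
  simp only [lin, Matrix.add_apply, Fin.sum_univ_three]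
  ring

theorem lin_add_right (A : Tensor) (x y : Fin 3 → ℝ) :
    lin A N (x + y) = lin A N x + lin A N y := by
  simp only [lin, Pi.add_apply, mul_add, Finset.sum_add_distrib]

@[simp] theorem lin_zero_left (x : Fin 3 → ℝ) : lin 0 N x = 0 := by simp [lin]

@[simp] theorem lin_zero_right (A : Tensor) : lin A N 0 = 0 := by simp [lin]

theorem quad_add_mid (A : Tensor) (x y z : Fin 3 → ℝ) :
    quad A (x + y) z = quad A x z + quad A y z := by
  simp only [quad, Pi.add_apply, mul_add, add_mul, Finset.sum_add_distrib]

theorem quad_add_right (A : Tensor) (x y z : Fin 3 → ℝ) :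
    quad A x (y + z) = quad A x y + quad A x z := by
  simp only [quad, Pi.add_apply, mul_add, Finset.sum_add_distrib]

@[simp] theorem quad_zero_left (x y : Fin 3 → ℝ) : quad 0 x y = 0 := by simp [quad]

@[simp] theorem quad_zero_mid (A : Tensor) (x : Fin 3 → ℝ) : quad A 0 x = 0 := by simp [quad]

@[simp] theorem quad_zero_right (A : Tensor) (x : Fin 3 → ℝ) : quad A x 0 = 0 := by simp [quad]

theorem quad_comm {A : Tensor} (hA : A.IsSymm) (x y : Fin 3 → ℝ) : quad A x y = quad A y x := by
  simp only [quad]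
  rw [Finset.sum_comm]
  refine Finset.sum_congr rfl fun i _ => Finset.sum_congr rfl fun j _ => ?_
  rw [hA.apply i.succ j.succ]
  ring

theorem linConv_add_left : linConv N (K + L) u n = linConv N K u n + linConv N L u n := by
  simp only [linConv, Pi.add_apply, lin_add_left, Finset.sum_add_distrib]

theorem linConv_add_right : linConv N K (u + v) n = linConv N K u n + linConv N K v n := by
  simp only [linConv, Pi.add_apply, lin_add_right, Finset.sum_add_distrib]

theorem quadConv_add_left : quadConv (u + v) w n = quadConv u w n + quadConv v w n := by
  simp only [quadConv, Pi.add_apply, quad_add_mid, Finset.sum_add_distrib]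

theorem quadConv_add_right : quadConv u (v + w) n = quadConv u v n + quadConv u w n := by
  simp only [quadConv, Pi.add_apply, quad_add_right, Finset.sum_add_distrib]

theorem quadConv_comm : quadConv u v n = quadConv v u n := by
  rw [quadConv, ← Finset.Nat.sum_antidiagonal_swap]
  exact Finset.sum_congr rfl fun q _ => quad_comm (Matrix.isSymm_diagonal _) _ _

theorem triConv_add_left : triConv (K + L) u v n = triConv K u v n + triConv L u v n := by
  simp only [triConv, Pi.add_apply, quad_add_left, Finset.sum_add_distrib]

theorem triConv_add_mid : triConv K (u + v) w n = triConv K u w n + triConv K v w n := by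
  simp only [triConv, Pi.add_apply, quad_add_mid, Finset.sum_add_distrib]

theorem triConv_add_right : triConv K u (v + w) n = triConv K u v n + triConv K u w n := by
  simp only [triConv, Pi.add_apply, quad_add_right, Finset.sum_add_distrib]

theorem triConv_comm {K : ℕ → Tensor} (hK : ∀ m, (K m).IsSymm) :
    triConv K u v n = triConv K v u n := by
  rw [triConv, triConv]
  refine Finset.sum_congr rfl fun q _ => ?_
  rw [← Finset.Nat.sum_antidiagonal_swap]
  exact Finset.sum_congr rfl fun q' _ => quad_comm (hK _) _ _

/-- The part of the integrand of the total delay which couples the two perturbations. -/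
theorem integrandCoeff_coupling {K L : ℕ → Tensor} (hK : ∀ m, (K m).IsSymm)
    (hL : ∀ m, (L m).IsSymm) :
    integrandCoeff (K + L) N (u + v + w) n - integrandCoeff L N v n - integrandCoeff K N u n
      = (2 * quadConv u v n - 2 * linConv N K v n - 2 * linConv N L u n)
        + (2 * quadConv u w n - 2 * linConv N K w n + 2 * triConv K u v n + triConv L u u n)
        + 2 * triConv K u w n
        + (2 * quadConv v w n - 2 * linConv N L w n + 2 * triConv L u v n + triConv K v v n)
        + (quadConv w w n + 2 * triConv L u w n + 2 * triConv K v w n)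
        + triConv K w w n
        + 2 * triConv L v w n
        + triConv L w w n := by
  simp only [integrandCoeff_eq, Pi.add_apply, source_add, linConv_add_left, linConv_add_right,
    quadConv_add_left, quadConv_add_right, triConv_add_left, triConv_add_mid, triConv_add_right]
  rw [quadConv_comm v u, quadConv_comm w u, quadConv_comm w v, triConv_comm v u n hK,
    triConv_comm w u n hK, triConv_comm w v n hK, triConv_comm v u n hL, triConv_comm w u n hL,
    triConv_comm w v n hL]
  ring

end Algebra

/-! ### Starting orders and convolutions as sums over index intervals -/

section Reindex

variable {N : Space} {K K' : ℕ → Tensor} {u v u' v' : ℕ → Fin 3 → ℝ} {α β δ n : ℕ}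

/-- If the orders add up to less than the sum of the starting orders, some factor lies below its
own. The two analogues for `quadConv` and `triConv` rest on the same count. -/
theorem linConv_eq_zero (hK : ∀ i < α, K i = 0) (hu : ∀ i < β, u i = 0) (hn : n < α + β) :
    linConv N K u n = 0 := by
  refine Finset.sum_eq_zero fun q hq => ?_
  rw [Finset.HasAntidiagonal.mem_antidiagonal] at hq
  by_cases h : q.1 < α
  · rw [hK _ h, lin_zero_left]
  · rw [hu _ (by omega), lin_zero_right]

theorem quadConv_eq_zero (hu : ∀ i < β, u i = 0) (hv : ∀ i < δ, v i = 0) (hn : n < β + δ) :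
    quadConv u v n = 0 := by
  refine Finset.sum_eq_zero fun q hq => ?_
  rw [Finset.HasAntidiagonal.mem_antidiagonal] at hq
  by_cases h : q.1 < β
  · rw [hu _ h, quad_zero_mid]
  · rw [hv _ (by omega), quad_zero_right]

theorem triConv_eq_zero (hK : ∀ i < α, K i = 0) (hu : ∀ i < β, u i = 0) (hv : ∀ i < δ, v i = 0)
    (hn : n < α + β + δ) : triConv K u v n = 0 := by
  refine Finset.sum_eq_zero fun q hq => Finset.sum_eq_zero fun q' hq' => ?_
  rw [Finset.HasAntidiagonal.mem_antidiagonal] at hq hq'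
  by_cases h : q.1 < α
  · rw [hK _ h, quad_zero_left]
  · by_cases h' : q'.1 < β
    · rw [hu _ h', quad_zero_mid]
    · rw [hv _ (by omega), quad_zero_right]

/-- The discarded indices are those at which `f` vanishes. Truncation in the subtraction is
harmless: any surplus index in the interval still belongs to the antidiagonal. -/
theorem sum_antidiagonal_eq_sum_Icc {f : ℕ → ℕ → ℝ} {A : ℕ}
    (hf : ∀ i j, i < α ∨ j ≤ β → f i j = 0) (hA : A = n - 1 - β) :
    ∑ q ∈ Finset.HasAntidiagonal.antidiagonal n, f q.1 q.2
      = ∑ m ∈ Finset.Icc α A, f m (n - m) := by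
  rw [Finset.Nat.sum_antidiagonal_eq_sum_range_succ_mk]
  have hsub : Finset.Icc α A ⊆ Finset.range (n + 1) := by
    intro m hm
    rw [Finset.mem_Icc] at hm
    rw [Finset.mem_range]
    omega
  refine (Finset.sum_subset hsub fun m hm hm' => hf _ _ ?_).symm
  rw [Finset.mem_range] at hm
  rw [Finset.mem_Icc] at hm'
  omega

/-- The sequence `u` starts at order `β + 1`, and `u'` is its renumbering from `1`. The index `B` is
characterised by an additive equation on the range of summation, so that the differently written
subtractions of the formulas can all be matched. -/
theorem linConv_eq (hK : ∀ i < α, K i = 0) (hu : ∀ i ≤ β, u i = 0)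
    (hK' : ∀ m, α ≤ m → K' m = K m) (hu' : ∀ j, u' j = u (j + β)) {A : ℕ} {B : ℕ → ℕ}
    (hA : A = n - 1 - β) (hB : ∀ m, α ≤ m → m ≤ A → B m + m + β = n) :
    linConv N K u n = ∑ m ∈ Finset.Icc α A, lin (K' m) N (u' (B m)) := by
  rw [linConv, sum_antidiagonal_eq_sum_Icc (f := fun i j => lin (K i) N (u j)) _ hA]
  · refine Finset.sum_congr rfl fun m hm => ?_
    rw [Finset.mem_Icc] at hm
    have := hB m hm.1 hm.2
    rw [hK' m hm.1, hu', show n - m = B m + β by omega]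
  · rintro i j (h | h)
    · rw [hK _ h, lin_zero_left]
    · rw [hu _ h, lin_zero_right]

theorem sum_quad_eq (L : Tensor) (hu : ∀ i ≤ β, u i = 0) (hv : ∀ i ≤ δ, v i = 0)
    (hu' : ∀ j, u' j = u (j + β)) (hv' : ∀ j, v' j = v (j + δ)) {A : ℕ} {B : ℕ → ℕ}
    (hA : A = n - 1 - β - δ) (hB : ∀ m, 1 ≤ m → m ≤ A → B m + m + β + δ = n) :
    ∑ q ∈ Finset.HasAntidiagonal.antidiagonal n, quad L (u q.1) (v q.2)
      = ∑ m ∈ Finset.Icc 1 A, quad L (u' m) (v' (B m)) := by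
  rw [sum_antidiagonal_eq_sum_Icc (f := fun i j => quad L (u i) (v j))
    (α := β + 1) _ rfl (β := δ)]
  · refine Finset.sum_bij' (fun m _ => m - β) (fun m _ => m + β) ?_ ?_ ?_ ?_ ?_
    · intro m hm
      rw [Finset.mem_Icc] at *
      omega
    · intro m hm
      rw [Finset.mem_Icc] at *
      omega
    · intro m hm
      rw [Finset.mem_Icc] at hm
      omega
    · intro m hm
      omega
    · intro m hm
      rw [Finset.mem_Icc] at hm
      have := hB (m - β) (by omega) (by omega)
      rw [hu', hv', show m - β + β = m by omega, show B (m - β) + δ = n - m by omega]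
  · rintro i j (h | h)
    · rw [hu _ (by omega), quad_zero_mid]
    · rw [hv _ h, quad_zero_right]

theorem quadConv_eq (hu : ∀ i ≤ β, u i = 0) (hv : ∀ i ≤ δ, v i = 0)
    (hu' : ∀ j, u' j = u (j + β)) (hv' : ∀ j, v' j = v (j + δ)) {A : ℕ} {B : ℕ → ℕ}
    (hA : A = n - 1 - β - δ) (hB : ∀ m, 1 ≤ m → m ≤ A → B m + m + β + δ = n) :
    quadConv u v n = ∑ m ∈ Finset.Icc 1 A, quad minkowski (u' m) (v' (B m)) :=
  sum_quad_eq minkowski hu hv hu' hv' hA hB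

theorem triConv_eq (hK : ∀ i < α, K i = 0) (hu : ∀ i ≤ β, u i = 0) (hv : ∀ i ≤ δ, v i = 0)
    (hK' : ∀ m, α ≤ m → K' m = K m) (hu' : ∀ j, u' j = u (j + β))
    (hv' : ∀ j, v' j = v (j + δ)) {A : ℕ} {A' : ℕ → ℕ} {B : ℕ → ℕ → ℕ}
    (hA : A = n - 2 - β - δ) (hA' : ∀ m, α ≤ m → m ≤ A → A' m = n - m - 1 - β - δ)
    (hB : ∀ m i, α ≤ m → m ≤ A → 1 ≤ i → i ≤ A' m → B m i + i + m + β + δ = n) :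
    triConv K u v n = ∑ m ∈ Finset.Icc α A, ∑ i ∈ Finset.Icc 1 (A' m),
      quad (K' m) (u' i) (v' (B m i)) := by
  rw [triConv, sum_antidiagonal_eq_sum_Icc (A := A) (β := β + δ + 1)
    (f := fun i j => ∑ q' ∈ Finset.HasAntidiagonal.antidiagonal j,
      quad (K i) (u q'.1) (v q'.2)) _ (by omega)]
  · refine Finset.sum_congr rfl fun m hm => ?_
    rw [Finset.mem_Icc] at hm
    rw [hK' m hm.1]
    have h1 := hA' m hm.1 hm.2
    exact sum_quad_eq (K m) hu hv hu' hv' (by omega) fun i hi hi' => by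
      have := hB m i hm.1 hm.2 hi hi'
      omega
  · rintro i j (h | h)
    · exact Finset.sum_eq_zero fun q' _ => by rw [hK _ h, quad_zero_left]
    · refine Finset.sum_eq_zero fun q' hq' => ?_
      rw [Finset.HasAntidiagonal.mem_antidiagonal] at hq'
      by_cases h' : q'.1 ≤ β
      · rw [hu _ h', quad_zero_mid]
      · rw [hv _ (by omega), quad_zero_right]

end Reindex

/-! ### The recursive formulas as convolutions -/

section Bounded

variable {N : Space} {K : ℕ → ℝ → Tensor} {u v : ℕ → ℝ → Fin 3 → ℝ}

theorem BoundedCont.lin {A : ℝ → Tensor} {x : ℝ → Fin 3 → ℝ}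
    (hA : ∀ α β, BoundedCont fun μ => A μ α β) (hx : ∀ i, BoundedCont fun μ => x μ i) :
    BoundedCont fun μ => lin (A μ) N (x μ) :=
  BoundedCont.sum _ fun i _ => ((hA _ _).sub (BoundedCont.sum _ fun j _ =>
    (hA i.succ j.succ).mul (.const (N j)))).mul (hx i)

theorem BoundedCont.quad {A : ℝ → Tensor} {x y : ℝ → Fin 3 → ℝ}
    (hA : ∀ α β, BoundedCont fun μ => A μ α β) (hx : ∀ i, BoundedCont fun μ => x μ i)
    (hy : ∀ i, BoundedCont fun μ => y μ i) :
    BoundedCont fun μ => quad (A μ) (x μ) (y μ) :=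
  BoundedCont.sum _ fun i _ => BoundedCont.sum _ fun j _ =>
    ((hA i.succ j.succ).mul (hx i)).mul (hy j)

theorem boundedCont_linConv (hK : ∀ m α β, BoundedCont fun μ => K m μ α β)
    (hu : ∀ m i, BoundedCont fun μ => u m μ i) (n : ℕ) :
    BoundedCont fun μ => linConv N (fun m => K m μ) (fun m => u m μ) n :=
  BoundedCont.sum _ fun q _ => BoundedCont.lin (hK q.1) (hu q.2)

theorem boundedCont_quadConv (hu : ∀ m i, BoundedCont fun μ => u m μ i)
    (hv : ∀ m i, BoundedCont fun μ => v m μ i) (n : ℕ) :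
    BoundedCont fun μ => quadConv (fun m => u m μ) (fun m => v m μ) n :=
  BoundedCont.sum _ fun q _ => BoundedCont.quad (fun _ _ => .const _) (hu q.1) (hv q.2)

theorem boundedCont_triConv (hK : ∀ m α β, BoundedCont fun μ => K m μ α β)
    (hu : ∀ m i, BoundedCont fun μ => u m μ i) (hv : ∀ m i, BoundedCont fun μ => v m μ i)
    (n : ℕ) : BoundedCont fun μ => triConv (fun m => K m μ) (fun m => u m μ) (fun m => v m μ) n :=
  BoundedCont.sum _ fun q _ => BoundedCont.sum _ fun q' _ =>
    BoundedCont.quad (hK q.1) (hu q'.1) (hv q'.2)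

end Bounded

/-- Brings contributions with prefactor `R_AB` to the common prefactor `R_AB / 2`. -/
theorem mul_integral_eq {r : ℝ} {f g : ℝ → ℝ} (h : ∀ μ ∈ Set.Ioc (0 : ℝ) 1, 2 * f μ = g μ) :
    r * ∫ μ in (0 : ℝ)..1, f μ = r / 2 * ∫ μ in (0 : ℝ)..1, g μ := by
  rw [← integral_congr_Ioc h, intervalIntegral.integral_const_mul]
  ring

namespace RecData

/-- The sequences which enter the recursive formulas are the coefficients, along the segment from
the emission position to `x`, of the perturbations `κ`, `k` and of the gradients `r`, `a`, `b` of
the refractive, gravitational and coupling delays. -/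
structure Realizes (S : RecData) (x : Space) (κ k : ℕ → ℝ → Tensor) (r a b : ℕ → ℝ → Fin 3 → ℝ) :
    Prop where
  one_le : 1 ≤ S.s
  kappaHat : ∀ μ ∈ Set.Ioc (0 : ℝ) 1, ∀ m, 1 ≤ m → S.kappaHat m x μ = κ m μ
  kHat : ∀ μ ∈ Set.Ioc (0 : ℝ) 1, ∀ m, S.s ≤ m → S.kHat m x μ = k m μ
  -- The shifts `0`, `s - 1` and `s` place the first refractive, gravitational and coupling terms at
  -- the orders `1`, `s` and `s + 1`. The idle `+ 0` keeps the shape `j + β` of the reindexing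
  -- lemmas.
  dr : ∀ μ ∈ Set.Ioc (0 : ℝ) 1, ∀ j, S.dr j x μ = r (j + 0) μ
  dg : ∀ μ ∈ Set.Ioc (0 : ℝ) 1, ∀ j, S.dg j x μ = a (j + (S.s - 1)) μ
  dgr : ∀ μ ∈ Set.Ioc (0 : ℝ) 1, ∀ j, S.dgr j x μ = b (j + S.s) μ
  κ_zero : ∀ μ ∈ Set.Ioc (0 : ℝ) 1, ∀ i < 1, κ i μ = 0
  k_zero : ∀ μ ∈ Set.Ioc (0 : ℝ) 1, ∀ i < S.s, k i μ = 0
  r_zero : ∀ μ ∈ Set.Ioc (0 : ℝ) 1, ∀ i ≤ 0, r i μ = 0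
  a_zero : ∀ μ ∈ Set.Ioc (0 : ℝ) 1, ∀ i ≤ S.s - 1, a i μ = 0
  b_zero : ∀ μ ∈ Set.Ioc (0 : ℝ) 1, ∀ i ≤ S.s, b i μ = 0
  κ_symm : ∀ μ ∈ Set.Ioc (0 : ℝ) 1, ∀ m, (κ m μ).IsSymm
  k_symm : ∀ μ ∈ Set.Ioc (0 : ℝ) 1, ∀ m, (k m μ).IsSymm
  κ_bdd : ∀ m α β, BoundedCont fun μ => κ m μ α β
  k_bdd : ∀ m α β, BoundedCont fun μ => k m μ α β
  r_bdd : ∀ m i, BoundedCont fun μ => r m μ i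
  a_bdd : ∀ m i, BoundedCont fun μ => a m μ i
  b_bdd : ∀ m i, BoundedCont fun μ => b m μ i

namespace Realizes

variable {S : RecData} {x : Space} {κ k : ℕ → ℝ → Tensor} {r a b : ℕ → ℝ → Fin 3 → ℝ}

theorem refrFormula_eq (h : S.Realizes x κ k r a b) {l : ℕ} (hl : 1 ≤ l) :
    S.refrFormula l x = S.range x / 2 * ∫ μ in (0 : ℝ)..1,
      integrandCoeff (fun m => κ m μ) (S.N x) (fun m => r m μ) l := by
  rw [refrFormula]
  congr 1
  refine integral_congr_Ioc fun μ hμ => ?_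
  rw [integrandCoeff_eq, h.kappaHat μ hμ l hl,
    linConv_eq (h.κ_zero μ hμ) (h.r_zero μ hμ) (h.kappaHat μ hμ) (h.dr μ hμ)
      (A := l - 1) (B := fun m => l - m) (by omega) (by intros; omega),
    quadConv_eq (h.r_zero μ hμ) (h.r_zero μ hμ) (h.dr μ hμ) (h.dr μ hμ)
      (A := l - 1) (B := fun m => l - m) (by omega) (by intros; omega),
    triConv_eq (h.κ_zero μ hμ) (h.r_zero μ hμ) (h.r_zero μ hμ) (h.kappaHat μ hμ) (h.dr μ hμ)
      (h.dr μ hμ) (A := l - 2) (A' := fun m => l - m - 1) (B := fun m i => l - m - i) (by omega)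
      (by intros; omega) (by intros; omega)]
  ring

/-- The term numbered `l` has order `l + (s - 1)`. Both `k` and `a` start at order `s`, so the
linear and Minkowskian products need order `2s`, that is `l ≥ s + 1`, and the triple products order
`3s`, that is `l ≥ 2s + 1`. Below these thresholds the convolutions vanish, as the conditionals
require. -/
theorem gravFormula_eq (h : S.Realizes x κ k r a b) {l : ℕ} (hl : 1 ≤ l) :
    S.gravFormula l x = S.range x / 2 * ∫ μ in (0 : ℝ)..1,
      integrandCoeff (fun m => k m μ) (S.N x) (fun m => a m μ) (l + (S.s - 1)) := by
  have hs := h.one_le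
  rw [gravFormula]
  congr 1
  refine integral_congr_Ioc fun μ hμ => ?_
  have ha' : ∀ i < S.s, a i μ = 0 := fun i hi => h.a_zero μ hμ i (by omega)
  rw [integrandCoeff_eq, h.kHat μ hμ _ (by omega : S.s ≤ S.s + l - 1),
    show S.s + l - 1 = l + (S.s - 1) by omega, add_assoc, sub_add]
  have e1 : (if S.s + 1 ≤ l then
          -2 * ∑ m ∈ Finset.Icc S.s (l - 1), lin (S.kHat m x μ) (S.N x) (S.dg (l - m) x μ)
          + ∑ m ∈ Finset.Icc 1 (l - S.s),
              quad minkowski (S.dg m x μ) (S.dg (l - S.s - m + 1) x μ) else 0)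
      = -2 * linConv (S.N x) (fun m => k m μ) (fun m => a m μ) (l + (S.s - 1))
        + quadConv (fun m => a m μ) (fun m => a m μ) (l + (S.s - 1)) := by
    split_ifs with hc
    · rw [linConv_eq (h.k_zero μ hμ) (h.a_zero μ hμ) (h.kHat μ hμ) (h.dg μ hμ)
        (A := l - 1) (B := fun m => l - m) (by omega) (by intros; omega),
      quadConv_eq (h.a_zero μ hμ) (h.a_zero μ hμ) (h.dg μ hμ) (h.dg μ hμ)
        (A := l - S.s) (B := fun m => l - S.s - m + 1) (by omega) (by intros; omega)]
    · rw [linConv_eq_zero (h.k_zero μ hμ) ha' (by omega), quadConv_eq_zero ha' ha' (by omega)]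
      ring
  have e2 : (if 2 * S.s + 1 ≤ l then
          ∑ m ∈ Finset.Icc S.s (l - S.s - 1), ∑ n ∈ Finset.Icc 1 (l - S.s - m),
            quad (S.kHat m x μ) (S.dg n x μ) (S.dg (l - S.s - m - n + 1) x μ) else 0)
      = triConv (fun m => k m μ) (fun m => a m μ) (fun m => a m μ) (l + (S.s - 1)) := by
    split_ifs with hc
    · rw [triConv_eq (h.k_zero μ hμ) (h.a_zero μ hμ) (h.a_zero μ hμ) (h.kHat μ hμ) (h.dg μ hμ)
        (h.dg μ hμ) (A := l - S.s - 1) (A' := fun m => l - S.s - m)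
        (B := fun m i => l - S.s - m - i + 1) (by omega) (by intros; omega) (by intros; omega)]
    · rw [triConv_eq_zero (h.k_zero μ hμ) ha' ha' (by omega)]
  rw [e1, e2]
  ring

variable (κ k r a b)

/-- The integrands of the eight contributions to the coupling term of order `n - s`. -/
noncomputable def couplIntegrand (N : Space) (n : ℕ) (μ : ℝ) : Fin 8 → ℝ :=
  let κ := fun m => κ m μ
  let k := fun m => k m μ
  let r := fun m => r m μ
  let a := fun m => a m μ
  let b := fun m => b m μ
  ![2 * quadConv r a n - 2 * linConv N κ a n - 2 * linConv N k r n,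
    2 * quadConv r b n - 2 * linConv N κ b n + 2 * triConv κ r a n + triConv k r r n,
    2 * triConv κ r b n,
    2 * quadConv a b n - 2 * linConv N k b n + 2 * triConv k r a n + triConv κ a a n,
    quadConv b b n + 2 * triConv k r b n + 2 * triConv κ a b n,
    triConv κ b b n,
    2 * triConv k a b n,
    triConv k b b n]

variable {κ k r a b}

theorem boundedCont_couplIntegrand (h : S.Realizes x κ k r a b) (N : Space) (n : ℕ) (i : Fin 8) :
    BoundedCont fun μ => couplIntegrand κ k r a b N n μ i := by
  have two : BoundedCont fun _ => (2 : ℝ) := .const 2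
  fin_cases i
  · exact ((two.mul (boundedCont_quadConv h.r_bdd h.a_bdd n)).sub
      (two.mul (boundedCont_linConv h.κ_bdd h.a_bdd n))).sub
      (two.mul (boundedCont_linConv h.k_bdd h.r_bdd n))
  · exact (((two.mul (boundedCont_quadConv h.r_bdd h.b_bdd n)).sub
      (two.mul (boundedCont_linConv h.κ_bdd h.b_bdd n))).add
      (two.mul (boundedCont_triConv h.κ_bdd h.r_bdd h.a_bdd n))).add
      (boundedCont_triConv h.k_bdd h.r_bdd h.r_bdd n)
  · exact two.mul (boundedCont_triConv h.κ_bdd h.r_bdd h.b_bdd n)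
  · exact (((two.mul (boundedCont_quadConv h.a_bdd h.b_bdd n)).sub
      (two.mul (boundedCont_linConv h.k_bdd h.b_bdd n))).add
      (two.mul (boundedCont_triConv h.k_bdd h.r_bdd h.a_bdd n))).add
      (boundedCont_triConv h.κ_bdd h.a_bdd h.a_bdd n)
  · exact ((boundedCont_quadConv h.b_bdd h.b_bdd n).add
      (two.mul (boundedCont_triConv h.k_bdd h.r_bdd h.b_bdd n))).add
      (two.mul (boundedCont_triConv h.κ_bdd h.a_bdd h.b_bdd n))
  · exact boundedCont_triConv h.κ_bdd h.b_bdd h.b_bdd n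
  · exact two.mul (boundedCont_triConv h.k_bdd h.a_bdd h.b_bdd n)
  · exact boundedCont_triConv h.k_bdd h.b_bdd h.b_bdd n

/-- The coupling term numbered `l` has order `l + s`, and `κ`, `r` start at `1`, `k`, `a` at `s`,
`b` at `s + 1`. The eight groups collect the cross terms with the same lowest order: `s + 1`, `s +
2`, `s + 3`, `2s + 1`, `2s + 2`, `2s + 3`, `3s + 1`, `3s + 2`. Subtracting `s` gives the eight
thresholds; only the first one holds for every `l ≥ 1`, so it needs no vanishing case. -/
theorem couplOne_eq (h : S.Realizes x κ k r a b) {l : ℕ} (hl : 1 ≤ l) :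
    S.couplOne l x = S.range x / 2 * ∫ μ in (0 : ℝ)..1,
      couplIntegrand κ k r a b (S.N x) (l + S.s) μ 0 := by
  have hs := h.one_le
  rw [couplOne]
  refine mul_integral_eq fun μ hμ => ?_
  change _ = 2 * quadConv _ _ _ - 2 * linConv _ _ _ _ - 2 * linConv _ _ _ _
  rw [quadConv_eq (h.r_zero μ hμ) (h.a_zero μ hμ) (h.dr μ hμ) (h.dg μ hμ)
      (A := l) (B := fun m => l - m + 1) (by omega) (by intros; omega),
    linConv_eq (h.κ_zero μ hμ) (h.a_zero μ hμ) (h.kappaHat μ hμ) (h.dg μ hμ)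
      (A := l) (B := fun m => l - m + 1) (by omega) (by intros; omega),
    linConv_eq (h.k_zero μ hμ) (h.r_zero μ hμ) (h.kHat μ hμ) (h.dr μ hμ)
      (A := l + S.s - 1) (B := fun m => l + S.s - m) (by omega) (by intros; omega)]
  ring

theorem couplTwo_eq (h : S.Realizes x κ k r a b) {l : ℕ} (hl : 1 ≤ l) :
    (if 2 ≤ l then S.couplTwo l x else 0) = S.range x / 2 * ∫ μ in (0 : ℝ)..1,
      couplIntegrand κ k r a b (S.N x) (l + S.s) μ 1 := by
  have hs := h.one_le
  split_ifs with hc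
  · rw [couplTwo]
    refine mul_integral_eq fun μ hμ => ?_
    change _ = 2 * quadConv _ _ _ - 2 * linConv _ _ _ _ + 2 * triConv _ _ _ _ + triConv _ _ _ _
    rw [quadConv_eq (h.r_zero μ hμ) (h.b_zero μ hμ) (h.dr μ hμ) (h.dgr μ hμ)
        (A := l - 1) (B := fun m => l - m) (by omega) (by intros; omega),
      linConv_eq (h.κ_zero μ hμ) (h.b_zero μ hμ) (h.kappaHat μ hμ) (h.dgr μ hμ)
        (A := l - 1) (B := fun m => l - m) (by omega) (by intros; omega),
      triConv_eq (h.κ_zero μ hμ) (h.r_zero μ hμ) (h.a_zero μ hμ) (h.kappaHat μ hμ) (h.dr μ hμ)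
        (h.dg μ hμ) (A := l - 1) (A' := fun m => l - m) (B := fun m i => l - m - i + 1)
        (by omega) (by intros; omega) (by intros; omega),
      triConv_eq (h.k_zero μ hμ) (h.r_zero μ hμ) (h.r_zero μ hμ) (h.kHat μ hμ) (h.dr μ hμ)
        (h.dr μ hμ) (A := l + S.s - 2) (A' := fun m => l + S.s - m - 1)
        (B := fun m i => l + S.s - m - i) (by omega) (by intros; omega) (by intros; omega)]
    ring
  · rw [integral_congr_Ioc (g := fun _ => 0) fun μ hμ => ?_]
    · simp
    · have hr' : ∀ i < 1, r i μ = 0 := fun i hi => h.r_zero μ hμ i (by omega)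
      have ha' : ∀ i < S.s, a i μ = 0 := fun i hi => h.a_zero μ hμ i (by omega)
      have hb' : ∀ i < S.s + 1, b i μ = 0 := fun i hi => h.b_zero μ hμ i (by omega)
      change 2 * quadConv _ _ _ - 2 * linConv _ _ _ _ + 2 * triConv _ _ _ _ + triConv _ _ _ _ = 0
      rw [quadConv_eq_zero hr' hb' (by omega), linConv_eq_zero (h.κ_zero μ hμ) hb' (by omega),
        triConv_eq_zero (h.κ_zero μ hμ) hr' ha' (by omega),
        triConv_eq_zero (h.k_zero μ hμ) hr' hr' (by omega)]
      ring

theorem couplThree_eq (h : S.Realizes x κ k r a b) {l : ℕ} (hl : 1 ≤ l) :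
    (if 3 ≤ l then S.couplThree l x else 0) = S.range x / 2 * ∫ μ in (0 : ℝ)..1,
      couplIntegrand κ k r a b (S.N x) (l + S.s) μ 2 := by
  have hs := h.one_le
  split_ifs with hc
  · rw [couplThree]
    refine mul_integral_eq fun μ hμ => ?_
    change _ = 2 * triConv _ _ _ _
    rw [triConv_eq (h.κ_zero μ hμ) (h.r_zero μ hμ) (h.b_zero μ hμ) (h.kappaHat μ hμ) (h.dr μ hμ)
        (h.dgr μ hμ) (A := l - 2) (A' := fun m => l - m - 1) (B := fun m i => l - m - i)
        (by omega) (by intros; omega) (by intros; omega)]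
  · rw [integral_congr_Ioc (g := fun _ => 0) fun μ hμ => ?_]
    · simp
    · have hr' : ∀ i < 1, r i μ = 0 := fun i hi => h.r_zero μ hμ i (by omega)
      have hb' : ∀ i < S.s + 1, b i μ = 0 := fun i hi => h.b_zero μ hμ i (by omega)
      change 2 * triConv _ _ _ _ = 0
      rw [triConv_eq_zero (h.κ_zero μ hμ) hr' hb' (by omega), mul_zero]

theorem couplSOne_eq (h : S.Realizes x κ k r a b) {l : ℕ} (hl : 1 ≤ l) :
    (if S.s + 1 ≤ l then S.couplSOne l x else 0) = S.range x / 2 * ∫ μ in (0 : ℝ)..1,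
      couplIntegrand κ k r a b (S.N x) (l + S.s) μ 3 := by
  have hs := h.one_le
  split_ifs with hc
  · rw [couplSOne]
    refine mul_integral_eq fun μ hμ => ?_
    change _ = 2 * quadConv _ _ _ - 2 * linConv _ _ _ _ + 2 * triConv _ _ _ _ + triConv _ _ _ _
    rw [quadConv_eq (h.a_zero μ hμ) (h.b_zero μ hμ) (h.dg μ hμ) (h.dgr μ hμ)
        (A := l - S.s) (B := fun m => l - S.s - m + 1) (by omega) (by intros; omega),
      linConv_eq (h.k_zero μ hμ) (h.b_zero μ hμ) (h.kHat μ hμ) (h.dgr μ hμ)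
        (A := l - 1) (B := fun m => l - m) (by omega) (by intros; omega),
      triConv_eq (h.k_zero μ hμ) (h.r_zero μ hμ) (h.a_zero μ hμ) (h.kHat μ hμ) (h.dr μ hμ)
        (h.dg μ hμ) (A := l - 1) (A' := fun m => l - m) (B := fun m i => l - m - i + 1)
        (by omega) (by intros; omega) (by intros; omega),
      triConv_eq (h.κ_zero μ hμ) (h.a_zero μ hμ) (h.a_zero μ hμ) (h.kappaHat μ hμ) (h.dg μ hμ)
        (h.dg μ hμ) (A := l - S.s) (A' := fun m => l - S.s - m + 1)
        (B := fun m i => l + 2 - S.s - m - i) (by omega) (by intros; omega) (by intros; omega)]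
    ring
  · rw [integral_congr_Ioc (g := fun _ => 0) fun μ hμ => ?_]
    · simp
    · have hr' : ∀ i < 1, r i μ = 0 := fun i hi => h.r_zero μ hμ i (by omega)
      have ha' : ∀ i < S.s, a i μ = 0 := fun i hi => h.a_zero μ hμ i (by omega)
      have hb' : ∀ i < S.s + 1, b i μ = 0 := fun i hi => h.b_zero μ hμ i (by omega)
      change 2 * quadConv _ _ _ - 2 * linConv _ _ _ _ + 2 * triConv _ _ _ _ + triConv _ _ _ _ = 0
      rw [quadConv_eq_zero ha' hb' (by omega), linConv_eq_zero (h.k_zero μ hμ) hb' (by omega),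
        triConv_eq_zero (h.k_zero μ hμ) hr' ha' (by omega),
        triConv_eq_zero (h.κ_zero μ hμ) ha' ha' (by omega)]
      ring

theorem couplSTwo_eq (h : S.Realizes x κ k r a b) {l : ℕ} (hl : 1 ≤ l) :
    (if S.s + 2 ≤ l then S.couplSTwo l x else 0) = S.range x / 2 * ∫ μ in (0 : ℝ)..1,
      couplIntegrand κ k r a b (S.N x) (l + S.s) μ 4 := by
  have hs := h.one_le
  split_ifs with hc
  · rw [couplSTwo]
    congr 1
    refine integral_congr_Ioc fun μ hμ => ?_
    change _ = quadConv _ _ _ + 2 * triConv _ _ _ _ + 2 * triConv _ _ _ _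
    rw [quadConv_eq (h.b_zero μ hμ) (h.b_zero μ hμ) (h.dgr μ hμ) (h.dgr μ hμ)
        (A := l - S.s - 1) (B := fun m => l - S.s - m) (by omega) (by intros; omega),
      triConv_eq (h.k_zero μ hμ) (h.r_zero μ hμ) (h.b_zero μ hμ) (h.kHat μ hμ) (h.dr μ hμ)
        (h.dgr μ hμ) (A := l - 2) (A' := fun m => l - m - 1) (B := fun m i => l - m - i)
        (by omega) (by intros; omega) (by intros; omega),
      triConv_eq (h.κ_zero μ hμ) (h.a_zero μ hμ) (h.b_zero μ hμ) (h.kappaHat μ hμ) (h.dg μ hμ)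
        (h.dgr μ hμ) (A := l - S.s - 1) (A' := fun m => l - S.s - m)
        (B := fun m i => l - S.s - m - i + 1) (by omega) (by intros; omega) (by intros; omega)]
  · rw [integral_congr_Ioc (g := fun _ => 0) fun μ hμ => ?_]
    · simp
    · have hr' : ∀ i < 1, r i μ = 0 := fun i hi => h.r_zero μ hμ i (by omega)
      have ha' : ∀ i < S.s, a i μ = 0 := fun i hi => h.a_zero μ hμ i (by omega)
      have hb' : ∀ i < S.s + 1, b i μ = 0 := fun i hi => h.b_zero μ hμ i (by omega)
      change quadConv _ _ _ + 2 * triConv _ _ _ _ + 2 * triConv _ _ _ _ = 0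
      rw [quadConv_eq_zero hb' hb' (by omega), triConv_eq_zero (h.k_zero μ hμ) hr' hb' (by omega),
        triConv_eq_zero (h.κ_zero μ hμ) ha' hb' (by omega)]
      ring

theorem couplIntegrand_five (N : Space) (n : ℕ) (μ : ℝ) :
    couplIntegrand κ k r a b N n μ 5
      = triConv (fun m => κ m μ) (fun m => b m μ) (fun m => b m μ) n := by
  simp only [couplIntegrand]
  rfl

theorem couplIntegrand_seven (N : Space) (n : ℕ) (μ : ℝ) :
    couplIntegrand κ k r a b N n μ 7
      = triConv (fun m => k m μ) (fun m => b m μ) (fun m => b m μ) n := by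
  simp only [couplIntegrand]
  rfl

theorem couplSThree_eq (h : S.Realizes x κ k r a b) (l : ℕ) :
    (if S.s + 3 ≤ l then S.couplSThree l x else 0) = S.range x / 2 * ∫ μ in (0 : ℝ)..1,
      couplIntegrand κ k r a b (S.N x) (l + S.s) μ 5 := by
  have hs := h.one_le
  split_ifs with hc
  · rw [couplSThree]
    congr 1
    refine integral_congr_Ioc fun μ hμ => ?_
    rw [couplIntegrand_five, triConv_eq (h.κ_zero μ hμ) (h.b_zero μ hμ) (h.b_zero μ hμ) (h.kappaHat μ hμ)
        (h.dgr μ hμ) (h.dgr μ hμ) (A := l - S.s - 2) (A' := fun m => l - S.s - m - 1)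
        (B := fun m i => l - S.s - m - i) (by omega) (by intros; omega) (by intros; omega)]
  · rw [integral_congr_Ioc (g := fun _ => 0) fun μ hμ => ?_]
    · simp
    · have hb' : ∀ i < S.s + 1, b i μ = 0 := fun i hi => h.b_zero μ hμ i (by omega)
      rw [couplIntegrand_five]
      exact triConv_eq_zero (h.κ_zero μ hμ) hb' hb' (by omega)

theorem couplTwoSOne_eq (h : S.Realizes x κ k r a b) (l : ℕ) :
    (if 2 * S.s + 1 ≤ l then S.couplTwoSOne l x else 0) = S.range x / 2 * ∫ μ in (0 : ℝ)..1,
      couplIntegrand κ k r a b (S.N x) (l + S.s) μ 6 := by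
  have hs := h.one_le
  split_ifs with hc
  · rw [couplTwoSOne]
    refine mul_integral_eq fun μ hμ => ?_
    change _ = 2 * triConv _ _ _ _
    rw [triConv_eq (h.k_zero μ hμ) (h.a_zero μ hμ) (h.b_zero μ hμ) (h.kHat μ hμ) (h.dg μ hμ)
        (h.dgr μ hμ) (A := l - S.s - 1) (A' := fun m => l - S.s - m)
        (B := fun m i => l - S.s - m - i + 1) (by omega) (by intros; omega) (by intros; omega)]
  · rw [integral_congr_Ioc (g := fun _ => 0) fun μ hμ => ?_]
    · simp
    · have ha' : ∀ i < S.s, a i μ = 0 := fun i hi => h.a_zero μ hμ i (by omega)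
      have hb' : ∀ i < S.s + 1, b i μ = 0 := fun i hi => h.b_zero μ hμ i (by omega)
      change 2 * triConv _ _ _ _ = 0
      rw [triConv_eq_zero (h.k_zero μ hμ) ha' hb' (by omega), mul_zero]

theorem couplTwoSTwo_eq (h : S.Realizes x κ k r a b) (l : ℕ) :
    (if 2 * S.s + 2 ≤ l then S.couplTwoSTwo l x else 0) = S.range x / 2 * ∫ μ in (0 : ℝ)..1,
      couplIntegrand κ k r a b (S.N x) (l + S.s) μ 7 := by
  have hs := h.one_le
  split_ifs with hc
  · rw [couplTwoSTwo]
    congr 1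
    refine integral_congr_Ioc fun μ hμ => ?_
    rw [couplIntegrand_seven, triConv_eq (h.k_zero μ hμ) (h.b_zero μ hμ) (h.b_zero μ hμ) (h.kHat μ hμ)
        (h.dgr μ hμ) (h.dgr μ hμ) (A := l - S.s - 2) (A' := fun m => l - S.s - m - 1)
        (B := fun m i => l - S.s - m - i) (by omega) (by intros; omega) (by intros; omega)]
  · rw [integral_congr_Ioc (g := fun _ => 0) fun μ hμ => ?_]
    · simp
    · have hb' : ∀ i < S.s + 1, b i μ = 0 := fun i hi => h.b_zero μ hμ i (by omega)
      rw [couplIntegrand_seven]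
      exact triConv_eq_zero (h.k_zero μ hμ) hb' hb' (by omega)

/-- Bounded continuity on `(0, 1]` allows the eight integrals to be merged, and
`integrandCoeff_coupling` recognises the sum of the integrands as the total coefficient minus the
two separate ones. -/
theorem couplFormula_eq (h : S.Realizes x κ k r a b) {l : ℕ} (hl : 1 ≤ l) :
    S.couplFormula l x = S.range x / 2 * ∫ μ in (0 : ℝ)..1,
      (integrandCoeff ((fun m => κ m μ) + fun m => k m μ) (S.N x)
          ((fun m => r m μ) + (fun m => a m μ) + fun m => b m μ) (l + S.s)
        - integrandCoeff (fun m => k m μ) (S.N x) (fun m => a m μ) (l + S.s)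
        - integrandCoeff (fun m => κ m μ) (S.N x) (fun m => r m μ) (l + S.s)) := by
  rw [couplFormula, h.couplOne_eq hl, h.couplTwo_eq hl, h.couplThree_eq hl, h.couplSOne_eq hl,
    h.couplSTwo_eq hl, h.couplSThree_eq l, h.couplTwoSOne_eq l, h.couplTwoSTwo_eq l]
  simp only [← mul_add]
  congr 1
  have hi : ∀ i ∈ Finset.univ, IntervalIntegrable
      (fun μ => couplIntegrand κ k r a b (S.N x) (l + S.s) μ i) volume 0 1 := fun i _ =>
    (h.boundedCont_couplIntegrand _ _ i).intervalIntegrable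
  have := intervalIntegral.integral_finsetSum hi
  simp only [Fin.sum_univ_eight] at this
  rw [← this]
  refine integral_congr_Ioc fun μ hμ => ?_
  rw [integrandCoeff_coupling _ _ _ _ _ (h.κ_symm μ hμ) (h.k_symm μ hμ)]
  rfl

end Realizes

end RecData

/-! ### Expansions in powers of `ε` of functions of `(ε N₀, εˢ G)` -/

theorem eventually_hasSum_jet {f : ℝ → ℝ} (hf : AnalyticAt ℝ f 0) :
    ∀ᶠ ε in 𝓝 (0 : ℝ), HasSum (fun j : ℕ => coeff j (jet f) * ε ^ j) (f ε) := by
  filter_upwards [hf.hasFPowerSeriesAt.eventually_hasSum] with ε hε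
  simpa [FormalMultilinearSeries.ofScalars, mul_comm] using hε

theorem sum_range_eq_sum_Icc {c : ℕ → ℝ} {a : ℕ} (hc : ∀ j ≤ a, c j = 0) (L : ℕ) (ε : ℝ) :
    ∑ j ∈ Finset.range (L + a + 1), c j * ε ^ j
      = ∑ l ∈ Finset.Icc 1 L, ε ^ (l + a) * c (l + a) := by
  induction L with
  | zero =>
    simp only [zero_add, Finset.Icc_eq_empty (show ¬(1 ≤ 0) by omega), Finset.sum_empty]
    refine Finset.sum_eq_zero fun j hj => ?_
    rw [Finset.mem_range] at hj
    rw [hc j (by omega), zero_mul]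
  | succ L ih =>
    rw [show L + 1 + a + 1 = (L + a + 1) + 1 by omega, Finset.sum_range_succ, ih,
      Finset.sum_Icc_succ_top (by omega), show L + 1 + a = L + a + 1 by omega, mul_comm (c _)]

/-- Rescaling `p` by `k` reparametrises its curve by `ε ↦ ε * k`, so uniqueness of the expansion
forces the factor `k ^ j`. Neither `p` nor its rescaling need lie in the parameter domain. -/
theorem coeff_jet_scale {s : ℕ} {u : ℝ × ℝ → ℝ}
    (hsm : ∀ p, ∃ U : Set ℝ, IsOpen U ∧ (0 : ℝ) ∈ U ∧
      ContDiffOn ℝ ∞ (fun ε => u (scale s ε p)) U) (p : ℝ × ℝ) (k : ℝ) (j : ℕ) :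
    coeff j (jet fun ε => u (scale s ε (scale s k p)))
      = k ^ j * coeff j (jet fun ε => u (scale s ε p)) := by
  obtain ⟨U, hU, h0, hs⟩ := hsm p
  obtain ⟨U', hU', h0', hs'⟩ := hsm (scale s k p)
  have h1 := (hasJet_of_contDiffAt hU h0 hs).comp_mul k
  have h2 := hasJet_of_contDiffAt hU' h0' hs'
  simp only [scale_scale] at h2 ⊢
  rw [h2.unique h1, coeff_mk]

/-- Once the terms are Taylor coefficients shifted by `a`, all three requirements concern one smooth
function of `ε`. The vanishing of the orders `0, …, a` makes a truncation of length `L + a + 1`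
contain exactly the first `L` terms. -/
theorem hasExpansion_of_jet {s a : ℕ} {u : ℝ × ℝ → ℝ} {X : ℝ × ℝ → ℕ → ℝ}
    (hsm : ∀ p, ∃ U : Set ℝ, IsOpen U ∧ (0 : ℝ) ∈ U ∧
      ContDiffOn ℝ ∞ (fun ε => u (scale s ε p)) U)
    (hzero : ∀ p, ∀ j ≤ a, coeff j (jet fun ε => u (scale s ε p)) = 0)
    (hX : ∀ p l, 1 ≤ l → X p l = coeff (l + a) (jet fun ε => u (scale s ε p))) :
    HasExpansion s a u X := by
  have hhom : ∀ (p : ℝ × ℝ) (ε : ℝ) (l : ℕ), 1 ≤ l →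
      X (scale s ε p) l = ε ^ (l + a) * X p l := by
    intro p ε l hl
    rw [hX _ l hl, hX _ l hl, coeff_jet_scale hsm]
  refine ⟨hhom, fun p L => ?_, fun p hp => ?_⟩
  · obtain ⟨U, hU, h0, hs⟩ := hsm p
    refine ((hasJet_of_contDiffAt hU h0 hs).approx (L + a + 1)).congr_left fun ε => ?_
    simp only [id]
    rw [sum_range_eq_sum_Icc (hzero p)]
    congr 1
    refine Finset.sum_congr rfl fun l hl => ?_
    have := (Finset.mem_Icc.1 hl).1
    rw [hhom p ε l this, hX p l this]
  · filter_upwards [eventually_hasSum_jet hp] with ε hε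
    have h1 := (hasSum_nat_add_iff' (a + 1)).2 hε
    rw [Finset.sum_eq_zero fun j hj => by
      rw [hzero p j (by rw [Finset.mem_range] at hj; omega), zero_mul], sub_zero] at h1
    refine h1.congr_fun fun l => ?_
    rw [hhom p ε (l + 1) (by omega), hX p (l + 1) (by omega),
      show l + (a + 1) = l + 1 + a by omega, mul_comm]

/-! ### The delays for a fixed direction in the parameter space -/

/-- The event of the actual path at the position `seg xA x μ`, for the delay `Ξ`. -/
noncomputable def delayedEvent (tA : ℝ) (xA : Space) (Ξ : Space → ℝ) (x : Space) (μ : ℝ) : Event :=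
  event (tA + μ * ‖x - xA‖ + Ξ (seg xA x μ)) (seg xA x μ)

/-- The coefficients of a perturbation along the actual path. -/
noncomputable def pathCoeff (K : ℝ → Event → Tensor) (tA : ℝ) (xA : Space) (f : ℝ → Space → ℝ)
    (x : Space) (j : ℕ) (μ : ℝ) : Tensor :=
  Matrix.of fun α β => coeff j (jet fun ε => K ε (delayedEvent tA xA (f ε) x μ) α β)

theorem grad_eq_zero {D : Set Space} (hD : IsOpen D) {u : Space → ℝ} (hu : ∀ y ∈ D, u y = 0)
    {y : Space} (hy : y ∈ D) : grad u y = 0 := by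
  have h : u =ᶠ[𝓝 y] fun _ => 0 := by
    filter_upwards [hD.mem_nhds hy] with z hz using hu z hz
  funext i
  simp [grad, h.fderiv_eq]

/-- A gradient of order `j` would have to be multiplied by another factor of positive order, so
knowing the gradients to vanish strictly below `j` is enough. This is the inductive step for the
vanishing of the low orders. -/
theorem integrandCoeff_eq_zero {N : Space} {K : ℕ → Tensor} {u : ℕ → Fin 3 → ℝ} {j : ℕ}
    (hj : 1 ≤ j) (hK : ∀ i < j + 1, K i = 0) (hu : ∀ i < j, u i = 0) :
    integrandCoeff K N u j = 0 := by
  rw [integrandCoeff_eq, hK j (by omega), linConv_eq_zero hK hu (by omega),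
    quadConv_eq_zero hu hu (by omega), triConv_eq_zero hK hu hu (by omega)]
  simp

/-- One-parameter families of the total, gravitational and refractive delays, for the
perturbations `κ` and `k`, the latter being of order `s` in the parameter. -/
structure IsDelayFamily (s : ℕ) (tA : ℝ) (xA : Space) (D : Set Space) (U : Set ℝ)
    (κ k : ℝ → Event → Tensor) (f fg fr : ℝ → Space → ℝ) : Prop where
  one_le : 1 ≤ s
  domain : IsReceptionDomain xA D
  isOpen : IsOpen U
  zero_mem : (0 : ℝ) ∈ U
  smooth : IsSmoothFamily U xA D f
  smooth_g : IsSmoothFamily U xA D fg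
  smooth_r : IsSmoothFamily U xA D fr
  zero : ∀ x ∈ D, f 0 x = 0
  zero_g : ∀ x ∈ D, fg 0 x = 0
  zero_r : ∀ x ∈ D, fr 0 x = 0
  κ_path : ∀ x ∈ D, ∀ α β, UnifJet (fun ε μ => κ ε (delayedEvent tA xA (f ε) x μ) α β)
    (fun μ => PowerSeries.mk fun j => pathCoeff κ tA xA f x j μ α β)
  k_path : ∀ x ∈ D, ∀ α β, UnifJet (fun ε μ => k ε (delayedEvent tA xA (f ε) x μ) α β)
    (fun μ => PowerSeries.mk fun j => pathCoeff k tA xA f x j μ α β)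
  κ_symm : ∀ x ∈ D, ∀ μ ∈ Set.Ioc (0 : ℝ) 1, ∀ j, (pathCoeff κ tA xA f x j μ).IsSymm
  k_symm : ∀ x ∈ D, ∀ μ ∈ Set.Ioc (0 : ℝ) 1, ∀ j, (pathCoeff k tA xA f x j μ).IsSymm
  κ_zero : ∀ x ∈ D, ∀ μ ∈ Set.Ioc (0 : ℝ) 1, ∀ j < 1, pathCoeff κ tA xA f x j μ = 0
  k_zero : ∀ x ∈ D, ∀ μ ∈ Set.Ioc (0 : ℝ) 1, ∀ j < s, pathCoeff k tA xA f x j μ = 0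
  eq : ∀ ε ∈ U, IsDelayDrivenBy (fun y => κ ε y + k ε y) tA xA D (f ε) (f ε)
  eq_g : ∀ ε ∈ U, IsDelayDrivenBy (k ε) tA xA D (f ε) (fg ε)
  eq_r : ∀ ε ∈ U, IsDelayDrivenBy (κ ε) tA xA D (f ε) (fr ε)

/-- The coupling delay. -/
def couplDelay (f fg fr : ℝ → Space → ℝ) (ε : ℝ) (y : Space) : ℝ := f ε y - fg ε y - fr ε y

namespace IsDelayFamily

variable {s : ℕ} {tA : ℝ} {xA : Space} {D : Set Space} {U : Set ℝ} {κ k : ℝ → Event → Tensor}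
  {f fg fr : ℝ → Space → ℝ}

theorem smooth_gr (h : IsDelayFamily s tA xA D U κ k f fg fr) :
    IsSmoothFamily U xA D (couplDelay f fg fr) :=
  (h.smooth.sub h.smooth_g).sub h.smooth_r

theorem delayCoeff_r_zero (h : IsDelayFamily s tA xA D U κ k f fg fr) {x : Space} (hx : x ∈ D) :
    delayCoeff fr 0 x = 0 := by simp [delayCoeff, h.zero_r x hx]

theorem delayCoeff_gr_zero (h : IsDelayFamily s tA xA D U κ k f fg fr) {x : Space} (hx : x ∈ D) :
    delayCoeff (couplDelay f fg fr) 0 x = 0 := by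
  simp [delayCoeff, couplDelay, h.zero x hx, h.zero_g x hx, h.zero_r x hx]

theorem delayCoeff_r (h : IsDelayFamily s tA xA D U κ k f fg fr) {x : Space} (hx : x ∈ D)
    (j : ℕ) : delayCoeff fr j x = ‖x - xA‖ / 2 * ∫ μ in (0 : ℝ)..1,
      integrandCoeff (fun m => pathCoeff κ tA xA f x m μ) (dir xA x)
        (fun m => grad (delayCoeff fr m) (seg xA x μ)) j :=
  delayCoeff_eq_integral h.isOpen h.zero_mem h.smooth_r hx (h.κ_path x hx)
    (uc := fun m μ => grad (delayCoeff fr m) (seg xA x μ))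
    (h.smooth_r.unifJet_grad h.isOpen h.zero_mem h.domain hx) (fun ε hε => h.eq_r ε hε x hx) j

theorem delayCoeff_g (h : IsDelayFamily s tA xA D U κ k f fg fr) {x : Space} (hx : x ∈ D)
    (j : ℕ) : delayCoeff fg j x = ‖x - xA‖ / 2 * ∫ μ in (0 : ℝ)..1,
      integrandCoeff (fun m => pathCoeff k tA xA f x m μ) (dir xA x)
        (fun m => grad (delayCoeff fg m) (seg xA x μ)) j :=
  delayCoeff_eq_integral h.isOpen h.zero_mem h.smooth_g hx (h.k_path x hx)
    (uc := fun m μ => grad (delayCoeff fg m) (seg xA x μ))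
    (h.smooth_g.unifJet_grad h.isOpen h.zero_mem h.domain hx) (fun ε hε => h.eq_g ε hε x hx) j

/-- At an order `j < s` the equation contains only perturbation coefficients of order below `s`,
which vanish, and products of gradients of lower order, which vanish by induction. -/
theorem delayCoeff_g_eq_zero (h : IsDelayFamily s tA xA D U κ k f fg fr) {j : ℕ} (hj : j < s) :
    ∀ x ∈ D, delayCoeff fg j x = 0 := by
  induction j using Nat.strong_induction_on with
  | _ j ih =>
    intro x hx
    rcases Nat.eq_zero_or_pos j with rfl | hj0
    · simp [delayCoeff, h.zero_g x hx]
    · rw [h.delayCoeff_g hx, integral_congr_Ioc (g := fun _ => 0) fun μ hμ => ?_]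
      · simp
      · exact integrandCoeff_eq_zero hj0 (fun i hi => h.k_zero x hx μ hμ i (by omega))
          fun i hi => grad_eq_zero h.domain.isOpen (ih i hi (hi.trans hj))
            (seg_mem h.domain hx hμ)

theorem delayCoeff_gr_eq_sub (h : IsDelayFamily s tA xA D U κ k f fg fr) {x : Space}
    (hx : x ∈ D) (j : ℕ) : delayCoeff (couplDelay f fg fr) j x
      = delayCoeff f j x - delayCoeff fg j x - delayCoeff fr j x := by
  have h1 := ((h.smooth.hasJet h.isOpen h.zero_mem hx).sub
    (h.smooth_g.hasJet h.isOpen h.zero_mem hx)).sub (h.smooth_r.hasJet h.isOpen h.zero_mem hx)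
  have h2 := congrArg (coeff j) ((h.smooth_gr.hasJet h.isOpen h.zero_mem hx).unique h1)
  simpa using h2

/-- The gradient of the total delay is expanded as the sum of its three parts, the form in which
`integrandCoeff_coupling` separates the cross terms. -/
theorem unifJet_grad_total (h : IsDelayFamily s tA xA D U κ k f fg fr) {x : Space} (hx : x ∈ D)
    (i : Fin 3) : UnifJet (fun ε μ => grad (f ε) (seg xA x μ) i)
      (fun μ => PowerSeries.mk fun j => (grad (delayCoeff fr j) (seg xA x μ)
        + grad (delayCoeff fg j) (seg xA x μ)
        + grad (delayCoeff (couplDelay f fg fr) j) (seg xA x μ)) i) := by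
  have h1 := ((h.smooth_r.unifJet_grad h.isOpen h.zero_mem h.domain hx i).add
    (h.smooth_g.unifJet_grad h.isOpen h.zero_mem h.domain hx i)).add
    (h.smooth_gr.unifJet_grad h.isOpen h.zero_mem h.domain hx i)
  refine h1.congr ?_ fun μ _ => ?_
  · filter_upwards [h.isOpen.mem_nhds h.zero_mem] with ε hε μ hμ
    have hd : ∀ {g : ℝ → Space → ℝ}, IsSmoothFamily U xA D g →
        DifferentiableAt ℝ (g ε) (seg xA x μ) := fun hg =>
      ((hg.contDiffOn_right hε).contDiffAt
        (h.domain.isOpen.mem_nhds (seg_mem h.domain hx hμ))).differentiableAt (by simp)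
    have h2 : couplDelay f fg fr ε = f ε - fg ε - fr ε := rfl
    simp only [grad]
    rw [h2, fderiv_sub ((hd h.smooth).sub (hd h.smooth_g)) (hd h.smooth_r),
      fderiv_sub (hd h.smooth) (hd h.smooth_g)]
    simp
    ring
  · ext j
    simp

/-- At each order, the gravitational and refractive equations are subtracted from the equation of
the total delay. All three are evaluated on the same delayed path, so the perturbation coefficients
are the same in them. -/
theorem delayCoeff_gr (h : IsDelayFamily s tA xA D U κ k f fg fr) {x : Space} (hx : x ∈ D)
    (j : ℕ) : delayCoeff (couplDelay f fg fr) j x = ‖x - xA‖ / 2 * ∫ μ in (0 : ℝ)..1,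
      (integrandCoeff ((fun m => pathCoeff κ tA xA f x m μ) + fun m => pathCoeff k tA xA f x m μ)
          (dir xA x) ((fun m => grad (delayCoeff fr m) (seg xA x μ))
            + (fun m => grad (delayCoeff fg m) (seg xA x μ))
            + fun m => grad (delayCoeff (couplDelay f fg fr) m) (seg xA x μ)) j
        - integrandCoeff (fun m => pathCoeff k tA xA f x m μ) (dir xA x)
          (fun m => grad (delayCoeff fg m) (seg xA x μ)) j
        - integrandCoeff (fun m => pathCoeff κ tA xA f x m μ) (dir xA x)
          (fun m => grad (delayCoeff fr m) (seg xA x μ)) j) := by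
  have hK : ∀ α β, UnifJet (fun ε μ => (κ ε (delayedEvent tA xA (f ε) x μ)
        + k ε (delayedEvent tA xA (f ε) x μ)) α β) (fun μ => PowerSeries.mk fun j =>
        (pathCoeff κ tA xA f x j μ + pathCoeff k tA xA f x j μ) α β) := by
    intro α β
    refine ((h.κ_path x hx α β).add (h.k_path x hx α β)).congr
      (Eventually.of_forall fun ε μ _ => rfl) fun μ _ => ?_
    ext j
    simp
  have hu := h.unifJet_grad_total hx
  have e1 := delayCoeff_eq_integral h.isOpen h.zero_mem h.smooth hx hK
    (uc := fun j μ => grad (delayCoeff fr j) (seg xA x μ)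
        + grad (delayCoeff fg j) (seg xA x μ)
        + grad (delayCoeff (couplDelay f fg fr) j) (seg xA x μ)) hu
    (fun ε hε => h.eq ε hε x hx) j
  have i1 := ((unifJet_integrand hK (dir xA x) (u := fun ε μ => grad (f ε) (seg xA x μ))
    hu).boundedCont_coeff j).intervalIntegrable
  have i2 := ((unifJet_integrand (h.k_path x hx) (dir xA x)
    (u := fun ε μ => grad (fg ε) (seg xA x μ))
    (h.smooth_g.unifJet_grad h.isOpen h.zero_mem h.domain hx)).boundedCont_coeff j).intervalIntegrable
  have i3 := ((unifJet_integrand (h.κ_path x hx) (dir xA x)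
    (u := fun ε μ => grad (fr ε) (seg xA x μ))
    (h.smooth_r.unifJet_grad h.isOpen h.zero_mem h.domain hx)).boundedCont_coeff j).intervalIntegrable
  simp only [coeff_mk] at i1 i2 i3
  rw [h.delayCoeff_gr_eq_sub hx, e1, h.delayCoeff_g hx, h.delayCoeff_r hx, ← mul_sub, ← mul_sub,
    ← intervalIntegral.integral_sub i1 i2, ← intervalIntegral.integral_sub (i1.sub i2) i3]
  rfl

/-- Cross terms free of the coupling gradient contain both a refractive factor, of order at least
`1`, and a gravitational one, of order at least `s`, so they start at order `s + 1`. The others are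
removed by induction. -/
theorem delayCoeff_gr_eq_zero (h : IsDelayFamily s tA xA D U κ k f fg fr) {j : ℕ} (hj : j ≤ s) :
    ∀ x ∈ D, delayCoeff (couplDelay f fg fr) j x = 0 := by
  have hs := h.one_le
  induction j using Nat.strong_induction_on with
  | _ j ih =>
    intro x hx
    rcases Nat.eq_zero_or_pos j with rfl | hj0
    · exact h.delayCoeff_gr_zero hx
    · rw [h.delayCoeff_gr hx, integral_congr_Ioc (g := fun _ => 0) fun μ hμ => ?_]
      · simp
      · have hy := seg_mem h.domain hx hμ
        have hr : ∀ i < 1, (fun m => grad (delayCoeff fr m) (seg xA x μ)) i = 0 := fun i hi => by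
          obtain rfl : i = 0 := by omega
          exact grad_eq_zero h.domain.isOpen (fun y hy => h.delayCoeff_r_zero hy) hy
        have ha : ∀ i < s, (fun m => grad (delayCoeff fg m) (seg xA x μ)) i = 0 := fun i hi =>
          grad_eq_zero h.domain.isOpen (h.delayCoeff_g_eq_zero hi) hy
        -- Within the induction the coupling gradient is known to vanish only below order `j`. That
        -- suffices, because it is always multiplied by a further factor of positive order.
        have hb : ∀ i < j, (fun m => grad (delayCoeff (couplDelay f fg fr) m) (seg xA x μ)) i = 0 :=
          fun i hi => grad_eq_zero h.domain.isOpen (ih i hi (by omega)) hy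
        have hκ := h.κ_zero x hx μ hμ
        have hk := h.k_zero x hx μ hμ
        rw [integrandCoeff_coupling _ _ _ _ _ (h.κ_symm x hx μ hμ) (h.k_symm x hx μ hμ),
          quadConv_eq_zero hr ha (by omega), linConv_eq_zero hκ ha (by omega),
          linConv_eq_zero hk hr (by omega), quadConv_eq_zero hr hb (by omega),
          linConv_eq_zero hκ hb (by omega), triConv_eq_zero hκ hr ha (by omega),
          triConv_eq_zero hk hr hr (by omega), triConv_eq_zero hκ hr hb (by omega),
          quadConv_eq_zero ha hb (by omega), linConv_eq_zero hk hb (by omega),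
          triConv_eq_zero hk hr ha (by omega), triConv_eq_zero hκ ha ha (by omega),
          quadConv_eq_zero hb hb (by omega), triConv_eq_zero hk hr hb (by omega),
          triConv_eq_zero hκ ha hb (by omega), triConv_eq_zero hκ hb hb (by omega),
          triConv_eq_zero hk ha hb (by omega), triConv_eq_zero hk hb hb (by omega)]
        ring

end IsDelayFamily

/-- The terms of the expansions of the delays. -/
noncomputable def delayTerms (s : ℕ) (f fg fr : ℝ → Space → ℝ) : DelayTerms where
  r l := delayCoeff fr l
  g l := delayCoeff fg (l + (s - 1))
  gr l := delayCoeff (couplDelay f fg fr) (l + s)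

namespace IsDelayFamily

variable {s : ℕ} {tA : ℝ} {xA : Space} {D : Set Space} {U : Set ℝ} {κ k : ℝ → Event → Tensor}
  {f fg fr : ℝ → Space → ℝ}

/-- The step functions `Θ` suppress only coefficients that vanish anyway, so the total term is the
plain Taylor coefficient of `Ξ`. -/
theorem total_eq (h : IsDelayFamily s tA xA D U κ k f fg fr) {x : Space} (hx : x ∈ D) (l : ℕ) :
    (delayTerms s f fg fr).total s l x = delayCoeff f l x := by
  have hs := h.one_le
  have h1 : (if s ≤ l then (delayTerms s f fg fr).g (l - s + 1) x else 0)
      = delayCoeff fg l x := by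
    split_ifs with hc
    · simp only [delayTerms]
      rw [show l - s + 1 + (s - 1) = l by omega]
    · exact (h.delayCoeff_g_eq_zero (by omega) x hx).symm
  have h2 : (if s + 1 ≤ l then (delayTerms s f fg fr).gr (l - s) x else 0)
      = delayCoeff (couplDelay f fg fr) l x := by
    split_ifs with hc
    · simp only [delayTerms]
      rw [show l - s + s = l by omega]
    · exact (h.delayCoeff_gr_eq_zero (by omega) x hx).symm
  rw [DelayTerms.total, h1, h2, h.delayCoeff_gr_eq_sub hx]
  simp only [delayTerms]
  ring

/-- Explains the emission functions: they are the Taylor coefficients of `Ξⁿ / n!`, where `Ξ` has no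
term of order zero. -/
theorem phi_eq (h : IsDelayFamily s tA xA D U κ k f fg fr) {S : RecData} (hSs : S.s = s)
    (hX : S.X = delayTerms s f fg fr) {y : Space} (hy : y ∈ D) (j n : ℕ) (hn : n ≤ j) :
    S.Phi j n y = coeff j ((PowerSeries.mk fun j => delayCoeff f j y) ^ n)
      / (n.factorial : ℝ) := by
  have hZ : coeff 0 (PowerSeries.mk fun j => delayCoeff f j y) = 0 := by
    simp [delayCoeff, h.zero y hy]
  rw [coeff_pow_of_constantCoeff_eq_zero hZ, if_pos hn, RecData.Phi, hX, hSs]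
  simp only [h.total_eq hy, coeff_mk]
  ring

theorem realizes (h : IsDelayFamily s tA xA D U κ k f fg fr) {S : RecData} (hSs : S.s = s)
    (hxA : S.xA = xA) (hX : S.X = delayTerms s f fg fr) {x : Space} (hx : x ∈ D)
    (hκ : ∀ μ ∈ Set.Ioc (0 : ℝ) 1, ∀ m, 1 ≤ m → S.kappaHat m x μ = pathCoeff κ tA xA f x m μ)
    (hk : ∀ μ ∈ Set.Ioc (0 : ℝ) 1, ∀ m, S.s ≤ m → S.kHat m x μ = pathCoeff k tA xA f x m μ) :
    S.Realizes x (pathCoeff κ tA xA f x) (pathCoeff k tA xA f x)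
      (fun m μ => grad (delayCoeff fr m) (seg xA x μ))
      (fun m μ => grad (delayCoeff fg m) (seg xA x μ))
      (fun m μ => grad (delayCoeff (couplDelay f fg fr) m) (seg xA x μ)) where
  one_le := by
    rw [hSs]
    exact h.one_le
  kappaHat := hκ
  kHat := hk
  dr μ _ j := by
    rw [RecData.dr, hX, hxA]
    rfl
  dg μ _ j := by
    rw [RecData.dg, hX, hxA, hSs]
    rfl
  dgr μ _ j := by
    rw [RecData.dgr, hX, hxA, hSs]
    rfl
  κ_zero := h.κ_zero x hx
  k_zero := by
    rw [hSs]
    exact h.k_zero x hx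
  r_zero μ hμ i hi := by
    obtain rfl : i = 0 := by omega
    exact grad_eq_zero h.domain.isOpen (fun y hy => h.delayCoeff_r_zero hy)
      (seg_mem h.domain hx hμ)
  a_zero μ hμ i hi := by
    have hs := h.one_le
    exact grad_eq_zero h.domain.isOpen (h.delayCoeff_g_eq_zero (by omega))
      (seg_mem h.domain hx hμ)
  b_zero μ hμ i hi :=
    grad_eq_zero h.domain.isOpen (h.delayCoeff_gr_eq_zero (by omega)) (seg_mem h.domain hx hμ)
  κ_symm := h.κ_symm x hx
  k_symm := h.k_symm x hx
  κ_bdd m α β := by simpa using (h.κ_path x hx α β).boundedCont_coeff m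
  k_bdd m α β := by simpa using (h.k_path x hx α β).boundedCont_coeff m
  r_bdd m i := by
    simpa using (h.smooth_r.unifJet_grad h.isOpen h.zero_mem h.domain hx i).boundedCont_coeff m
  a_bdd m i := by
    simpa using (h.smooth_g.unifJet_grad h.isOpen h.zero_mem h.domain hx i).boundedCont_coeff m
  b_bdd m i := by
    simpa using (h.smooth_gr.unifJet_grad h.isOpen h.zero_mem h.domain hx i).boundedCont_coeff m

/-- The recursive formulas for the terms of the expansions. -/
theorem formulas (h : IsDelayFamily s tA xA D U κ k f fg fr) {S : RecData} (hSs : S.s = s)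
    (hxA : S.xA = xA) (hX : S.X = delayTerms s f fg fr) {x : Space} (hx : x ∈ D)
    (hκ : ∀ μ ∈ Set.Ioc (0 : ℝ) 1, ∀ m, 1 ≤ m → S.kappaHat m x μ = pathCoeff κ tA xA f x m μ)
    (hk : ∀ μ ∈ Set.Ioc (0 : ℝ) 1, ∀ m, S.s ≤ m → S.kHat m x μ = pathCoeff k tA xA f x m μ)
    {l : ℕ} (hl : 1 ≤ l) :
    (delayTerms s f fg fr).r l x = S.refrFormula l x ∧
      (delayTerms s f fg fr).g l x = S.gravFormula l x ∧
      (delayTerms s f fg fr).gr l x = S.couplFormula l x := by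
  have hR := h.realizes hSs hxA hX hx hκ hk
  rw [hR.refrFormula_eq hl, hR.gravFormula_eq hl, hR.couplFormula_eq hl, RecData.range, RecData.N,
    hxA, hSs]
  exact ⟨h.delayCoeff_r hx l, h.delayCoeff_g hx _, h.delayCoeff_gr hx _⟩

end IsDelayFamily

/-! ### The perturbations of the metric along the actual path -/

/-- A smooth symmetric perturbation `K`, depending on a parameter `u` and vanishing for `u = 0`,
with the terms of its expansion at `u = k`. -/
structure IsPerturbation (V : Set ℝ) (M : Set Event) (K : ℝ → Event → Tensor) (k : ℝ)
    (term : ℕ → Event → Tensor) : Prop where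
  isOpen_param : IsOpen V
  zero_mem : (0 : ℝ) ∈ V
  isOpen : IsOpen M
  smooth : ∀ α β, ContDiffOn ℝ ∞ (fun q : ℝ × Event => K q.1 q.2 α β) (V ×ˢ M)
  symm : ∀ u ∈ V, ∀ y ∈ M, (K u y).IsSymm
  zero : ∀ y ∈ M, K 0 y = 0
  term_eq : ∀ y ∈ M, ∀ m α β, term m y α β = k ^ m * coeff m (jet fun u => K u y α β)

namespace IsPerturbation

theorem refr {P : Set (ℝ × ℝ)} (hP : IsOpen P) (hP0 : (0 : ℝ × ℝ) ∈ P) {M : Set Event}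
    (hM : IsOpen M) {n : ℝ → Event → ℝ} {w : ℝ → Event → Fin 4 → ℝ}
    (κ_smooth : ∀ α β, ContDiffOn ℝ ∞
      (fun q : (ℝ × ℝ) × Event => refrPert n w q.1.1 q.2 α β) (P ×ˢ M))
    (n_zero : ∀ y ∈ M, n 0 y = 1) (N₀ : ℝ) :
    IsPerturbation (Prod.fst '' P) M (refrPert n w) N₀ (kappaTerm n w N₀) where
  isOpen_param := isOpenMap_fst P hP
  zero_mem := ⟨0, hP0, rfl⟩
  isOpen := hM
  smooth α β := by
    -- A point of the projection lifts to some `p ∈ P`; freezing the second parameter at its value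
    -- there stays in `P` locally, and smoothness is local.
    rintro ⟨_, y⟩ ⟨⟨p, hp, rfl⟩, hy⟩
    have h1 := (κ_smooth α β).contDiffAt ((hP.prod hM).mem_nhds (x := (p, y)) ⟨hp, hy⟩)
    exact (ContDiffAt.comp (p.1, y) (f := fun q : ℝ × Event => ((q.1, p.2), q.2)) h1
      (by fun_prop)).contDiffWithinAt
  symm u _ y _ := refrPert_isSymm n w u y
  zero y hy := refrPert_zero (n_zero y hy)
  term_eq y _ m α β := by
    simp [kappaTerm]
    ring

theorem grav {P : Set (ℝ × ℝ)} (hP : IsOpen P) (hP0 : (0 : ℝ × ℝ) ∈ P) {M : Set Event}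
    (hM : IsOpen M) {h : ℝ → Event → Tensor}
    (h_smooth : ∀ α β, ContDiffOn ℝ ∞ (fun q : (ℝ × ℝ) × Event => h q.1.2 q.2 α β) (P ×ˢ M))
    (h_symm : ∀ p ∈ P, ∀ y ∈ M, (h p.2 y).IsSymm)
    (h_det : ∀ p ∈ P, ∀ y ∈ M, (minkowski + h p.2 y).det ≠ 0)
    (h_zero : ∀ y ∈ M, h 0 y = 0) (G : ℝ) :
    IsPerturbation (Prod.snd '' P) M (gravPert h) G (kTerm h G) := by
  have key : ∀ K : ℝ → Event → ℝ, ContDiffOn ℝ ∞ (fun q : (ℝ × ℝ) × Event => K q.1.2 q.2)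
      (P ×ˢ M) → ContDiffOn ℝ ∞ (fun q : ℝ × Event => K q.1 q.2) ((Prod.snd '' P) ×ˢ M) := by
    rintro K hK ⟨_, y⟩ ⟨⟨p, hp, rfl⟩, hy⟩
    have h1 := hK.contDiffAt ((hP.prod hM).mem_nhds (x := (p, y)) ⟨hp, hy⟩)
    exact (ContDiffAt.comp (p.2, y) (f := fun q : ℝ × Event => ((p.1, q.1), q.2)) h1
      (by fun_prop)).contDiffWithinAt
  have hV : IsOpen (Prod.snd '' P) := isOpenMap_snd P hP
  have h0 : (0 : ℝ) ∈ Prod.snd '' P := ⟨0, hP0, rfl⟩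
  have hk := fun α β => key (fun u y => gravPert h u y α β) (contDiffOn_gravPert h_smooth h_det α β)
  refine ⟨hV, h0, hM, hk, ?_, fun y hy => gravPert_zero (h_zero y hy), fun y hy m α β => ?_⟩
  · rintro _ ⟨p, hp, rfl⟩ y hy
    exact gravPert_isSymm (h_symm p hp y hy)
  · have slice : ∀ K : ℝ → Event → ℝ, ContDiffOn ℝ ∞ (fun q : ℝ × Event => K q.1 q.2)
        ((Prod.snd '' P) ×ˢ M) → ContDiffOn ℝ ∞ (fun u => K u y) (Prod.snd '' P) := fun K hK =>
      hK.comp (f := fun u : ℝ => (u, y)) (by fun_prop) fun u hu => ⟨hu, hy⟩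
    refine kTerm_eq hV h0 (fun α β => slice (fun u y => h u y α β)
      (key (fun u y => h u y α β) (h_smooth α β))) (fun α β => slice (fun u y => gravPert h u y α β) (hk α β)) ?_
      (h_zero y hy) G m α β
    rintro _ ⟨p, hp, rfl⟩
    exact h_det p hp y hy

section Path

variable {V : Set ℝ} {M : Set Event} {K : ℝ → Event → Tensor} {k : ℝ}
  {term : ℕ → Event → Tensor} {U : Set ℝ} {tA : ℝ} {xA : Space} {D : Set Space}
  {f : ℝ → Space → ℝ} {σ : ℕ}

theorem differentiableAt (h : IsPerturbation V M K k term) {u : ℝ} (hu : u ∈ V) {y : Event}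
    (hy : y ∈ M) (α β : Fin 4) : DifferentiableAt ℝ (fun y => K u y α β) y := by
  have h1 := (h.smooth α β).contDiffAt
    ((h.isOpen_param.prod h.isOpen).mem_nhds (x := (u, y)) ⟨hu, hy⟩)
  exact (ContDiffAt.comp y (f := fun z : Event => (u, z)) h1 (by fun_prop)).differentiableAt
    (by simp)

theorem unifJet (h : IsPerturbation V M K k term) (hU : IsOpen U) (h0 : (0 : ℝ) ∈ U)
    (hUV : ∀ ε ∈ U, ε ^ σ * k ∈ V) (hf : IsSmoothFamily U xA D f)
    (hmem : ∀ ε ∈ U, ∀ x ∈ D, ∀ μ ∈ Set.Icc (0 : ℝ) 1, delayedEvent tA xA (f ε) x μ ∈ M)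
    {x : Space} (hx : x ∈ D) (α β : Fin 4) :
    UnifJet (fun ε μ => K (ε ^ σ * k) (delayedEvent tA xA (f ε) x μ) α β)
      (fun μ => PowerSeries.mk fun j =>
        pathCoeff (fun ε => K (ε ^ σ * k)) tA xA f x j μ α β) := by
  have h1 : ContDiffOn ℝ ∞ (fun q : ℝ × ℝ =>
      K (q.1 ^ σ * k) (delayedEvent tA xA (f q.1) x q.2) α β) (U ×ˢ Set.Icc 0 1) := by
    refine (h.smooth α β).comp
      (f := fun q : ℝ × ℝ => (q.1 ^ σ * k, delayedEvent tA xA (f q.1) x q.2))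
      (ContDiffOn.prodMk (by fun_prop) (contDiffOn_event ?_ ?_))
      fun q hq => ⟨hUV _ hq.1, hmem _ hq.1 x hx _ hq.2⟩
    · exact ContDiffOn.add (by fun_prop) (hf.contDiffOn_seg hx)
    · unfold seg
      fun_prop
  refine (unifJet_of_contDiffOn hU h0 h1).congr (Eventually.of_forall fun ε μ _ => rfl)
    fun μ _ => ?_
  ext j
  simp [pathCoeff]

theorem isSymm_pathCoeff (h : IsPerturbation V M K k term) (hU : IsOpen U) (h0 : (0 : ℝ) ∈ U)
    (hUV : ∀ ε ∈ U, ε ^ σ * k ∈ V)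
    (hmem : ∀ ε ∈ U, ∀ x ∈ D, ∀ μ ∈ Set.Icc (0 : ℝ) 1, delayedEvent tA xA (f ε) x μ ∈ M)
    {x : Space} (hx : x ∈ D) {μ : ℝ} (hμ : μ ∈ Set.Ioc (0 : ℝ) 1) (j : ℕ) :
    (pathCoeff (fun ε => K (ε ^ σ * k)) tA xA f x j μ).IsSymm := by
  ext α β
  simp only [Matrix.transpose_apply, pathCoeff, Matrix.of_apply]
  congr 1
  refine jet_congr ?_
  filter_upwards [hU.mem_nhds h0] with ε hε
  exact (h.symm _ (hUV ε hε) _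
    (hmem ε hε x hx μ (Set.Ioc_subset_Icc_self hμ))).apply α β

/-- At `ε = 0` the delay vanishes and the actual path is the Minkowskian one, so the latter lies in
`M` without a separate assumption. -/
theorem event_mem (hD : IsReceptionDomain xA D) (h0 : (0 : ℝ) ∈ U) (hf0 : ∀ x ∈ D, f 0 x = 0)
    (hmem : ∀ ε ∈ U, ∀ x ∈ D, ∀ μ ∈ Set.Icc (0 : ℝ) 1, delayedEvent tA xA (f ε) x μ ∈ M)
    {x : Space} (hx : x ∈ D) {μ : ℝ} (hμ : μ ∈ Set.Ioc (0 : ℝ) 1) :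
    event (tA + μ * ‖x - xA‖) (seg xA x μ) ∈ M := by
  have := hmem 0 h0 x hx μ (Set.Ioc_subset_Icc_self hμ)
  rwa [delayedEvent, hf0 _ (seg_mem hD hx hμ), add_zero] at this

theorem pathCoeff_eq_zero (h : IsPerturbation V M K k term) (hD : IsReceptionDomain xA D)
    (hU : IsOpen U) (h0 : (0 : ℝ) ∈ U)
    (hUV : ∀ ε ∈ U, ε ^ σ * k ∈ V) (hf : IsSmoothFamily U xA D f) (hf0 : ∀ x ∈ D, f 0 x = 0)
    (hmem : ∀ ε ∈ U, ∀ x ∈ D, ∀ μ ∈ Set.Icc (0 : ℝ) 1, delayedEvent tA xA (f ε) x μ ∈ M)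
    (hσ : 1 ≤ σ) {x : Space} (hx : x ∈ D) {μ : ℝ} (hμ : μ ∈ Set.Ioc (0 : ℝ) 1) {j : ℕ}
    (hj : j < σ) : pathCoeff (fun ε => K (ε ^ σ * k)) tA xA f x j μ = 0 := by
  have hy := seg_mem hD hx hμ
  ext α β
  have h1 := coeff_path_eq_zero h.isOpen h.isOpen_param h.zero_mem (h.smooth α β)
    (fun y hy => by rw [h.zero y hy]; rfl) (fun y hy m => h.term_eq y hy m α β)
    (event_mem hD h0 hf0 hmem hx hμ) (hf.hasJet hU h0 hy) (by simp [delayCoeff, hf0 _ hy]) hσ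
    ((h.unifJet hU h0 hUV hf hmem hx α β).hasJet_at hμ) hj
  simpa using h1

theorem pathCoeff_eq_hat (h : IsPerturbation V M K k term) (hD : IsReceptionDomain xA D)
    (hU : IsOpen U) (h0 : (0 : ℝ) ∈ U)
    (hUV : ∀ ε ∈ U, ε ^ σ * k ∈ V) (hf : IsSmoothFamily U xA D f) (hf0 : ∀ x ∈ D, f 0 x = 0)
    (hmem : ∀ ε ∈ U, ∀ x ∈ D, ∀ μ ∈ Set.Icc (0 : ℝ) 1, delayedEvent tA xA (f ε) x μ ∈ M)
    (hσ : 1 ≤ σ) {x : Space} (hx : x ∈ D) {μ : ℝ} (hμ : μ ∈ Set.Ioc (0 : ℝ) 1)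
    {φ : ℕ → ℕ → ℝ} (hφ : ∀ j n, 1 ≤ n → n ≤ j → φ j n
      = coeff j ((PowerSeries.mk fun j => delayCoeff f j (seg xA x μ)) ^ n) / (n.factorial : ℝ))
    {l : ℕ} (hl : σ ≤ l) (α β : Fin 4) :
    pathCoeff (fun ε => K (ε ^ σ * k)) tA xA f x l μ α β
      = (if l % σ = 0 then term (l / σ) (event (tA + μ * ‖x - xA‖) (seg xA x μ)) α β
        else ∑ n ∈ Finset.Icc 1 (l % σ), φ (l % σ) n
          * timeDeriv n (fun y => term (l / σ) y α β) (event (tA + μ * ‖x - xA‖) (seg xA x μ)))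
      + ∑ m ∈ Finset.Icc 1 (l / σ - 1), ∑ n ∈ Finset.Icc 1 (m * σ + l % σ),
          φ (m * σ + l % σ) n * timeDeriv n (fun y => term (l / σ - m) y α β)
            (event (tA + μ * ‖x - xA‖) (seg xA x μ)) := by
  have hy := seg_mem hD hx hμ
  have h1 := coeff_path_eq_hat (term := fun m y => term m y α β) h.isOpen h.isOpen_param
    h.zero_mem (h.smooth α β)
    (fun y hy => by rw [h.zero y hy]; rfl) (fun y hy m => h.term_eq y hy m α β)
    (event_mem hD h0 hf0 hmem hx hμ) (hf.hasJet hU h0 hy) (by simp [delayCoeff, hf0 _ hy]) hσ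
    ((h.unifJet hU h0 hUV hf hmem hx α β).hasJet_at hμ) hφ hl
  rwa [coeff_mk] at h1

end Path

end IsPerturbation

/-- For `μ > 0` the event is the endpoint of the ray that arrives at the position `seg xA x μ`. For
`μ = 0` it is the emission event, by `R xA = 0`. Both lie on rays contained in `M`. -/
theorem IsEmissionRange.delayedEvent_mem {ginv : Event → Tensor} {M : Set Event} {tA : ℝ}
    {xA : Space} {D : Set Space} {R : Space → ℝ} (hD : IsReceptionDomain xA D)
    (hR : IsEmissionRange ginv M tA xA D R) (hR0 : R xA = 0) {x : Space} (hx : x ∈ D) {μ : ℝ}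
    (hμ : μ ∈ Set.Icc (0 : ℝ) 1) : delayedEvent tA xA (delay xA R) x μ ∈ M := by
  obtain ⟨γ, k, O, -, -, -, -, hray⟩ := hR
  rcases hμ.1.eq_or_lt with rfl | h0
  · have h1 := (hray x hx).1.mem 0 ⟨le_rfl, zero_le_one⟩
    rw [(hray x hx).2.1] at h1
    simpa [delayedEvent, seg, delay, hR0] using h1
  · have hy := seg_mem hD hx ⟨h0, hμ.2⟩
    have h1 := (hray _ hy).1.mem 1 ⟨zero_le_one, le_rfl⟩
    rw [(hray _ hy).2.2] at h1
    rw [delayedEvent, delay, norm_seg_sub hμ.1]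
    convert h1 using 2
    ring

/-- The expansions in `ε` of the delays, from the one-parameter families of the delays. -/
theorem hasExpansion_delays {s : ℕ} {tA : ℝ} {xA : Space} {D : Set Space}
    {Ξ Ξg Ξr : ℝ × ℝ → Space → ℝ} {U : ℝ × ℝ → Set ℝ} {κ k : ℝ × ℝ → ℝ → Event → Tensor}
    (H : ∀ p, IsDelayFamily s tA xA D (U p) (κ p) (k p) (fun ε => Ξ (scale s ε p))
      (fun ε => Ξg (scale s ε p)) (fun ε => Ξr (scale s ε p)))
    {X : ℝ × ℝ → DelayTerms} (hX : ∀ p, X p = delayTerms s (fun ε => Ξ (scale s ε p))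
      (fun ε => Ξg (scale s ε p)) (fun ε => Ξr (scale s ε p))) {x : Space} (hx : x ∈ D) :
    HasExpansion s 0 (fun p => Ξ p x) (fun p l => (X p).total s l x) ∧
      HasExpansion s 0 (fun p => Ξr p x) (fun p l => (X p).r l x) ∧
      HasExpansion s (s - 1) (fun p => Ξg p x) (fun p l => (X p).g l x) ∧
      HasExpansion s s (fun p => Ξ p x - Ξg p x - Ξr p x) (fun p l => (X p).gr l x) := by
  refine ⟨hasExpansion_of_jet (fun p => ⟨U p, (H p).isOpen, (H p).zero_mem,
      (H p).smooth.contDiffOn_left hx⟩) (fun p j hj => ?_) fun p l _ => ?_,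
    hasExpansion_of_jet (fun p => ⟨U p, (H p).isOpen, (H p).zero_mem,
      (H p).smooth_r.contDiffOn_left hx⟩) (fun p j hj => ?_) fun p l _ => ?_,
    hasExpansion_of_jet (fun p => ⟨U p, (H p).isOpen, (H p).zero_mem,
      (H p).smooth_g.contDiffOn_left hx⟩) (fun p j hj => ?_) fun p l _ => ?_,
    hasExpansion_of_jet (fun p => ⟨U p, (H p).isOpen, (H p).zero_mem,
      (H p).smooth_gr.contDiffOn_left hx⟩) (fun p j hj => ?_) fun p l _ => ?_⟩
  · obtain rfl : j = 0 := by omega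
    simp [(H p).zero x hx]
  · rw [hX, (H p).total_eq hx]
    rfl
  · obtain rfl : j = 0 := by omega
    simp [(H p).zero_r x hx]
  · rw [hX]
    rfl
  · have := (H p).one_le
    exact (H p).delayCoeff_g_eq_zero (j := j) (by omega) x hx
  · rw [hX]
    rfl
  · exact (H p).delayCoeff_gr_eq_zero hj x hx
  · rw [hX]
    rfl

/-- The delays along the curve `ε ↦ (ε N₀, εˢ G)` of parameters, `p = (N₀, G)`. -/
structure IsDelaySystem (s : ℕ) (tA : ℝ) (xA : Space) (D : Set Space) (M : Set Event)
    (P : Set (ℝ × ℝ)) (κ k : ℝ → Event → Tensor) (κterm kterm : ℝ → ℕ → Event → Tensor)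
    (Ξ Ξg Ξr : ℝ × ℝ → Space → ℝ) : Prop where
  one_le : 1 ≤ s
  domain : IsReceptionDomain xA D
  isOpen : IsOpen P
  zero_mem : (0 : ℝ × ℝ) ∈ P
  κ_pert : ∀ N₀, IsPerturbation (Prod.fst '' P) M κ N₀ (κterm N₀)
  k_pert : ∀ G, IsPerturbation (Prod.snd '' P) M k G (kterm G)
  mem : ∀ p ∈ P, ∀ x ∈ D, ∀ μ ∈ Set.Icc (0 : ℝ) 1, delayedEvent tA xA (Ξ p) x μ ∈ M
  qm : IsQuasiMinkowskian xA D P Ξ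
  qm_g : IsQuasiMinkowskian xA D P Ξg
  qm_r : IsQuasiMinkowskian xA D P Ξr
  eq : ∀ p ∈ P, IsDelayDrivenBy (fun y => κ p.1 y + k p.2 y) tA xA D (Ξ p) (Ξ p)
  eq_g : ∀ p ∈ P, IsDelayDrivenBy (k p.2) tA xA D (Ξ p) (Ξg p)
  eq_r : ∀ p ∈ P, IsDelayDrivenBy (κ p.1) tA xA D (Ξ p) (Ξr p)

namespace IsDelaySystem

variable {s : ℕ} {tA : ℝ} {xA : Space} {D : Set Space} {M : Set Event} {P : Set (ℝ × ℝ)}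
  {κ k : ℝ → Event → Tensor} {κterm kterm : ℝ → ℕ → Event → Tensor} {Ξ Ξg Ξr : ℝ × ℝ → Space → ℝ}

theorem isOpen_scale (h : IsDelaySystem s tA xA D M P κ k κterm kterm Ξ Ξg Ξr) (p : ℝ × ℝ) :
    IsOpen {ε | scale s ε p ∈ P} :=
  h.isOpen.preimage (contDiff_scale s p).continuous

theorem zero_mem_scale (h : IsDelaySystem s tA xA D M P κ k κterm kterm Ξ Ξg Ξr) (p : ℝ × ℝ) :
    (0 : ℝ) ∈ {ε | scale s ε p ∈ P} := by
  rw [Set.mem_ofPred_eq, scale_zero h.one_le]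
  exact h.zero_mem

theorem fst_mem {ε : ℝ} {p : ℝ × ℝ} (hε : scale s ε p ∈ P) : ε ^ 1 * p.1 ∈ Prod.fst '' P :=
  ⟨_, hε, by simp [scale]⟩

theorem snd_mem {ε : ℝ} {p : ℝ × ℝ} (hε : scale s ε p ∈ P) : ε ^ s * p.2 ∈ Prod.snd '' P :=
  ⟨_, hε, rfl⟩

theorem zero (h : IsDelaySystem s tA xA D M P κ k κterm kterm Ξ Ξg Ξr)
    {u : ℝ × ℝ → Space → ℝ} (hu : IsQuasiMinkowskian xA D P u) (p : ℝ × ℝ) :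
    ∀ x ∈ D, u (scale s 0 p) x = 0 := by
  rw [scale_zero h.one_le]
  exact hu.zero

/-- Writing the refractive parameter as `ε ^ 1 * p.1` makes both perturbations instances of the same
lemmas, with `σ = 1` and `σ = s`. -/
theorem isDelayFamily (h : IsDelaySystem s tA xA D M P κ k κterm kterm Ξ Ξg Ξr) (p : ℝ × ℝ) :
    IsDelayFamily s tA xA D {ε | scale s ε p ∈ P} (fun ε => κ (ε ^ 1 * p.1))
      (fun ε => k (ε ^ s * p.2)) (fun ε => Ξ (scale s ε p)) (fun ε => Ξg (scale s ε p))
      (fun ε => Ξr (scale s ε p)) where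
  one_le := h.one_le
  domain := h.domain
  isOpen := h.isOpen_scale p
  zero_mem := h.zero_mem_scale p
  smooth := h.qm.isSmoothFamily s p
  smooth_g := h.qm_g.isSmoothFamily s p
  smooth_r := h.qm_r.isSmoothFamily s p
  zero := h.zero h.qm p
  zero_g := h.zero h.qm_g p
  zero_r := h.zero h.qm_r p
  κ_path _ hx α β := (h.κ_pert p.1).unifJet (h.isOpen_scale p) (h.zero_mem_scale p)
    (fun _ => fst_mem) (h.qm.isSmoothFamily s p) (fun _ => h.mem _) hx α β
  k_path _ hx α β := (h.k_pert p.2).unifJet (h.isOpen_scale p) (h.zero_mem_scale p)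
    (fun _ => snd_mem) (h.qm.isSmoothFamily s p) (fun _ => h.mem _) hx α β
  κ_symm _ hx _ hμ j := (h.κ_pert p.1).isSymm_pathCoeff (h.isOpen_scale p) (h.zero_mem_scale p)
    (fun _ => fst_mem) (fun _ => h.mem _) hx hμ j
  k_symm _ hx _ hμ j := (h.k_pert p.2).isSymm_pathCoeff (h.isOpen_scale p) (h.zero_mem_scale p)
    (fun _ => snd_mem) (fun _ => h.mem _) hx hμ j
  κ_zero _ hx _ hμ _ hj := (h.κ_pert p.1).pathCoeff_eq_zero h.domain (h.isOpen_scale p)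
    (h.zero_mem_scale p) (fun _ => fst_mem) (h.qm.isSmoothFamily s p) (h.zero h.qm p)
    (fun _ => h.mem _) le_rfl hx hμ hj
  k_zero _ hx _ hμ _ hj := (h.k_pert p.2).pathCoeff_eq_zero h.domain (h.isOpen_scale p)
    (h.zero_mem_scale p) (fun _ => snd_mem) (h.qm.isSmoothFamily s p) (h.zero h.qm p)
    (fun _ => h.mem _) h.one_le hx hμ hj
  eq ε hε := by
    simp only [pow_one]
    exact h.eq _ hε
  eq_g ε hε := h.eq_g _ hε
  eq_r ε hε := by
    simp only [pow_one]
    exact h.eq_r _ hε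

theorem formulas (h : IsDelaySystem s tA xA D M P κ k κterm kterm Ξ Ξg Ξr) (p : ℝ × ℝ)
    {S : RecData} (hS : S = ⟨s, tA, xA, κterm p.1, kterm p.2,
      delayTerms s (fun ε => Ξ (scale s ε p)) (fun ε => Ξg (scale s ε p))
        (fun ε => Ξr (scale s ε p))⟩) {l : ℕ} (hl : 1 ≤ l) {x : Space} (hx : x ∈ D) :
    S.X.r l x = S.refrFormula l x ∧ S.X.g l x = S.gravFormula l x ∧
      S.X.gr l x = S.couplFormula l x := by
  have hF := h.isDelayFamily p
  have hSs : S.s = s := by rw [hS]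
  have hSX : S.X = delayTerms s (fun ε => Ξ (scale s ε p)) (fun ε => Ξg (scale s ε p))
      (fun ε => Ξr (scale s ε p)) := by rw [hS]
  have hφ : ∀ μ ∈ Set.Ioc (0 : ℝ) 1, ∀ i m, 1 ≤ m → m ≤ i → S.Phi i m (seg xA x μ)
      = coeff i ((PowerSeries.mk fun j => delayCoeff (fun ε => Ξ (scale s ε p)) j
          (seg xA x μ)) ^ m) / (m.factorial : ℝ) :=
    fun μ hμ i m _ hmi => hF.phi_eq hSs hSX (seg_mem h.domain hx hμ) i m hmi
  rw [hSX]
  refine hF.formulas hSs (by rw [hS]) hSX hx (fun μ hμ m hm => ?_) (fun μ hμ m hm => ?_) hl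
  · ext α β
    rw [(h.κ_pert p.1).pathCoeff_eq_hat h.domain (h.isOpen_scale p) (h.zero_mem_scale p)
      (fun _ => fst_mem) (h.qm.isSmoothFamily s p) (h.zero h.qm p) (fun _ => h.mem _) le_rfl hx hμ
      (hφ μ hμ) hm α β]
    subst hS
    -- For `σ = 1` the remainder is zero and the quotient is the order itself, so the general
    -- expression collapses to the refractive one.
    simp [RecData.kappaHat, RecData.path, Nat.mod_one]
  · ext α β
    rw [hSs] at hm
    rw [(h.k_pert p.2).pathCoeff_eq_hat h.domain (h.isOpen_scale p) (h.zero_mem_scale p)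
      (fun _ => snd_mem) (h.qm.isSmoothFamily s p) (h.zero h.qm p) (fun _ => h.mem _) h.one_le hx
      hμ (hφ μ hμ) hm α β]
    subst hS
    rfl

end IsDelaySystem

end OpticalDelay

theorem theorem11
    -- ordering integer, emission event, reception positions, spacetime region, parameters (N₀, G)
    (s : ℕ) (hs : 1 ≤ s) (tA : ℝ) (xA : OpticalDelay.Space)
    (D : Set OpticalDelay.Space) (hD : OpticalDelay.IsReceptionDomain xA D)
    (M : Set OpticalDelay.Event) (hM : IsOpen M)
    (P : Set (ℝ × ℝ)) (hP : IsOpen P) (hP0 : (0 : ℝ × ℝ) ∈ P)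
    -- gravitational perturbation of the metric
    (h : ℝ → OpticalDelay.Event → OpticalDelay.Tensor)
    (h_smooth : ∀ α β, ContDiffOn ℝ ∞
      (fun q : (ℝ × ℝ) × OpticalDelay.Event => h q.1.2 q.2 α β) (P ×ˢ M))
    (h_symm : ∀ p ∈ P, ∀ y ∈ M, (h p.2 y).IsSymm)
    (h_det : ∀ p ∈ P, ∀ y ∈ M, (OpticalDelay.minkowski + h p.2 y).det ≠ 0)
    (h_zero : ∀ y ∈ M, h 0 y = 0)
    -- index of refraction and velocity of the medium
    (n : ℝ → OpticalDelay.Event → ℝ) (w : ℝ → OpticalDelay.Event → Fin 4 → ℝ)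
    (κ_smooth : ∀ α β, ContDiffOn ℝ ∞
      (fun q : (ℝ × ℝ) × OpticalDelay.Event => OpticalDelay.refrPert n w q.1.1 q.2 α β) (P ×ˢ M))
    (n_zero : ∀ y ∈ M, n 0 y = 1)
    -- emission range transfer function
    (R : ℝ × ℝ → OpticalDelay.Space → ℝ)
    (R_range : ∀ p ∈ P,
      OpticalDelay.IsEmissionRange (OpticalDelay.opticalInv h n w p) M tA xA D (R p))
    (R_zero : ∀ p ∈ P, R p xA = 0)
    (Ξ_qm : OpticalDelay.IsQuasiMinkowskian xA D P (fun p => OpticalDelay.delay xA (R p)))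
    -- gravitational and refractive delay functions
    (Ξg Ξr : ℝ × ℝ → OpticalDelay.Space → ℝ)
    (Ξg_eq : ∀ p ∈ P, OpticalDelay.IsDelayDrivenBy (OpticalDelay.gravPert h p.2) tA xA D
      (OpticalDelay.delay xA (R p)) (Ξg p))
    (Ξr_eq : ∀ p ∈ P, OpticalDelay.IsDelayDrivenBy (OpticalDelay.refrPert n w p.1) tA xA D
      (OpticalDelay.delay xA (R p)) (Ξr p))
    (Ξg_qm : OpticalDelay.IsQuasiMinkowskian xA D P Ξg)
    (Ξr_qm : OpticalDelay.IsQuasiMinkowskian xA D P Ξr) :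
    ∃ X : ℝ × ℝ → OpticalDelay.DelayTerms,
      -- the terms are given by the recursive line integrals
      (∀ (p : ℝ × ℝ) (S : OpticalDelay.RecData),
        S = ⟨s, tA, xA, OpticalDelay.kappaTerm n w p.1, OpticalDelay.kTerm h p.2, X p⟩ →
        ∀ l : ℕ, 1 ≤ l → ∀ x ∈ D,
          (X p).r l x = S.refrFormula l x ∧
          (X p).g l x = S.gravFormula l x ∧
          (X p).gr l x = S.couplFormula l x) ∧
      -- the total, refractive, gravitational and coupling delays are the sums of the terms
      ∀ x ∈ D,
        OpticalDelay.HasExpansion s 0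
          (fun p => OpticalDelay.delay xA (R p) x) (fun p l => (X p).total s l x) ∧
        OpticalDelay.HasExpansion s 0 (fun p => Ξr p x) (fun p l => (X p).r l x) ∧
        OpticalDelay.HasExpansion s (s - 1) (fun p => Ξg p x) (fun p l => (X p).g l x) ∧
        OpticalDelay.HasExpansion s s
          (fun p => OpticalDelay.delay xA (R p) x - Ξg p x - Ξr p x)
          (fun p l => (X p).gr l x) := by
  have hκ := OpticalDelay.IsPerturbation.refr hP hP0 hM κ_smooth n_zero
  have hk := OpticalDelay.IsPerturbation.grav hP hP0 hM h_smooth h_symm h_det h_zero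
  have heq : ∀ p ∈ P, OpticalDelay.IsDelayDrivenBy
      (fun y => OpticalDelay.refrPert n w p.1 y + OpticalDelay.gravPert h p.2 y) tA xA D
      (OpticalDelay.delay xA (R p)) (OpticalDelay.delay xA (R p)) := by
    intro p hp
    have hp1 : p.1 ∈ Prod.fst '' P := ⟨p, hp, rfl⟩
    have hp2 : p.2 ∈ Prod.snd '' P := ⟨p, hp, rfl⟩
    -- With weight `1` the curve passes through `p` at `ε = 1`, so the family statements specialise
    -- to smoothness of the single function `delay xA (R p)`.
    have hsm := Ξ_qm.isSmoothFamily 1 p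
    have hp' : (1 : ℝ) ∈ {ε | OpticalDelay.scale 1 ε p ∈ P} := by
      simpa [OpticalDelay.scale] using hp
    have h1 : OpticalDelay.scale 1 1 p = p := by simp [OpticalDelay.scale]
    have hd := hsm.contDiffOn_right hp'
    have hseg := fun (x : OpticalDelay.Space) (hx : x ∈ D) => (hsm.contDiffOn_seg hx).comp
      (f := fun μ : ℝ => ((1 : ℝ), μ)) (s := Set.Icc 0 1) (by fun_prop) fun μ hμ => ⟨hp', hμ⟩
    simp only [Function.comp_def, h1] at hd hseg
    refine OpticalDelay.IsEmissionRange.isDelayDrivenBy (M := M) hD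
      (fun y hy => ((hκ p.1).symm _ hp1 y hy).add ((hk p.2).symm _ hp2 y hy))
      (fun y hy α β => ((hκ p.1).differentiableAt hp1 hy α β).fun_add
        ((hk p.2).differentiableAt hp2 hy α β)) ?_ (R_zero p hp)
      (hd.differentiableOn (by simp)) fun x hx => (hseg x hx).of_le (by simp)
    convert R_range p hp using 1
    funext y
    simp only [OpticalDelay.opticalInv]
    abel
  have H : OpticalDelay.IsDelaySystem s tA xA D M P (OpticalDelay.refrPert n w)
      (OpticalDelay.gravPert h) (OpticalDelay.kappaTerm n w) (OpticalDelay.kTerm h)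
      (fun p => OpticalDelay.delay xA (R p)) Ξg Ξr :=
    ⟨hs, hD, hP, hP0, hκ, hk, fun p hp x hx μ hμ =>
      (R_range p hp).delayedEvent_mem hD (R_zero p hp) hx hμ, Ξ_qm, Ξg_qm, Ξr_qm, heq, Ξg_eq,
      Ξr_eq⟩
  -- The witnesses are Taylor coefficients at `ε = 0`. They are meaningful for all `p`, including `p
  -- ∉ P`, because the curve through `scale s ε p` is in `P` for small `ε`.
  refine ⟨fun p => OpticalDelay.delayTerms s
    (fun ε => OpticalDelay.delay xA (R (OpticalDelay.scale s ε p)))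
    (fun ε => Ξg (OpticalDelay.scale s ε p)) (fun ε => Ξr (OpticalDelay.scale s ε p)), ?_,
    fun x hx => OpticalDelay.hasExpansion_delays (Ξ := fun p => OpticalDelay.delay xA (R p))
      H.isDelayFamily (fun _ => rfl) hx⟩
  intro p S hS l hl x hx
  have h1 := H.formulas p hS hl hx
  rwa [show S.X = _ by rw [hS]] at h1
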